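/- **Setting.** Let $\{(X_t,Y_t,Z_t)\}_{t\in\mathbb Z}$ be a process with values in $\mathbb R^{d_x}\times\mathbb R^{d_y}\times\mathbb R^{d_z}$ on a probability space. Fix an integer $p\ge 1$ and put $$W_t=\big(X_s,Y_{s-1},Z_{s-1}\big)_{s=t-p+1}^{t}\in\mathbb R^{d_w},\qquad d_w=p(d_x+d_y+d_z),\qquad d=d_w+d_y+d_z.$$ Inequalities between vectors are componentwise. $F_{Y|W},F_{Z|W},F_{Y,Z|W}$ are the conditional distribution functions of $Y_t$, $Z_t$, $(Y_t,Z_t)$ given $W_t$, and $f_W$ is the density of $W_t$. Let $\mathcal W\subset\mathbb R^{d_w}$ be bounded and let $\varphi:\mathbb R^{d_w}\times\mathbb R^{d_w}\to\mathbb R$ or $\mathbb C$ be measurable in its first argument for each $w\in\mathcal W$. For a function $k:\mathbb R\to\mathbb R$, $K(u)=\prod_{j=1}^{d_w}k(u_j)$ and bandwidths $h=h_n>0$ let $$S_n(w,y,z)=\frac1{\sqrt n\,(n-1)h^{d_w}}\sum_{t=1}^n\sum_{s\ne t}K\Big(\frac{W_t-W_s}{h}\Big)\varphi(W_t,w)\,1(Y_t\le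 y)\big(1(Z_t\le z)-1(Z_s\le z)\big),$$ $$CvM_n=\frac1n\sum_{t=1}^n|S_n(W_t,Y_t,Z_t)|^2,\qquad KS_n=\sup_{(w,y,z)\in\mathcal W\times\mathbb R^{d_y}\times\mathbb R^{d_z}}|S_n(w,y,z)|.$$ **Assumptions.** * (Markov) For all $t,y,z$, a.s. $P(Y_t\le y,Z_t\le z\mid \sigma(X_s,Y_{s-1},Z_{s-1}:s\le t))=P(Y_t\le y,Z_t\le z\mid W_t)$. * (A1) $\{(X_t,Y_t,Z_t)\}$ is strictly stationary and strongly mixing, with mixing coefficients satisfying $\sum_{s\ge1}s^{2m-1}\alpha(s)^{\eta/(2m+\eta)}<\infty$ for some integer $m\ge1$ and some $\eta>0$ with $m\ge\frac{d+\sqrt{d^2+4\eta d}}4\vee\frac{(d+\eta-1)+\sqrt{(d+\eta-1)^2+4(d-2)\eta}}4$. * (A2) $\varphi(u,w)$ is bounded uniformly over $u$ in the support of $W_t$ and $w\in\mathcal W$; $u\mapsto\varphi(u,w)$ is continuous on $\mathcal W$ for each $w\in\mathcal W$; and $|\varphi(u,w)-\varphi(u,w')|\le C_\varphi(u)|w-w'|^\nu$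 for $u$ in the support of $W_t$ and $w,w'\in\mathcal W$, with some $\nu\in(0,1]$ and $E\,C_\varphi(W_t)^2<\infty$. * (A3) $k$ is bounded, measurable and symmetric, and for some $l$: $\int u^ik(u)\,du=\delta_{0i}$ for $0\le i\le l-1$ and $\int u^lk(u)\,du\ne0$ (all these integrals converging absolutely). * (A4) $h\to0$, $nh^{2d_w}/\log^\xi n\to\infty$ for some $\xi>0$, and $nh^{2l}\to0$. * (A5) For each $r\ge1$ the vectors $(W_{i_1},\dots,W_{i_r})$, with indices $i_a\ge1$ at mutual distance at least $p$ (so that the windows do not overlap), have joint densities bounded by a constant depending on $r$ only. * (A6) $Y_t$ and $Z_t$ have bounded densities. * (A7) There are $\bar\nu>4(1+\frac2\eta)\big(\frac{d_y}{d_y+1}+\frac{d_z}{d_z+1}\big)$, $\bar\nu>0$, and $C$ with $E\,C(W_t)^2<\infty$ such that for all $y,y'$ there is a distribution function $G_{y,y'}$ with $|F_{Y|W}(y|W_t)-F_{Y|W}(y'|W_t)|\le C(W_t)|G_{y,y'}(y)-G_{y,y'}(y')|^{\bar\nu}$ a.s.; and the same (with its own $\bar\nu$, $C$) for $F_{Z|W}$.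 * (Regularity) $W_t$ is a.s. bounded, or $|k(u)|\le g(|u|)$ for a nonincreasing $g$ on $[0,\infty)$ with $\int g(|u|)\,du<\infty$. The alternative $\mathrm H_1$ is the negation of $\mathrm H_0$: for all $(y,z)$, $F_{Y,Z|W}(y,z|W_t)=F_{Y|W}(y|W_t)F_{Z|W}(z|W_t)$ a.s. Call $\varphi$ *comprehensively revealing* (CR) on $\mathcal W$ if for every bounded measurable $g:\mathbb R^{d_w}\to\mathbb R$ with $P(g(W_t)\neq0)>0$ there is $w\in\mathcal W$ with $E[\varphi(W_t,w)g(W_t)]\ne0$, and *generically comprehensively revealing* (GCR) if for every such $g$ this holds for Lebesgue-almost every $w\in\mathcal W$. **Theorem 2.** Assume the above and $\mathrm H_1$. 1. For each $(w,y,z)\in\mathcal W\times\mathbb R^{d_y}\times\mathbb R^{d_z}$, $$n^{-1/2}S_n(w,y,z)\xrightarrow{P}E\big[\varphi(W_t,w)\big(F_{Y,Z|W}(y,z|W_t)-F_{Y|W}(y|W_t)F_{Z|W}(z|W_t)\big)f_W(W_t)\big].$$ 2. If $\varphi$ is CR on $\mathcal W$, or GCR on $\mathcal W$ and $\mathcal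 W$ has nonempty interior, then $n^{-1/2}KS_n$ converges in probability to a positive constant. Consequently $KS_n\to\infty$ in probability, and the test that rejects for $KS_n>\kappa_n$ is consistent: $P(KS_n\le\kappa_n)\to0$ for all (possibly random) critical values $\kappa_n=O_p(1)$. 3. If $\varphi$ is GCR on $\mathcal W$ and $W_t\in\mathcal W$ a.s., then $n^{-1}CvM_n$ converges in probability to a positive constant. Consequently $CvM_n\to\infty$ in probability, and $P(CvM_n\le\kappa_n)\to0$ for all critical values $\kappa_n=O_p(1)$. -/

import Mathlib

open MeasureTheory ProbabilityTheory Filter Topology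
open scoped ENNReal NNReal

noncomputable section

namespace CondIndepTest

/-- Coordinates of `W_t`: `p` lags of a vector of dimension `dx + dy + dz`. -/
abbrev WIdx (p dx dy dz : ℕ) : Type := Fin p × (Fin dx ⊕ Fin dy ⊕ Fin dz)

/-- The space `ℝ^{d_w}`, `d_w = p (dx + dy + dz)`, with componentwise order and Lebesgue measure. -/
abbrev WSpace (p dx dy dz : ℕ) : Type := WIdx p dx dy dz → ℝ

/-- `d_w = p (dx + dy + dz)`. -/
def dimW (p dx dy dz : ℕ) : ℕ := p * (dx + dy + dz)

section Series

variable {Ω : Type*} {dx dy dz : ℕ}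

/-- `W_t = (X_s, Y_{s-1}, Z_{s-1})_{s = t-p+1, …, t}`; the lag `j` corresponds to `s = t - j`. -/
def condVec (X : ℤ → Ω → Fin dx → ℝ) (Y : ℤ → Ω → Fin dy → ℝ) (Z : ℤ → Ω → Fin dz → ℝ)
    (p : ℕ) (t : ℤ) (ω : Ω) : WSpace p dx dy dz := fun i =>
  match i.2 with
  | Sum.inl a => X (t - (i.1 : ℕ)) ω a
  | Sum.inr (Sum.inl b) => Y (t - (i.1 : ℕ) - 1) ω b
  | Sum.inr (Sum.inr c) => Z (t - (i.1 : ℕ) - 1) ω c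

/-- The observed vector `(X_t, Y_t, Z_t)`. -/
def obs (X : ℤ → Ω → Fin dx → ℝ) (Y : ℤ → Ω → Fin dy → ℝ) (Z : ℤ → Ω → Fin dz → ℝ)
    (t : ℤ) (ω : Ω) : (Fin dx → ℝ) × (Fin dy → ℝ) × (Fin dz → ℝ) := (X t ω, Y t ω, Z t ω)

/-- `σ(V_s : s ≤ t)`. -/
abbrev sigmaPast {E : Type*} [MeasurableSpace E] (V : ℤ → Ω → E) (t : ℤ) : MeasurableSpace Ω :=
  ⨆ s : ℤ, ⨆ _ : s ≤ t, MeasurableSpace.comap (V s) inferInstance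

/-- `σ(V_s : t ≤ s)`. -/
abbrev sigmaFuture {E : Type*} [MeasurableSpace E] (V : ℤ → Ω → E) (t : ℤ) : MeasurableSpace Ω :=
  ⨆ s : ℤ, ⨆ _ : t ≤ s, MeasurableSpace.comap (V s) inferInstance

variable [MeasurableSpace Ω]

/-- Strict stationarity: the law of the whole trajectory is invariant under the time shift. -/
def StrictlyStationary {E : Type*} [MeasurableSpace E] (μ : Measure Ω) (V : ℤ → Ω → E) : Prop :=
  μ.map (fun ω (t : ℤ) => V (t + 1) ω) = μ.map (fun ω (t : ℤ) => V t ω)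

/-- The strong (`α`-) mixing coefficient at distance `s`. -/
def alphaMix {E : Type*} [MeasurableSpace E] (μ : Measure Ω) (V : ℤ → Ω → E) (s : ℕ) : ℝ :=
  sSup {r : ℝ | ∃ (t : ℤ) (A B : Set Ω), MeasurableSet[sigmaPast V t] A ∧
    MeasurableSet[sigmaFuture V (t + s)] B ∧ r = |μ.real (A ∩ B) - μ.real A * μ.real B|}

/-- The Markov property: given `σ(X_s, Y_{s-1}, Z_{s-1} : s ≤ t)`, the law of `(Y_t, Z_t)` depends
on `W_t` only. -/
def MarkovProperty (μ : Measure Ω) (X : ℤ → Ω → Fin dx → ℝ) (Y : ℤ → Ω → Fin dy → ℝ)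
    (Z : ℤ → Ω → Fin dz → ℝ) (p : ℕ) : Prop :=
  ∀ (t : ℤ) (y : Fin dy → ℝ) (z : Fin dz → ℝ),
    μ[{ω | Y t ω ≤ y ∧ Z t ω ≤ z}.indicator (fun _ => (1 : ℝ)) |
        sigmaPast (fun s ω => (X s ω, Y (s - 1) ω, Z (s - 1) ω)) t]
      =ᵐ[μ]
    μ[{ω | Y t ω ≤ y ∧ Z t ω ≤ z}.indicator (fun _ => (1 : ℝ)) |
        MeasurableSpace.comap (condVec X Y Z p t) inferInstance]

/-- Strict stationarity and strong mixing with a rate. -/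
def MixingAssumption (μ : Measure Ω) (X : ℤ → Ω → Fin dx → ℝ) (Y : ℤ → Ω → Fin dy → ℝ)
    (Z : ℤ → Ω → Fin dz → ℝ) (p m : ℕ) (η : ℝ) : Prop :=
  StrictlyStationary μ (obs X Y Z) ∧ 0 < m ∧ 0 < η ∧
  Summable (fun s : ℕ => ((s : ℝ) + 1) ^ (2 * m - 1) *
    alphaMix μ (obs X Y Z) (s + 1) ^ (η / (2 * m + η))) ∧
  (let d : ℝ := ((dimW p dx dy dz + dy + dz : ℕ) : ℝ)
   max ((d + √(d ^ 2 + 4 * η * d)) / 4)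
     (((d + η - 1) + √((d + η - 1) ^ 2 + 4 * (d - 2) * η)) / 4) ≤ m)

/-- Conditions on the weight function `φ(W, w)`, `w ∈ 𝒲`, where `ν` is the Hölder exponent;
`P` is the law of `W_t`. -/
def WeightAssumption {ι 𝕜 : Type*} [Fintype ι] [RCLike 𝕜] (P : Measure (ι → ℝ)) (𝒲 : Set (ι → ℝ))
    (φ : (ι → ℝ) → (ι → ℝ) → 𝕜) (ν : ℝ) : Prop :=
  (∀ w ∈ 𝒲, Measurable fun u => φ u w) ∧
  (∃ B : ℝ, ∀ u ∈ P.support, ∀ w ∈ 𝒲, ‖φ u w‖ ≤ B) ∧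
  (∀ w ∈ 𝒲, ContinuousOn (fun u => φ u w) 𝒲) ∧
  0 < ν ∧ ν ≤ 1 ∧
  ∃ C : (ι → ℝ) → ℝ, Measurable C ∧ MemLp C 2 P ∧
    ∀ u ∈ P.support, ∀ w ∈ 𝒲, ∀ w' ∈ 𝒲, ‖φ u w - φ u w'‖ ≤ C u * ‖w - w'‖ ^ ν

/-- `k` is a bounded symmetric kernel of order `l`. -/
def KernelAssumption (k : ℝ → ℝ) (l : ℕ) : Prop :=
  Measurable k ∧ (∃ B : ℝ, ∀ x, |k x| ≤ B) ∧ (∀ x, k (-x) = k x) ∧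
  (∀ i < l, Integrable (fun x => x ^ i * k x) ∧
    ∫ x, x ^ i * k x = if i = 0 then 1 else 0) ∧
  Integrable (fun x => x ^ l * k x) ∧ ∫ x, x ^ l * k x ≠ 0

/-- Conditions on the bandwidth; `dw = d_w`. -/
def BandwidthAssumption (h : ℕ → ℝ) (dw l : ℕ) : Prop :=
  (∀ n, 0 < h n) ∧ Tendsto h atTop (𝓝 0) ∧
  (∃ ξ : ℝ, 0 < ξ ∧
    Tendsto (fun n : ℕ => n * h n ^ (2 * dw) / Real.log n ^ ξ) atTop atTop) ∧
  Tendsto (fun n : ℕ => n * h n ^ (2 * l)) atTop (𝓝 0)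

/-- The measure `P` has a Lebesgue density bounded by `M`. -/
def HasDensityLE {E : Type*} [MeasureSpace E] (P : Measure E) (M : ℝ≥0) : Prop :=
  ∃ f : E → ℝ≥0∞, Measurable f ∧ (∀ x, f x ≤ M) ∧ P = volume.withDensity f

/-- For each `r` the joint densities of `(W_{i_1}, …, W_{i_r})` are bounded.
`W_s` and `W_t` share coordinates when `|s - t| < p`, so that a joint density exists only for
indices at distance at least `p` (for `p = 1`: distinct indices). -/
def JointDensityAssumption (μ : Measure Ω) (X : ℤ → Ω → Fin dx → ℝ) (Y : ℤ → Ω → Fin dy → ℝ)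
    (Z : ℤ → Ω → Fin dz → ℝ) (p : ℕ) : Prop :=
  ∀ r : ℕ, 0 < r → ∃ M : ℝ≥0, ∀ i : Fin r → ℤ, (∀ a, 1 ≤ i a) →
    (∀ a b, a ≠ b → (p : ℤ) ≤ |i a - i b|) →
    HasDensityLE (μ.map fun ω (a : Fin r) => condVec X Y Z p (i a) ω) M

/-- `Y_t` and `Z_t` have bounded densities. -/
def MarginalDensityAssumption (μ : Measure Ω) (Y : ℤ → Ω → Fin dy → ℝ) (Z : ℤ → Ω → Fin dz → ℝ) : Prop :=
  (∃ M : ℝ≥0, HasDensityLE (μ.map (Y 0)) M) ∧ (∃ M : ℝ≥0, HasDensityLE (μ.map (Z 0)) M)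

/-- The conditional distribution function `u ↦ F_{Y|W}(y|u)` of `Y` given `W = u`. -/
def condCDF {d : ℕ} {ι : Type*} (μ : Measure Ω) [IsFiniteMeasure μ] (Y : Ω → Fin d → ℝ)
    (W : Ω → ι → ℝ) (y : Fin d → ℝ) (u : ι → ℝ) : ℝ :=
  (condDistrib Y W μ u).real (Set.Iic y)

/-- The joint conditional distribution function `u ↦ F_{Y,Z|W}(y,z|u)`. -/
def condCDF₂ {ι : Type*} (μ : Measure Ω) [IsFiniteMeasure μ] (Y : Ω → Fin dy → ℝ)
    (Z : Ω → Fin dz → ℝ) (W : Ω → ι → ℝ) (y : Fin dy → ℝ) (z : Fin dz → ℝ) (u : ι → ℝ) : ℝ :=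
  (condDistrib (fun ω => (Y ω, Z ω)) W μ u).real (Set.Iic y ×ˢ Set.Iic z)

/-- The Hölder condition for `F_{Y|W}`, with `c` the lower bound for the exponent;
the distribution function `G_{y,y'}` is given by a probability measure `G`. -/
def HolderCDF {d : ℕ} {ι : Type*} (μ : Measure Ω) [IsFiniteMeasure μ] (Y : Ω → Fin d → ℝ)
    (W : Ω → ι → ℝ) (c : ℝ) : Prop :=
  ∃ (ν : ℝ) (C : (ι → ℝ) → ℝ), 0 < ν ∧ c < ν ∧ Measurable C ∧ MemLp C 2 (μ.map W) ∧
    ∀ y y' : Fin d → ℝ, ∃ G : Measure (Fin d → ℝ), IsProbabilityMeasure G ∧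
      ∀ᵐ u ∂(μ.map W), |condCDF μ Y W y u - condCDF μ Y W y' u|
        ≤ C u * |G.real (Set.Iic y) - G.real (Set.Iic y')| ^ ν

/-- Hölder conditions for both conditional distribution functions; `η` is that of the mixing rate. -/
def HolderAssumption (μ : Measure Ω) [IsFiniteMeasure μ] (X : ℤ → Ω → Fin dx → ℝ)
    (Y : ℤ → Ω → Fin dy → ℝ) (Z : ℤ → Ω → Fin dz → ℝ) (p : ℕ) (η : ℝ) : Prop :=
  HolderCDF μ (Y 0) (condVec X Y Z p 0)
    (4 * (1 + 2 / η) * ((dy : ℝ) / (dy + 1) + (dz : ℝ) / (dz + 1))) ∧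
  HolderCDF μ (Z 0) (condVec X Y Z p 0)
    (4 * (1 + 2 / η) * ((dy : ℝ) / (dy + 1) + (dz : ℝ) / (dz + 1)))

/-- The null hypothesis: `Y_t` and `Z_t` are conditionally independent given `W_t`. -/
def NullHypothesis (μ : Measure Ω) [IsFiniteMeasure μ] (X : ℤ → Ω → Fin dx → ℝ)
    (Y : ℤ → Ω → Fin dy → ℝ) (Z : ℤ → Ω → Fin dz → ℝ) (p : ℕ) : Prop :=
  ∀ (y : Fin dy → ℝ) (z : Fin dz → ℝ), ∀ᵐ u ∂(μ.map (condVec X Y Z p 0)),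
    condCDF₂ μ (Y 0) (Z 0) (condVec X Y Z p 0) y z u
      = condCDF μ (Y 0) (condVec X Y Z p 0) y u * condCDF μ (Z 0) (condVec X Y Z p 0) z u

/-- `E[φ(W_t, w) (F_{Y,Z|W}(y,z|W_t) - F_{Y|W}(y|W_t) F_{Z|W}(z|W_t)) f_W(W_t)]`, at `t = 0`
(by stationarity it does not depend on `t`). -/
def limitFun {𝕜 : Type*} [RCLike 𝕜] (μ : Measure Ω) [IsFiniteMeasure μ]
    (X : ℤ → Ω → Fin dx → ℝ) (Y : ℤ → Ω → Fin dy → ℝ) (Z : ℤ → Ω → Fin dz → ℝ) (p : ℕ)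
    (φ : WSpace p dx dy dz → WSpace p dx dy dz → 𝕜)
    (w : WSpace p dx dy dz) (y : Fin dy → ℝ) (z : Fin dz → ℝ) : 𝕜 :=
  let W := condVec X Y Z p 0
  ∫ ω, φ (W ω) w *
    (((condCDF₂ μ (Y 0) (Z 0) W y z (W ω) - condCDF μ (Y 0) W y (W ω) * condCDF μ (Z 0) W z (W ω))
      * (pdf W μ volume (W ω)).toReal : ℝ) : 𝕜) ∂μ

end Series

section Statistics

variable {Ω : Type*} {dx dy dz : ℕ} {𝕜 : Type*} [RCLike 𝕜]

/-- The product kernel `K(u) = ∏ k(u_j)`. -/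
def prodKernel {ι : Type*} [Fintype ι] (k : ℝ → ℝ) (u : ι → ℝ) : ℝ := ∏ j, k (u j)

open Classical in
/-- The indicator `1(a ≤ b)` of the componentwise order. -/
def ind {d : ℕ} (a b : Fin d → ℝ) : ℝ := if a ≤ b then 1 else 0

/-- The leave-one-out density estimator `f̂_W(W_t)`. -/
def fHat (X : ℤ → Ω → Fin dx → ℝ) (Y : ℤ → Ω → Fin dy → ℝ) (Z : ℤ → Ω → Fin dz → ℝ) (p : ℕ)
    (k : ℝ → ℝ) (h : ℕ → ℝ) (n : ℕ) (t : ℤ) (ω : Ω) : ℝ :=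
  1 / (((n : ℝ) - 1) * h n ^ dimW p dx dy dz) *
    ∑ s ∈ (Finset.Icc (1 : ℤ) n).erase t,
      prodKernel k ((h n)⁻¹ • (condVec X Y Z p t ω - condVec X Y Z p s ω))

/-- The leave-one-out estimator `F̂_{Z|W}(z|W_t)`. -/
def FHat (X : ℤ → Ω → Fin dx → ℝ) (Y : ℤ → Ω → Fin dy → ℝ) (Z : ℤ → Ω → Fin dz → ℝ) (p : ℕ)
    (k : ℝ → ℝ) (h : ℕ → ℝ) (n : ℕ) (z : Fin dz → ℝ) (t : ℤ) (ω : Ω) : ℝ :=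
  1 / (((n : ℝ) - 1) * h n ^ dimW p dx dy dz) *
    (∑ s ∈ (Finset.Icc (1 : ℤ) n).erase t, ind (Z s ω) z *
      prodKernel k ((h n)⁻¹ • (condVec X Y Z p t ω - condVec X Y Z p s ω)))
    / fHat X Y Z p k h n t ω

/-- The process `S_n(w,y,z)`, in the form of a double sum (which, unlike the plug-in form, has no
random denominator; see `empS_eq_plugin`). -/
def empS (X : ℤ → Ω → Fin dx → ℝ) (Y : ℤ → Ω → Fin dy → ℝ) (Z : ℤ → Ω → Fin dz → ℝ) (p : ℕ)
    (φ : WSpace p dx dy dz → WSpace p dx dy dz → 𝕜) (k : ℝ → ℝ) (h : ℕ → ℝ) (n : ℕ)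
    (w : WSpace p dx dy dz) (y : Fin dy → ℝ) (z : Fin dz → ℝ) (ω : Ω) : 𝕜 :=
  (1 / (√(n : ℝ) * ((n : ℝ) - 1) * h n ^ dimW p dx dy dz)) •
    ∑ t ∈ Finset.Icc (1 : ℤ) n, ∑ s ∈ (Finset.Icc (1 : ℤ) n).erase t,
      (prodKernel k ((h n)⁻¹ • (condVec X Y Z p t ω - condVec X Y Z p s ω)) *
        ind (Y t ω) y * (ind (Z t ω) z - ind (Z s ω) z)) • φ (condVec X Y Z p t ω) w

/-- Where no denominator `f̂_W(W_t)` vanishes,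
`S_n = n^{-1/2} ∑ φ(W_t,w) 1(Y_t ≤ y) (1(Z_t ≤ z) - F̂_{Z|W}(z|W_t)) f̂_W(W_t)`. -/
theorem empS_eq_plugin (X : ℤ → Ω → Fin dx → ℝ) (Y : ℤ → Ω → Fin dy → ℝ)
    (Z : ℤ → Ω → Fin dz → ℝ) (p : ℕ) (φ : WSpace p dx dy dz → WSpace p dx dy dz → 𝕜)
    (k : ℝ → ℝ) (h : ℕ → ℝ) (n : ℕ) (w : WSpace p dx dy dz) (y : Fin dy → ℝ) (z : Fin dz → ℝ)
    (ω : Ω) (hf : ∀ t ∈ Finset.Icc (1 : ℤ) n, fHat X Y Z p k h n t ω ≠ 0) :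
    empS X Y Z p φ k h n w y z ω =
      (1 / √(n : ℝ)) • ∑ t ∈ Finset.Icc (1 : ℤ) n,
        (ind (Y t ω) y * (ind (Z t ω) z - FHat X Y Z p k h n z t ω) * fHat X Y Z p k h n t ω) •
          φ (condVec X Y Z p t ω) w := by
  unfold empS
  rw [Finset.smul_sum, Finset.smul_sum]
  refine Finset.sum_congr rfl fun t ht => ?_
  have h0 := hf t ht
  rw [← Finset.sum_smul, smul_smul, smul_smul]
  congr 1
  have e : (ind (Z t ω) z - FHat X Y Z p k h n z t ω) * fHat X Y Z p k h n t ω =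
      1 / (((n : ℝ) - 1) * h n ^ dimW p dx dy dz) * ∑ s ∈ (Finset.Icc (1 : ℤ) n).erase t,
        prodKernel k ((h n)⁻¹ • (condVec X Y Z p t ω - condVec X Y Z p s ω)) *
          (ind (Z t ω) z - ind (Z s ω) z) := by
    rw [sub_mul, FHat, div_mul_cancel₀ _ h0, fHat, mul_left_comm, ← mul_sub, Finset.mul_sum,
      ← Finset.sum_sub_distrib]
    congr 1
    exact Finset.sum_congr rfl fun s _ => by ring
  have e2 : ∑ s ∈ (Finset.Icc (1 : ℤ) n).erase t,
        prodKernel k ((h n)⁻¹ • (condVec X Y Z p t ω - condVec X Y Z p s ω)) *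
        ind (Y t ω) y * (ind (Z t ω) z - ind (Z s ω) z) =
      ind (Y t ω) y * ∑ s ∈ (Finset.Icc (1 : ℤ) n).erase t,
        prodKernel k ((h n)⁻¹ • (condVec X Y Z p t ω - condVec X Y Z p s ω)) *
          (ind (Z t ω) z - ind (Z s ω) z) := by
    rw [Finset.mul_sum]
    exact Finset.sum_congr rfl fun s _ => by ring
  rw [mul_assoc (ind (Y t ω) y), e, e2, mul_assoc √(n : ℝ), one_div_mul_eq_div, one_div_mul_eq_div,
    one_div_mul_eq_div, mul_div_assoc', div_div]
  congr 1
  ring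

/-- The Cramér–von Mises statistic `n⁻¹ ∑ |S_n(W_t, Y_t, Z_t)|²`. -/
def cvmStat (X : ℤ → Ω → Fin dx → ℝ) (Y : ℤ → Ω → Fin dy → ℝ) (Z : ℤ → Ω → Fin dz → ℝ) (p : ℕ)
    (φ : WSpace p dx dy dz → WSpace p dx dy dz → 𝕜) (k : ℝ → ℝ) (h : ℕ → ℝ) (n : ℕ) (ω : Ω) : ℝ :=
  (n : ℝ)⁻¹ * ∑ t ∈ Finset.Icc (1 : ℤ) n,
    ‖empS X Y Z p φ k h n (condVec X Y Z p t ω) (Y t ω) (Z t ω) ω‖ ^ 2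

/-- The Kolmogorov–Smirnov statistic `sup |S_n(w,y,z)|` over `𝒲 × ℝ^{dy} × ℝ^{dz}`. -/
def ksStat (X : ℤ → Ω → Fin dx → ℝ) (Y : ℤ → Ω → Fin dy → ℝ) (Z : ℤ → Ω → Fin dz → ℝ) (p : ℕ)
    (𝒲 : Set (WSpace p dx dy dz)) (φ : WSpace p dx dy dz → WSpace p dx dy dz → 𝕜)
    (k : ℝ → ℝ) (h : ℕ → ℝ) (n : ℕ) (ω : Ω) : ℝ :=
  ⨆ q : 𝒲 × (Fin dy → ℝ) × (Fin dz → ℝ), ‖empS X Y Z p φ k h n q.1 q.2.1 q.2.2 ω‖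

/-- `φ` is comprehensively revealing on `𝒲` for the law `P` of `W_t`. -/
def IsCR {ι : Type*} [Fintype ι] (P : Measure (ι → ℝ)) (𝒲 : Set (ι → ℝ))
    (φ : (ι → ℝ) → (ι → ℝ) → 𝕜) : Prop :=
  ∀ g : (ι → ℝ) → ℝ, Measurable g → (∃ B, ∀ u, |g u| ≤ B) → ¬ (g =ᵐ[P] 0) →
    ∃ w ∈ 𝒲, ∫ u, φ u w * (g u : 𝕜) ∂P ≠ 0

/-- `φ` is generically comprehensively revealing on `𝒲` for the law `P` of `W_t`: deviations are
detected by Lebesgue-almost every `w ∈ 𝒲`. -/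
def IsGCR {ι : Type*} [Fintype ι] (P : Measure (ι → ℝ)) (𝒲 : Set (ι → ℝ))
    (φ : (ι → ℝ) → (ι → ℝ) → 𝕜) : Prop :=
  ∀ g : (ι → ℝ) → ℝ, Measurable g → (∃ B, ∀ u, |g u| ≤ B) → ¬ (g =ᵐ[P] 0) →
    ∀ᵐ w ∂(volume : Measure (ι → ℝ)), w ∈ 𝒲 → ∫ u, φ u w * (g u : 𝕜) ∂P ≠ 0

/-- `|k|` is dominated by an integrable function of `|x|` that is nonincreasing in `|x|`. -/
def HasMonotoneMajorant (k : ℝ → ℝ) : Prop :=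
  ∃ g : ℝ → ℝ, AntitoneOn g (Set.Ici 0) ∧ Integrable (fun x => g |x|) ∧ ∀ x, |k x| ≤ g |x|

variable [MeasurableSpace Ω]

/-- The statistics `T_n` diverge to infinity in probability. -/
def DivergesInProbability (μ : Measure Ω) (T : ℕ → Ω → ℝ) : Prop :=
  ∀ M : ℝ, Tendsto (fun n => μ {ω | T n ω ≤ M}) atTop (𝓝 0)

/-- The random variables `κ_n` are bounded in probability. -/
def BoundedInProbability (μ : Measure Ω) (κ : ℕ → Ω → ℝ) : Prop :=
  ∀ ε : ℝ≥0∞, 0 < ε → ∃ M : ℝ, ∀ᶠ n in atTop, μ {ω | M < |κ n ω|} ≤ ε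

/-- Consistency of the tests that reject for `T_n > κ_n`: the probability of not rejecting tends to
zero, for all (possibly random) critical values `κ_n` that are bounded in probability. -/
def ConsistentTests (μ : Measure Ω) (T : ℕ → Ω → ℝ) : Prop :=
  ∀ κ : ℕ → Ω → ℝ, BoundedInProbability μ κ →
    Tendsto (fun n => μ {ω | T n ω ≤ κ n ω}) atTop (𝓝 0)

end Statistics

end CondIndepTest

end

open MeasureTheory ProbabilityTheory Filter Topology
open scoped ENNReal NNReal

set_option linter.unusedSectionVars false


noncomputable section

/-! Write `V_t = (W_t, Y_t, Z_t)`. Up to a factor `n/(n-1)`, `n^{-1/2} S_n` is a sum of two averages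
over pairs `t ≠ s` of terms `h^{-d} K((W_t - W_s)/h) f(V_t) g(V_s)`, `d = d_w`: one with `f = φ 1(Y
≤ y) 1(Z ≤ z)`, `g = 1`, the other with `f = -φ 1(Y ≤ y)`, `g = 1(Z ≤ z)`. If `V_t` and `V_s` were
independent, the mean of such a term would tend to `E[a(W) b(W) f_W(W)]`, where `a`, `b` are the
regressions of `f`, `g` on `W`, because a rescaled kernel is an approximate identity. The two values
add up to the asserted limit `L(w,y,z)`.

Dependence is removed by Fourier analysis (`KernelDesign.tendsto_pairDev`). For a product `f(V_t)
g(V_s)` the pair average is a product of sample means, up to the diagonal, so the covariance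
inequality gives an `L¹` error of order `n^{-1/2}`. This passes to mixtures of products, and `cos (a
- b)` is a sum of two products. Hence a kernel that is the Fourier transform of a finite measure
costs `(√n h^d)⁻¹`, which tends to zero. A general `K` is replaced by its Gaussian smoothing, which
is of this kind. The remainder is small in `L¹`, and is controlled by the bounded joint densities as
long as `W_t` stays in a ball; pairs with `|t - s| < p` are few. Remote `W_t` either do not occur or
are handled by dominating `k` by a mixture of Gaussian bumps, again a Fourier transform
(`HasMonotoneMajorant.exists_charFun`).

Uniformity in `(w,y,z)` comes from a finite partition into cells, on which the oscillation of the
process is at most a kernel pair average with a small limit (`hasBrackets_indepStat`). Then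
`n^{-1/2} KS_n` tends to `sup |L|`, and `n^{-1} CvM_n` to the integral of `|L|²` under the law of
`V_t`.

It remains that these limits are positive under the alternative. For the supremum this is the
revealing property, applied to one `(y,z)` at which factorization fails. For the integral, suppose
that `L` vanishes at almost every value of `V_t`. The generic revealing property and the absolute
continuity of the law of `V_t` give factorization of the conditional distribution function at almost
every value `(y,z)` of `(Y_t, Z_t)` only. This suffices (`eq_prod_of_factorizes`): an integrable
function vanishes at almost every point where its integral over the lower orthant vanishes, so the
conditional density agrees with the product density wherever the conditional law lives. -/

namespace CondIndepTest

/-! ### Zeros of integrals over lower orthants -/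

section OrthantIntegrals

/-- An integrable function on `E` vanishes at almost every point at which its integral over the
lower orthant vanishes. -/
def OrthantIntegralProperty (E : Type*) [MeasureSpace E] [Preorder E] : Prop :=
  ∀ g : E → ℝ, Measurable g → Integrable g → ∀ᵐ x : E, ∫ t in Set.Iic x, g t = 0 → g x = 0

/-- Let `S` be the zero set of the primitive of `g`. Only countably many points of `S` are isolated
in `S` from the right. At any other point of `S` the derivative along `S` is unique; it is `0` since
the primitive vanishes on `S`, and it is `g x` for almost every `x` by Lebesgue differentiation. -/
theorem orthantIntegralProperty_real : OrthantIntegralProperty ℝ := by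
  intro g _ hg
  set S : Set ℝ := {x | ∫ t in Set.Iic x, g t = 0} with hS
  have hcount : {x ∈ S | 𝓝[S ∩ Set.Ioi x] x = ⊥}.Countable :=
    countable_setOfPred_isolated_right_within
  filter_upwards [_root_.LocallyIntegrable.ae_hasDerivAt_integral hg.locallyIntegrable, hcount.ae_notMem volume]
    with x hx hxS hx0
  have hacc : AccPt x (𝓟 S) := by
    rw [accPt_principal_iff_nhdsWithin, neBot_iff]
    intro hbot
    refine hxS ⟨hx0, le_bot_iff.1 (hbot ▸ nhdsWithin_mono x fun y hy => ⟨hy.1, ?_⟩)⟩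
    exact (Set.mem_Ioi.1 hy.2).ne'
  have hder : HasDerivWithinAt (fun y => ∫ t in x..y, g t) (g x) S x := (hx x).hasDerivWithinAt
  have hzero : HasDerivWithinAt (fun y => ∫ t in x..y, g t) 0 S x := by
    refine (hasDerivWithinAt_const x S (0 : ℝ)).congr (fun y hy => ?_) (by simp)
    rw [← intervalIntegral.integral_Iic_sub_Iic hg.integrableOn hg.integrableOn]
    simp only [hS, Set.mem_ofPred_eq] at hy hx0
    rw [hy, hx0, sub_zero]
  exact (hacc.uniqueDiffWithinAt).eq_deriv S hder hzero

/-- The orthant integral is an iterated one: integrate `g (y, ·)` up to `z`, giving `G y z`, then `G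
· z` up to `y`. The property of `E`, for fixed `z`, passes from a zero of the outer integral to a
zero of `G`; that of `F`, for fixed `y`, passes from `G` to `g`. Measurability of the exceptional
sets allows the exchange of the two almost-everywhere quantifiers. -/
theorem OrthantIntegralProperty.prod {E F : Type*} [MeasureSpace E] [MeasureSpace F]
    [TopologicalSpace E] [TopologicalSpace F] [PartialOrder E] [PartialOrder F]
    [OrderClosedTopology E] [OrderClosedTopology F] [SecondCountableTopology E]
    [SecondCountableTopology F] [OpensMeasurableSpace E] [OpensMeasurableSpace F]
    [SFinite (volume : Measure E)] [SFinite (volume : Measure F)]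
    (hE : OrthantIntegralProperty E) (hF : OrthantIntegralProperty F) :
    OrthantIntegralProperty (E × F) := by
  intro g hg hgi
  set G : E → F → ℝ := fun y z => ∫ z' in Set.Iic z, g (y, z') with hG
  have hGm : Measurable (Function.uncurry G) := by
    have h1 : Measurable fun q : (E × F) × F => (Set.Iic q.1.2).indicator (fun z' => g (q.1.1, z')) q.2 := by
      have : (fun q : (E × F) × F => (Set.Iic q.1.2).indicator (fun z' => g (q.1.1, z')) q.2) =
          {q : (E × F) × F | q.2 ≤ q.1.2}.indicator (fun q => g (q.1.1, q.2)) := by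
        ext q; by_cases hq : q.2 ≤ q.1.2 <;> simp [hq]
      rw [this]
      exact (by fun_prop : Measurable fun q : (E × F) × F => g (q.1.1, q.2)).indicator
        (measurableSet_le (by fun_prop) (by fun_prop))
    have h2 := h1.stronglyMeasurable.integral_prod_right' (ν := (volume : Measure F))
    convert h2.measurable using 1
    ext q
    simp only [Function.uncurry, hG]
    rw [integral_indicator measurableSet_Iic]
  have hGi : ∀ z, Integrable (fun y => G y z) := by
    intro z
    have : Integrable ((Set.univ ×ˢ Set.Iic z).indicator g) :=
      hgi.indicator (MeasurableSet.univ.prod measurableSet_Iic)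
    have h := Integrable.integral_prod_left this
    refine h.congr (.of_forall fun y => ?_)
    simp only [hG]
    rw [← integral_indicator measurableSet_Iic]
    refine integral_congr_ae (.of_forall fun z' => ?_)
    by_cases hz : z' ≤ z <;> simp [hz]
  have hH : ∀ y z, ∫ t in Set.Iic (y, z), g t = ∫ y' in Set.Iic y, G y' z := by
    intro y z
    rw [← Set.Iic_prod_Iic]
    exact setIntegral_prod g hgi.integrableOn
  have hHm : Measurable fun q : E × F => ∫ t in Set.Iic q, g t := by
    have h1 : Measurable fun q : (E × F) × (E × F) => (Set.Iic q.1).indicator g q.2 := by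
      have : (fun q : (E × F) × (E × F) => (Set.Iic q.1).indicator g q.2) =
          {q : (E × F) × (E × F) | q.2 ≤ q.1}.indicator (fun q => g q.2) := by
        ext q; by_cases hq : q.2 ≤ q.1 <;> simp [hq]
      rw [this]
      exact (by fun_prop : Measurable fun q : (E × F) × (E × F) => g q.2).indicator
        (measurableSet_le (by fun_prop) (by fun_prop))
    have h2 := h1.stronglyMeasurable.integral_prod_right' (ν := (volume : Measure (E × F)))
    convert h2.measurable using 1
    ext q
    rw [integral_indicator measurableSet_Iic]
  have key1 : ∀ᵐ y : E, ∀ᵐ z : F, ∫ t in Set.Iic (y, z), g t = 0 → G y z = 0 := by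
    have hset : MeasurableSet {q : E × F | ∫ t in Set.Iic (q.1, q.2), g t = 0 → G q.1 q.2 = 0} := by
      have h1 : MeasurableSet {q : E × F | ∫ t in Set.Iic q, g t = 0} :=
        hHm (measurableSet_singleton 0)
      have h2 : MeasurableSet {q : E × F | G q.1 q.2 = 0} := hGm (measurableSet_singleton 0)
      exact MeasurableSet.imp h1 h2
    rw [Measure.ae_ae_comm hset]
    refine .of_forall fun z => ?_
    filter_upwards [hE (fun y => G y z) (hGm.comp measurable_prodMk_right) (hGi z)] with y hy h0
    exact hy (by rw [← hH]; exact h0)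
  have key2 : ∀ᵐ y : E, ∀ᵐ z : F, ∫ t in Set.Iic (y, z), g t = 0 → g (y, z) = 0 := by
    filter_upwards [key1, hgi.prod_right_ae] with y hy hyi
    filter_upwards [hy, hF (fun z => g (y, z)) (by fun_prop) hyi] with z h1 h2 h0
    exact h2 (h1 h0)
  have hset : MeasurableSet {q : E × F | ∫ t in Set.Iic q, g t = 0 → g q = 0} :=
    MeasurableSet.imp (hHm (measurableSet_singleton 0)) (hg (measurableSet_singleton 0))
  exact (Measure.ae_prod_iff_ae_ae hset).2 key2

theorem orthantIntegralProperty_fin : ∀ d : ℕ, OrthantIntegralProperty (Fin d → ℝ)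
  | 0 => by
    intro g _ _
    refine .of_forall fun x hx => ?_
    have h1 : Set.Iic x = Set.univ := by
      ext y; simp [Subsingleton.elim y x]
    have h2 : (fun t : Fin 0 → ℝ => g t) = fun _ => g x := by
      ext y; rw [Subsingleton.elim y x]
    rw [h1, h2] at hx
    simpa [Measure.real, volume_pi] using hx
  | d + 1 => by
    intro g hg hgi
    have hp := orthantIntegralProperty_real.prod (orthantIntegralProperty_fin d)
    set e := MeasurableEquiv.piFinSuccAbove (fun _ : Fin (d + 1) => ℝ) 0 with he
    have hep : MeasurePreserving e volume volume :=
      volume_preserving_piFinSuccAbove (fun _ : Fin (d + 1) => ℝ) 0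
    have hes : MeasurePreserving e.symm volume volume := hep.symm e
    have h := hp (g ∘ e.symm) (hg.comp e.symm.measurable)
      (hes.integrable_comp_of_integrable hgi)
    filter_upwards [hep.quasiMeasurePreserving.ae h] with x hx h0
    have h1 := hx
    simp only [Function.comp_apply, MeasurableEquiv.symm_apply_apply] at h1
    refine h1 ?_
    rw [← h0, ← hes.setIntegral_preimage_emb e.symm.measurableEmbedding]
    congr 2
    ext t
    simp only [Set.mem_preimage, Set.mem_Iic]
    obtain ⟨u, rfl⟩ := e.surjective t
    rw [MeasurableEquiv.symm_apply_apply]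
    simp only [he, MeasurableEquiv.piFinSuccAbove_apply, Prod.le_def, Pi.le_def, Fin.forall_fin_succ]
    simp [Fin.insertNthEquiv, Fin.tail]

end OrthantIntegrals

/-! ### Product measures recognized from their distribution functions -/

section AbsolutelyContinuous

/-- An absolutely continuous law on a product whose distribution function factorizes at almost
every point of the law itself is the product of its marginals. -/
theorem eq_prod_of_factorizes {d e : ℕ} (κ : Measure ((Fin d → ℝ) × (Fin e → ℝ)))
    [IsProbabilityMeasure κ] (hac : κ ≪ volume)
    (h : ∀ᵐ q ∂κ, κ.real (Set.Iic q.1 ×ˢ Set.Iic q.2) =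
      κ.fst.real (Set.Iic q.1) * κ.snd.real (Set.Iic q.2)) :
    κ = κ.fst.prod κ.snd := by
  have hLD := (orthantIntegralProperty_fin d).prod (orthantIntegralProperty_fin e)
  have : SigmaFinite (volume : Measure ((Fin d → ℝ) × (Fin e → ℝ))) :=
    inferInstanceAs (SigmaFinite (volume.prod volume))
  have hfst : κ.fst ≪ volume :=
    (hac.map measurable_fst).trans Measure.quasiMeasurePreserving_fst.absolutelyContinuous
  have hsnd : κ.snd ≪ volume :=
    (hac.map measurable_snd).trans Measure.quasiMeasurePreserving_snd.absolutelyContinuous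
  set ρ := κ.fst.prod κ.snd with hρ
  have hρac : ρ ≪ volume := hfst.prod hsnd
  set f := κ.rnDeriv volume
  set f' := ρ.rnDeriv volume
  have hκ : volume.withDensity f = κ := Measure.withDensity_rnDeriv_eq _ _ hac
  have hρ' : volume.withDensity f' = ρ := Measure.withDensity_rnDeriv_eq _ _ hρac
  have hfm : Measurable f := Measure.measurable_rnDeriv _ _
  have hf'm : Measurable f' := Measure.measurable_rnDeriv _ _
  have hfi : Integrable (fun q => (f q).toReal) := Measure.integrable_toReal_rnDeriv
  have hf'i : Integrable (fun q => (f' q).toReal) := Measure.integrable_toReal_rnDeriv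
  have hint : ∀ s, ∫ q in s, ((f q).toReal - (f' q).toReal) = κ.real s - ρ.real s := by
    intro s
    rw [integral_sub hfi.integrableOn hf'i.integrableOn,
      Measure.setIntegral_toReal_rnDeriv hac, Measure.setIntegral_toReal_rnDeriv hρac]
  have hz := hLD (fun q => (f q).toReal - (f' q).toReal)
    (hfm.ennreal_toReal.sub hf'm.ennreal_toReal) (hfi.sub hf'i)
  have hSz : ∀ᵐ q, κ.real (Set.Iic q) = ρ.real (Set.Iic q) → (f q).toReal = (f' q).toReal := by
    filter_upwards [hz] with q hq h0
    rw [hint, h0, sub_self] at hq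
    linarith [hq rfl]
  have hS : ∀ᵐ q ∂κ, κ.real (Set.Iic q) = ρ.real (Set.Iic q) := by
    filter_upwards [h] with q hq
    rw [show Set.Iic q = Set.Iic q.1 ×ˢ Set.Iic q.2 from (Set.Iic_prod_eq q), hq, hρ,
      measureReal_prod_prod]
  -- The factorization is known only `κ`-almost everywhere, that is, where `f ≠ 0`. So the densities
  -- agree there, and elsewhere `f = 0 ≤ f'`; equality of the measures then follows from equality of
  -- their total masses.
  have hle : κ ≤ ρ := by
    rw [← hκ, ae_withDensity_iff hfm] at hS
    rw [← hκ, ← hρ']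
    refine withDensity_mono ?_
    rw [hκ] at hS
    filter_upwards [hS, hSz, Measure.rnDeriv_lt_top κ volume, Measure.rnDeriv_lt_top ρ volume]
      with q h1 h2 h3 h4
    by_cases h0 : f q = 0
    · simp [h0]
    · exact ((ENNReal.toReal_eq_toReal_iff' h3.ne h4.ne).1 (h2 (h1 h0))).le
  refine Measure.eq_of_le_of_measure_univ_eq hle ?_
  simp [hρ]

/-- Split a null set `N` of `Q.fst.prod β` by its sections. The points `u` whose section is not
`β`-null form a `Q.fst`-null set `B₀`; the part of `N` over the complement of `B₀` is null for
`α.prod β`, hence for `Q`. -/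
theorem absolutelyContinuous_fst_prod {A B : Type*} [MeasurableSpace A] [MeasurableSpace B]
    {Q : Measure (A × B)} [IsFiniteMeasure Q] {α : Measure A} {β : Measure B} [SFinite α] [SFinite β]
    (h : Q ≪ α.prod β) : Q ≪ Q.fst.prod β := by
  refine Measure.AbsolutelyContinuous.mk fun N hN hN0 => ?_
  rw [Measure.measure_prod_null hN] at hN0
  set B₀ : Set A := {u | β (Prod.mk u ⁻¹' N) ≠ 0} with hB₀
  have hBm : MeasurableSet B₀ :=
    (measurable_measure_prodMk_left hN) (measurableSet_singleton (0 : ℝ≥0∞)).compl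
  have h1 : Q (Prod.fst ⁻¹' B₀) = 0 := by
    rw [← Measure.fst_apply hBm]
    exact hN0
  have h2 : Q (N \ Prod.fst ⁻¹' B₀) = 0 := by
    refine h ?_
    rw [Measure.measure_prod_null (hN.diff (measurable_fst hBm))]
    refine .of_forall fun u => ?_
    by_cases hu : u ∈ B₀
    · have : Prod.mk u ⁻¹' (N \ Prod.fst ⁻¹' B₀) = ∅ := by
        ext b; simp [hu]
      simp [this]
    · have hu' : β (Prod.mk u ⁻¹' N) = 0 := by simpa [hB₀] using hu
      exact measure_mono_null (Set.preimage_mono Set.sdiff_subset) hu'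
  have h3 : N ⊆ (N \ Prod.fst ⁻¹' B₀) ∪ Prod.fst ⁻¹' B₀ := by
    rw [Set.sdiff_union_self]; exact Set.subset_union_left
  exact measure_mono_null h3 (measure_union_null h2 h1)

theorem absolutelyContinuous_fst_prod_snd {A B : Type*} [MeasurableSpace A] [MeasurableSpace B]
    {Q : Measure (A × B)} [IsFiniteMeasure Q] {α : Measure A} {β : Measure B} [SFinite α] [SFinite β]
    (h : Q ≪ α.prod β) : Q ≪ Q.fst.prod Q.snd := by
  have h1 := absolutelyContinuous_fst_prod h
  have h2 : Q.map Prod.swap ≪ β.prod Q.fst := by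
    rw [← Measure.prod_swap]
    exact h1.map measurable_swap
  have h3 := absolutelyContinuous_fst_prod h2
  have h4 := h3.map measurable_swap
  rw [Measure.map_map measurable_swap measurable_swap, Measure.prod_swap] at h4
  simpa [Measure.fst_map_swap] using h4

theorem measurable_kernel_Iic {U R : Type*} [MeasurableSpace U] [MeasurableSpace R]
    [TopologicalSpace R] [PartialOrder R] [OrderClosedTopology R] [SecondCountableTopology R]
    [OpensMeasurableSpace R] (κ : Kernel U R) [IsFiniteKernel κ] :
    Measurable fun q : U × R => (κ q.1).real (Set.Iic q.2) := by
  have ht : MeasurableSet {x : (U × R) × R | x.2 ≤ x.1.2} :=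
    measurableSet_le (by fun_prop) (by fun_prop)
  have h := Kernel.measurable_kernel_prodMk_left (κ := κ.comap Prod.fst measurable_fst) ht
  exact h.ennreal_toReal

/-- If the conditional distribution functions factorize at almost every value of the conditioned
variables, then the conditional laws are product measures. -/
theorem ae_kernel_eq_prod {U : Type*} [MeasurableSpace U] {d e : ℕ} (P : Measure U)
    [IsProbabilityMeasure P] (κ : Kernel U ((Fin d → ℝ) × (Fin e → ℝ))) [IsMarkovKernel κ]
    (α : Measure U) [SFinite α] (hac : P ⊗ₘ κ ≪ α.prod volume)
    (h : ∀ᵐ r ∂(P ⊗ₘ κ).snd, ∀ᵐ u ∂P, (κ u).real (Set.Iic r) =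
      (κ u).fst.real (Set.Iic r.1) * (κ u).snd.real (Set.Iic r.2)) :
    ∀ᵐ u ∂P, κ u = (κ u).fst.prod (κ u).snd := by
  have : SigmaFinite (volume : Measure ((Fin d → ℝ) × (Fin e → ℝ))) :=
    inferInstanceAs (SigmaFinite (volume.prod volume))
  have hset : MeasurableSet {q : U × ((Fin d → ℝ) × (Fin e → ℝ)) | (κ q.1).real (Set.Iic q.2) =
      (κ q.1).fst.real (Set.Iic q.2.1) * (κ q.1).snd.real (Set.Iic q.2.2)} := by
    refine measurableSet_eq_fun (measurable_kernel_Iic κ) (Measurable.mul ?_ ?_)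
    · have h1 := (measurable_kernel_Iic (Kernel.fst κ)).comp
        (by fun_prop : Measurable fun q : U × ((Fin d → ℝ) × (Fin e → ℝ)) => (q.1, q.2.1))
      simpa [Function.comp_def, Kernel.fst_apply, Measure.fst] using h1
    · have h1 := (measurable_kernel_Iic (Kernel.snd κ)).comp
        (by fun_prop : Measurable fun q : U × ((Fin d → ℝ) × (Fin e → ℝ)) => (q.1, q.2.2))
      simpa [Function.comp_def, Kernel.snd_apply, Measure.snd] using h1
  have h1 : ∀ᵐ q ∂(P.prod (P ⊗ₘ κ).snd), (κ q.1).real (Set.Iic q.2) =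
      (κ q.1).fst.real (Set.Iic q.2.1) * (κ q.1).snd.real (Set.Iic q.2.2) := by
    rw [Measure.ae_prod_iff_ae_ae hset, Measure.ae_ae_comm hset]
    exact h
  -- The factorization holds almost everywhere for the product of the marginals; absolute continuity
  -- carries it to the joint law, and disintegration to `κ u`-almost every point for almost every
  -- `u`.
  have h2 : P ⊗ₘ κ ≪ P.prod (P ⊗ₘ κ).snd := by
    simpa using absolutelyContinuous_fst_prod_snd hac
  have h3 := Measure.ae_ae_of_ae_compProd (h2.ae_le h1)
  have h4 : ∀ᵐ u ∂P, κ u ≪ volume := by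
    -- Lebesgue measure is replaced by an equivalent finite measure, so that absolute continuity can
    -- be disintegrated into kernels.
    have h5 : P ⊗ₘ κ ≪ P ⊗ₘ Kernel.const U (volume : Measure ((Fin d → ℝ) × (Fin e → ℝ))).toFinite := by
      rw [Measure.compProd_const]
      have h6 := absolutelyContinuous_fst_prod hac
      rw [Measure.fst_compProd] at h6
      exact h6.trans (Measure.AbsolutelyContinuous.rfl.prod (absolutelyContinuous_toFinite _))
    filter_upwards [h5.kernel_of_compProd] with u hu
    exact hu.trans (toFinite_absolutelyContinuous _)
  filter_upwards [h3, h4] with u hu hu'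
  refine eq_prod_of_factorizes (κ u) hu' ?_
  filter_upwards [hu] with q hq
  rw [← hq, Set.Iic_prod_eq]

end AbsolutelyContinuous

/-! ### Covariance inequality under strong mixing -/

section CovarianceInequality

variable {Ω : Type*} {mA mB : MeasurableSpace Ω} [mΩ : MeasurableSpace Ω] {μ : Measure Ω}
  [IsProbabilityMeasure μ]

theorem integrable_of_abs_le {E : Type*} [MeasurableSpace E] {Q : Measure E} [IsFiniteMeasure Q]
    {f : E → ℝ} (hf : Measurable f) {B : ℝ} (hB : ∀ x, |f x| ≤ B) : Integrable f Q :=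
  Integrable.of_bound hf.aestronglyMeasurable B (.of_forall hB)

theorem natFloor_eq_sum_indicator (N : ℕ) {x : ℝ} (h0 : 0 ≤ x) (hN : x ≤ N) :
    (⌊x⌋₊ : ℝ) = ∑ k ∈ Finset.range N, if (k : ℝ) + 1 ≤ x then 1 else 0 := by
  rw [← Finset.sum_filter, Finset.sum_const, nsmul_eq_mul, mul_one]
  congr 1
  have : Finset.filter (fun k : ℕ => (k : ℝ) + 1 ≤ x) (Finset.range N) = Finset.range ⌊x⌋₊ := by
    ext k
    have h1 : k < ⌊x⌋₊ ↔ (k : ℝ) + 1 ≤ x := by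
      rw [← Nat.succ_le_iff, Nat.le_floor_iff h0]
      push_cast; rfl
    simp only [Finset.mem_filter, Finset.mem_range, h1, and_iff_right_iff_imp]
    intro h
    exact_mod_cast (by linarith : (k : ℝ) < N)
  rw [this, Finset.card_range]

/-- The discretization `⌊f N⌋ / N` is the mean of the indicators of the level sets `{f N ≥ k + 1}`,
`k < N`. By bilinearity the covariance of two discretizations is the mean of `N²` covariances of
events, each at most `α`. Let `N → ∞`. -/
theorem abs_cov_le_of_unitInterval (hA : mA ≤ mΩ) (hB : mB ≤ mΩ) {α : ℝ}
    (hα : ∀ A B, MeasurableSet[mA] A → MeasurableSet[mB] B →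
      |μ.real (A ∩ B) - μ.real A * μ.real B| ≤ α)
    {f g : Ω → ℝ} (hf : Measurable[mA] f) (hg : Measurable[mB] g)
    (hf1 : ∀ ω, f ω ∈ Set.Icc (0 : ℝ) 1) (hg1 : ∀ ω, g ω ∈ Set.Icc (0 : ℝ) 1) :
    |∫ ω, f ω * g ω ∂μ - (∫ ω, f ω ∂μ) * ∫ ω, g ω ∂μ| ≤ α := by
  have hf' : Measurable f := hf.mono hA le_rfl
  have hg' : Measurable g := hg.mono hB le_rfl
  set F : (Ω → ℝ) → ℕ → Ω → ℝ := fun f N ω => (⌊f ω * N⌋₊ : ℝ) / N with hF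
  have hFle : ∀ f : Ω → ℝ, (∀ ω, f ω ∈ Set.Icc (0 : ℝ) 1) → ∀ N ω, |F f N ω| ≤ 1 := by
    intro f hf1 N ω
    rw [abs_of_nonneg (by positivity)]
    refine div_le_one_of_le₀ ?_ (by positivity)
    refine (Nat.floor_le (mul_nonneg (hf1 ω).1 (by positivity))).trans ?_
    exact mul_le_of_le_one_left (by positivity) (hf1 ω).2
  have hFm : ∀ f : Ω → ℝ, Measurable f → ∀ N, Measurable (F f N) := by
    intro f hf N
    have : Measurable fun ω => ⌊f ω * N⌋₊ := Nat.measurable_floor.comp (hf.mul_const _)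
    exact ((measurable_from_top (f := fun n : ℕ => (n : ℝ))).comp this).div_const _
  have hFt : ∀ f : Ω → ℝ, (∀ ω, f ω ∈ Set.Icc (0 : ℝ) 1) → ∀ ω,
      Tendsto (fun N => F f N ω) atTop (𝓝 (f ω)) := by
    intro f hf1 ω
    exact (tendsto_nat_floor_mul_div_atTop (hf1 ω).1).comp tendsto_natCast_atTop_atTop
  have t1 : Tendsto (fun N => ∫ ω, F f N ω ∂μ) atTop (𝓝 (∫ ω, f ω ∂μ)) :=
    tendsto_integral_of_dominated_convergence (fun _ => 1)
      (fun N => (hFm f hf' N).aestronglyMeasurable) (integrable_const _)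
      (fun N => .of_forall (hFle f hf1 N)) (.of_forall (hFt f hf1))
  have t2 : Tendsto (fun N => ∫ ω, F g N ω ∂μ) atTop (𝓝 (∫ ω, g ω ∂μ)) :=
    tendsto_integral_of_dominated_convergence (fun _ => 1)
      (fun N => (hFm g hg' N).aestronglyMeasurable) (integrable_const _)
      (fun N => .of_forall (hFle g hg1 N)) (.of_forall (hFt g hg1))
  have t3 : Tendsto (fun N => ∫ ω, F f N ω * F g N ω ∂μ) atTop (𝓝 (∫ ω, f ω * g ω ∂μ)) := by
    refine tendsto_integral_of_dominated_convergence (fun _ => 1)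
      (fun N => ((hFm f hf' N).mul (hFm g hg' N)).aestronglyMeasurable) (integrable_const _)
      (fun N => .of_forall fun ω => ?_) (.of_forall fun ω => (hFt f hf1 ω).mul (hFt g hg1 ω))
    rw [norm_mul]
    exact mul_le_one₀ (hFle f hf1 N ω) (norm_nonneg _) (hFle g hg1 N ω)
  refine le_of_tendsto (t3.sub (t1.mul t2)).abs ?_
  filter_upwards [eventually_gt_atTop 0] with N hN
  have hN' : (0 : ℝ) < N := by exact_mod_cast hN
  set A : ℕ → Set Ω := fun k => {ω | (k : ℝ) + 1 ≤ f ω * N} with hAdef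
  set B : ℕ → Set Ω := fun k => {ω | (k : ℝ) + 1 ≤ g ω * N} with hBdef
  have hAm : ∀ k, MeasurableSet[mA] (A k) := fun k =>
    @measurableSet_le _ _ _ _ _ mA _ _ _ _ _ measurable_const (hf.mul_const _)
  have hBm : ∀ k, MeasurableSet[mB] (B k) := fun k =>
    @measurableSet_le _ _ _ _ _ mB _ _ _ _ _ measurable_const (hg.mul_const _)
  have hFA : ∀ ω, F f N ω = (N : ℝ)⁻¹ * ∑ k ∈ Finset.range N, (A k).indicator (fun _ => (1 : ℝ)) ω := by
    intro ω
    simp only [hF]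
    rw [natFloor_eq_sum_indicator N (mul_nonneg (hf1 ω).1 hN'.le)
      (mul_le_of_le_one_left hN'.le (hf1 ω).2), div_eq_inv_mul]
    congr 1
  have hFB : ∀ ω, F g N ω = (N : ℝ)⁻¹ * ∑ k ∈ Finset.range N, (B k).indicator (fun _ => (1 : ℝ)) ω := by
    intro ω
    simp only [hF]
    rw [natFloor_eq_sum_indicator N (mul_nonneg (hg1 ω).1 hN'.le)
      (mul_le_of_le_one_left hN'.le (hg1 ω).2), div_eq_inv_mul]
    congr 1
  have hiA : ∀ k, ∫ ω, (A k).indicator (fun _ => (1 : ℝ)) ω ∂μ = μ.real (A k) := fun k => by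
    rw [integral_indicator (hA _ (hAm k))]; simp
  have hiB : ∀ k, ∫ ω, (B k).indicator (fun _ => (1 : ℝ)) ω ∂μ = μ.real (B k) := fun k => by
    rw [integral_indicator (hB _ (hBm k))]; simp
  have intA : ∀ k, Integrable ((A k).indicator (fun _ => (1 : ℝ))) μ := fun k =>
    (integrable_const _).indicator (hA _ (hAm k))
  have intB : ∀ k, Integrable ((B k).indicator (fun _ => (1 : ℝ))) μ := fun k =>
    (integrable_const _).indicator (hB _ (hBm k))
  have intAB : ∀ k j, Integrable ((A k ∩ B j).indicator (fun _ => (1 : ℝ))) μ := fun k j =>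
    (integrable_const _).indicator ((hA _ (hAm k)).inter (hB _ (hBm j)))
  have e1 : ∫ ω, F f N ω ∂μ = (N : ℝ)⁻¹ * ∑ k ∈ Finset.range N, μ.real (A k) := by
    simp_rw [hFA]
    rw [integral_const_mul, integral_finsetSum _ (fun k _ => intA k)]
    simp_rw [hiA]
  have e2 : ∫ ω, F g N ω ∂μ = (N : ℝ)⁻¹ * ∑ k ∈ Finset.range N, μ.real (B k) := by
    simp_rw [hFB]
    rw [integral_const_mul, integral_finsetSum _ (fun k _ => intB k)]
    simp_rw [hiB]
  have e3 : ∫ ω, F f N ω * F g N ω ∂μ =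
      (N : ℝ)⁻¹ * (N : ℝ)⁻¹ * ∑ k ∈ Finset.range N, ∑ j ∈ Finset.range N, μ.real (A k ∩ B j) := by
    have : ∀ ω, F f N ω * F g N ω = (N : ℝ)⁻¹ * (N : ℝ)⁻¹ * ∑ k ∈ Finset.range N,
        ∑ j ∈ Finset.range N, (A k ∩ B j).indicator (fun _ => (1 : ℝ)) ω := by
      intro ω
      rw [hFA, hFB, mul_mul_mul_comm, Finset.sum_mul_sum]
      congr 1
      refine Finset.sum_congr rfl fun k _ => Finset.sum_congr rfl fun j _ => ?_
      rw [← Set.inter_indicator_mul]; simp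
    simp_rw [this]
    rw [integral_const_mul, integral_finsetSum _ (fun k _ => integrable_finsetSum _ fun j _ => intAB k j)]
    congr 1
    refine Finset.sum_congr rfl fun k _ => ?_
    rw [integral_finsetSum _ (fun j _ => intAB k j)]
    refine Finset.sum_congr rfl fun j _ => ?_
    rw [integral_indicator ((hA _ (hAm k)).inter (hB _ (hBm j)))]; simp
  rw [e1, e2, e3, mul_mul_mul_comm, Finset.sum_mul_sum, ← mul_sub, ← Finset.sum_sub_distrib]
  simp_rw [← Finset.sum_sub_distrib]
  rw [abs_mul, abs_of_nonneg (by positivity)]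
  have : |∑ k ∈ Finset.range N, ∑ j ∈ Finset.range N,
      (μ.real (A k ∩ B j) - μ.real (A k) * μ.real (B j))| ≤ N * (N * α) := by
    refine (Finset.abs_sum_le_sum_abs _ _).trans ?_
    refine (Finset.sum_le_card_nsmul _ _ (N * α) fun k _ => ?_).trans (by simp)
    refine (Finset.abs_sum_le_sum_abs _ _).trans ?_
    exact (Finset.sum_le_card_nsmul _ _ α fun j _ => hα _ _ (hAm k) (hBm j)).trans (by simp)
  calc _ ≤ (N : ℝ)⁻¹ * (N : ℝ)⁻¹ * (N * (N * α)) := by gcongr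
    _ = α := by field_simp

/-- The covariance inequality for bounded functions under strong mixing. -/
theorem abs_cov_le (hA : mA ≤ mΩ) (hB : mB ≤ mΩ) {α : ℝ}
    (hα : ∀ A B, MeasurableSet[mA] A → MeasurableSet[mB] B →
      |μ.real (A ∩ B) - μ.real A * μ.real B| ≤ α)
    {f g : Ω → ℝ} (hf : Measurable[mA] f) (hg : Measurable[mB] g)
    (hf1 : ∀ ω, |f ω| ≤ 1) (hg1 : ∀ ω, |g ω| ≤ 1) :
    |∫ ω, f ω * g ω ∂μ - (∫ ω, f ω ∂μ) * ∫ ω, g ω ∂μ| ≤ 4 * α := by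
  have hf' : Measurable f := hf.mono hA le_rfl
  have hg' : Measurable g := hg.mono hB le_rfl
  -- The map `x ↦ (x + 1) / 2` takes `[-1, 1]` to `[0, 1]` and divides covariances by `4`.
  have key := abs_cov_le_of_unitInterval (μ := μ) hA hB hα (f := fun ω => (f ω + 1) / 2)
    (g := fun ω => (g ω + 1) / 2) ((hf.add_const 1).div_const 2) ((hg.add_const 1).div_const 2)
    (fun ω => by have := abs_le.1 (hf1 ω); constructor <;> linarith)
    (fun ω => by have := abs_le.1 (hg1 ω); constructor <;> linarith)
  have i1 : Integrable f μ := integrable_of_abs_le hf' hf1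
  have i2 : Integrable g μ := integrable_of_abs_le hg' hg1
  have i3 : Integrable (fun ω => f ω * g ω) μ := integrable_of_abs_le (hf'.mul hg') (B := 1)
    fun ω => by rw [abs_mul]; exact mul_le_one₀ (hf1 ω) (abs_nonneg _) (hg1 ω)
  have e1 : ∫ ω, (f ω + 1) / 2 ∂μ = ((∫ ω, f ω ∂μ) + 1) / 2 := by
    rw [integral_div, integral_add i1 (integrable_const _)]; simp
  have e2 : ∫ ω, (g ω + 1) / 2 ∂μ = ((∫ ω, g ω ∂μ) + 1) / 2 := by
    rw [integral_div, integral_add i2 (integrable_const _)]; simp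
  have e3 : ∫ ω, (f ω + 1) / 2 * ((g ω + 1) / 2) ∂μ =
      ((∫ ω, f ω * g ω ∂μ) + (∫ ω, f ω ∂μ) + (∫ ω, g ω ∂μ) + 1) / 4 := by
    have : ∀ ω, (f ω + 1) / 2 * ((g ω + 1) / 2) = (f ω * g ω + f ω + g ω + 1) / 4 := fun ω => by ring
    simp_rw [this]
    have i4 : Integrable (fun ω => f ω * g ω + f ω) μ := i3.add i1
    have i5 : Integrable (fun ω => f ω * g ω + f ω + g ω) μ := i4.add i2
    rw [integral_div, integral_add i5 (integrable_const _), integral_add i4 i2, integral_add i3 i1]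
    simp
  rw [e1, e2, e3] at key
  rw [abs_le] at key ⊢
  constructor <;> nlinarith [key.1, key.2]

end CovarianceInequality

/-! ### Sample averages of mixing sequences -/

section MixingSequences

variable {Ω E : Type*} [MeasurableSpace Ω] [MeasurableSpace E]

/-- A sequence with common marginal law `Q` and summable covariance bounds `a` for bounded
functions of pairs. -/
structure MixingSequence (μ : Measure Ω) (V : ℤ → Ω → E) (Q : Measure E) (a : ℕ → ℝ) : Prop where
  measurable : ∀ t, Measurable (V t)
  map_eq : ∀ t, μ.map (V t) = Q
  nonneg : ∀ s, 0 ≤ a s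
  summable : Summable a
  cov_le : ∀ t s (f g : E → ℝ), Measurable f → Measurable g → (∀ x, |f x| ≤ 1) →
    (∀ x, |g x| ≤ 1) →
    |∫ ω, f (V t ω) * g (V s ω) ∂μ - (∫ x, f x ∂Q) * ∫ x, g x ∂Q| ≤ a (t - s).natAbs

namespace MixingSequence

variable {μ : Measure Ω} [IsProbabilityMeasure μ] {V : ℤ → Ω → E} {Q : Measure E} {a : ℕ → ℝ}

theorem isProbabilityMeasure (hV : MixingSequence μ V Q a) : IsProbabilityMeasure Q := by
  rw [← hV.map_eq 0]
  exact Measure.isProbabilityMeasure_map (hV.measurable 0).aemeasurable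

theorem integral_comp (hV : MixingSequence μ V Q a) (t : ℤ) {f : E → ℝ} (hf : Measurable f) :
    ∫ ω, f (V t ω) ∂μ = ∫ x, f x ∂Q := by
  rw [← hV.map_eq t, integral_map (hV.measurable t).aemeasurable hf.aestronglyMeasurable]

/-- The total of the covariance bounds over all lags. -/
def total (a : ℕ → ℝ) : ℝ := ∑' z : ℤ, a z.natAbs

theorem summable_int (hV : MixingSequence μ V Q a) : Summable fun z : ℤ => a z.natAbs :=
  Summable.of_nat_of_neg (by simpa using hV.summable) (by simpa using hV.summable)

theorem total_nonneg (hV : MixingSequence μ V Q a) : 0 ≤ total a := tsum_nonneg fun _ => hV.nonneg _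

theorem sum_lag_le (hV : MixingSequence μ V Q a) (F : Finset ℤ) (t : ℤ) :
    ∑ s ∈ F, a (t - s).natAbs ≤ total a := by
  have h := hV.summable_int.sum_le_tsum (F.map (Equiv.subLeft t).toEmbedding)
    (fun z _ => hV.nonneg _)
  rw [Finset.sum_map] at h
  simpa [total] using h

/-- The sample average of `f`. -/
def avg (V : ℤ → Ω → E) (n : ℕ) (f : E → ℝ) (ω : Ω) : ℝ :=
  (n : ℝ)⁻¹ * ∑ t ∈ Finset.Icc (1 : ℤ) n, f (V t ω)

theorem measurable_avg (hV : MixingSequence μ V Q a) (n : ℕ) {f : E → ℝ} (hf : Measurable f) :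
    Measurable (avg V n f) :=
  (Finset.measurable_fun_sum _ fun t _ => hf.comp (hV.measurable t)).const_mul _

theorem abs_avg_le (n : ℕ) {f : E → ℝ} {B : ℝ} (hB : 0 ≤ B) (hf : ∀ x, |f x| ≤ B) (ω : Ω) :
    |avg V n f ω| ≤ B := by
  rcases n.eq_zero_or_pos with rfl | hn
  · simpa [avg] using hB
  have hn' : (0 : ℝ) < n := by exact_mod_cast hn
  rw [avg, abs_mul, abs_of_nonneg (by positivity)]
  have : |∑ t ∈ Finset.Icc (1 : ℤ) n, f (V t ω)| ≤ n * B := by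
    refine (Finset.abs_sum_le_sum_abs _ _).trans ?_
    exact (Finset.sum_le_card_nsmul _ _ B fun t _ => hf _).trans (by simp)
  calc _ ≤ (n : ℝ)⁻¹ * (n * B) := by gcongr
    _ = B := by field_simp

/-- The variance of the average is `n⁻²` times a double sum of covariances, and for each `t` the
covariances over all `s` sum to at most `total a`. -/
theorem integral_sq_avg_sub_le (hV : MixingSequence μ V Q a) {n : ℕ} (hn : 0 < n) {f : E → ℝ}
    (hf : Measurable f) (hf1 : ∀ x, |f x| ≤ 1) :
    ∫ ω, (avg V n f ω - ∫ x, f x ∂Q) ^ 2 ∂μ ≤ total a / n := by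
  have hn' : (0 : ℝ) < n := by exact_mod_cast hn
  set c := ∫ x, f x ∂Q with hc
  have hfm : ∀ t, Measurable fun ω => f (V t ω) := fun t => hf.comp (hV.measurable t)
  have hi : ∀ t, Integrable (fun ω => f (V t ω)) μ := fun t =>
    integrable_of_abs_le (hfm t) fun ω => hf1 _
  have hii : ∀ t s, Integrable (fun ω => f (V t ω) * f (V s ω)) μ := fun t s =>
    integrable_of_abs_le ((hfm t).mul (hfm s)) (B := 1) fun ω => by
      rw [abs_mul]; exact mul_le_one₀ (hf1 _) (abs_nonneg _) (hf1 _)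
  have hexp : ∀ ω, (avg V n f ω - c) ^ 2 = ((n : ℝ) ^ 2)⁻¹ * ∑ t ∈ Finset.Icc (1 : ℤ) n,
      ∑ s ∈ Finset.Icc (1 : ℤ) n, (f (V t ω) * f (V s ω) - c * f (V t ω) - c * f (V s ω) + c ^ 2) := by
    intro ω
    have h1 : avg V n f ω - c = (n : ℝ)⁻¹ * ∑ t ∈ Finset.Icc (1 : ℤ) n, (f (V t ω) - c) := by
      rw [avg, Finset.sum_sub_distrib]
      simp only [Finset.sum_const, Int.card_Icc, nsmul_eq_mul]
      have : ((n : ℤ) + 1 - 1).toNat = n := by simp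
      rw [this]
      field_simp
    rw [h1, mul_pow, sq (∑ t ∈ _, _), Finset.sum_mul_sum, inv_pow]
    congr 1
    exact Finset.sum_congr rfl fun t _ => Finset.sum_congr rfl fun s _ => by ring
  have hI : ∀ t s, Integrable (fun ω => f (V t ω) * f (V s ω) - c * f (V t ω) - c * f (V s ω) + c ^ 2) μ :=
    fun t s => (((hii t s).sub ((hi t).const_mul c)).sub ((hi s).const_mul c)).add (integrable_const _)
  simp_rw [hexp]
  rw [integral_const_mul, integral_finsetSum _ fun t _ => integrable_finsetSum _ fun s _ => hI t s]
  have hterm : ∀ t s, ∫ ω, (f (V t ω) * f (V s ω) - c * f (V t ω) - c * f (V s ω) + c ^ 2) ∂μ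
      ≤ a (t - s).natAbs := by
    intro t s
    have i1 : Integrable (fun ω => f (V t ω) * f (V s ω) - c * f (V t ω)) μ :=
      (hii t s).sub ((hi t).const_mul c)
    have i2 : Integrable (fun ω => f (V t ω) * f (V s ω) - c * f (V t ω) - c * f (V s ω)) μ :=
      i1.sub ((hi s).const_mul c)
    rw [integral_add i2 (integrable_const _), integral_sub i1 ((hi s).const_mul c),
      integral_sub (hii t s) ((hi t).const_mul c), integral_const_mul, integral_const_mul,
      hV.integral_comp t hf, hV.integral_comp s hf]
    have := (abs_le.1 (hV.cov_le t s f f hf hf hf1 hf1)).2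
    simp only [integral_const, probReal_univ, one_smul]
    rw [← hc] at this ⊢
    nlinarith
  have hsum : ∑ t ∈ Finset.Icc (1 : ℤ) n, ∫ ω, ∑ s ∈ Finset.Icc (1 : ℤ) n,
      (f (V t ω) * f (V s ω) - c * f (V t ω) - c * f (V s ω) + c ^ 2) ∂μ ≤ n * total a := by
    refine (Finset.sum_le_card_nsmul _ _ (total a) fun t _ => ?_).trans (by simp)
    rw [integral_finsetSum _ fun s _ => hI t s]
    exact (Finset.sum_le_sum fun s _ => hterm t s).trans (hV.sum_lag_le _ t)
  calc _ ≤ ((n : ℝ) ^ 2)⁻¹ * (n * total a) := by gcongr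
    _ = total a / n := by field_simp

theorem integral_abs_le_sqrt {X : Ω → ℝ} (hX : Measurable X) {B : ℝ} (hB : ∀ ω, |X ω| ≤ B) :
    ∫ ω, |X ω| ∂μ ≤ √(∫ ω, X ω ^ 2 ∂μ) := by
  refine Real.le_sqrt_of_sq_le ?_
  set m := ∫ ω, |X ω| ∂μ with hm
  have i1 : Integrable (fun ω => |X ω|) μ :=
    integrable_of_abs_le (by fun_prop) (B := B) fun ω => by rw [abs_abs]; exact hB ω
  have i2 : Integrable (fun ω => X ω ^ 2) μ :=
    integrable_of_abs_le (by fun_prop) (B := B ^ 2) fun ω => by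
      rw [abs_pow]; exact pow_le_pow_left₀ (abs_nonneg _) (hB ω) 2
  have h0 : 0 ≤ ∫ ω, (|X ω| - m) ^ 2 ∂μ := integral_nonneg fun ω => sq_nonneg _
  have e : ∀ ω, (|X ω| - m) ^ 2 = X ω ^ 2 - 2 * m * |X ω| + m ^ 2 := fun ω => by
    rw [sub_sq, sq_abs]; ring
  simp_rw [e] at h0
  have i3 : Integrable (fun ω => X ω ^ 2 - 2 * m * |X ω|) μ := i2.sub (i1.const_mul _)
  rw [integral_add i3 (integrable_const _), integral_sub i2 (i1.const_mul _),
    integral_const_mul, ← hm] at h0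
  simp at h0
  nlinarith

theorem integral_abs_avg_sub_le (hV : MixingSequence μ V Q a) {n : ℕ} (hn : 0 < n) {f : E → ℝ}
    (hf : Measurable f) (hf1 : ∀ x, |f x| ≤ 1) :
    ∫ ω, |avg V n f ω - ∫ x, f x ∂Q| ∂μ ≤ √(total a / n) := by
  refine (integral_abs_le_sqrt ((hV.measurable_avg n hf).sub_const _)
    (B := 1 + |∫ x, f x ∂Q|) fun ω => ?_).trans
    (Real.sqrt_le_sqrt (hV.integral_sq_avg_sub_le hn hf hf1))
  exact (abs_sub _ _).trans (by gcongr; exact abs_avg_le n zero_le_one hf1 ω)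

end MixingSequence

end MixingSequences

/-! ### Averages over pairs: decoupling of products and of their mixtures -/

section PairAverages

variable {Ω E : Type*} [MeasurableSpace Ω] [MeasurableSpace E]

/-- The average of `H (V_t, V_s)` over pairs of distinct indices in `{1, …, n}`. -/
def pairAvg (V : ℤ → Ω → E) (n : ℕ) (H : E → E → ℝ) (ω : Ω) : ℝ :=
  ((n : ℝ) ^ 2)⁻¹ * ∑ t ∈ Finset.Icc (1 : ℤ) n, ∑ s ∈ (Finset.Icc (1 : ℤ) n).erase t,
    H (V t ω) (V s ω)

/-- The mean absolute deviation of the pair average from its value under independence. -/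
def pairDev (μ : Measure Ω) (V : ℤ → Ω → E) (Q : Measure E) (n : ℕ) (H : E → E → ℝ) : ℝ≥0∞ :=
  ∫⁻ ω, ‖pairAvg V n H ω - ∫ x, ∫ x', H x x' ∂Q ∂Q‖ₑ ∂μ

/-- The average of `E |H (V_t, V_s)|` over pairs of distinct indices. -/
def pairMean (μ : Measure Ω) (V : ℤ → Ω → E) (n : ℕ) (H : E → E → ℝ) : ℝ≥0∞ :=
  ((n : ℝ≥0∞) ^ 2)⁻¹ * ∑ t ∈ Finset.Icc (1 : ℤ) n, ∑ s ∈ (Finset.Icc (1 : ℤ) n).erase t,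
    ∫⁻ ω, ‖H (V t ω) (V s ω)‖ₑ ∂μ

variable {μ : Measure Ω} [IsProbabilityMeasure μ] {V : ℤ → Ω → E} {Q : Measure E} {a : ℕ → ℝ}

theorem measurable_pairAvg (hV : ∀ t, Measurable (V t)) (n : ℕ) {H : E → E → ℝ}
    (hH : Measurable (Function.uncurry H)) : Measurable (pairAvg V n H) :=
  (Finset.measurable_fun_sum _ fun t _ => Finset.measurable_fun_sum _ fun s _ =>
    hH.comp ((hV t).prodMk (hV s))).const_mul _

theorem lintegral_enorm_pairAvg_le (hV : ∀ t, Measurable (V t)) (n : ℕ) {H : E → E → ℝ}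
    (hH : Measurable (Function.uncurry H)) :
    ∫⁻ ω, ‖pairAvg V n H ω‖ₑ ∂μ ≤ pairMean μ V n H := by
  have hm : ∀ t s, Measurable fun ω => ‖H (V t ω) (V s ω)‖ₑ := fun t s =>
    (hH.comp ((hV t).prodMk (hV s))).enorm
  rw [pairMean]
  simp_rw [pairAvg, enorm_mul]
  rw [lintegral_const_mul]
  · rcases n.eq_zero_or_pos with rfl | hn
    · simp
    gcongr
    · rw [enorm_inv (by positivity)]
      simp [enorm_pow]
    rw [← lintegral_finsetSum _ (fun t _ => Finset.measurable_fun_sum _ fun s _ => hm t s) |>.trans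
      (Finset.sum_congr rfl fun t _ => lintegral_finsetSum _ fun s _ => hm t s)]
    refine lintegral_mono fun ω => ?_
    exact (enorm_sum_le _ _).trans (Finset.sum_le_sum fun t _ => enorm_sum_le _ _)
  · exact (Finset.measurable_fun_sum _ fun t _ => Finset.measurable_fun_sum _ fun s _ =>
      hH.comp ((hV t).prodMk (hV s))).enorm

theorem pairMean_mono (n : ℕ) {H H' : E → E → ℝ} (h : ∀ x x', ‖H x x'‖ ≤ ‖H' x x'‖) :
    pairMean μ V n H ≤ pairMean μ V n H' := by
  unfold pairMean
  gcongr with t _ s _ ω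
  exact enorm_le_iff_norm_le.2 (h _ _)

theorem abs_integral_le_of_abs_le {E : Type*} [MeasurableSpace E] {Q : Measure E}
    [IsProbabilityMeasure Q] {f : E → ℝ} {B : ℝ} (hB : ∀ x, |f x| ≤ B) : |∫ x, f x ∂Q| ≤ B := by
  have h : ∀ᵐ x ∂Q, ‖f x‖ ≤ B := .of_forall hB
  simpa using norm_integral_le_of_norm_le_const h

theorem integrable_pair [IsFiniteMeasure Q] {H : E → E → ℝ} (hH : Measurable (Function.uncurry H))
    {B : ℝ} (hB : ∀ x x', |H x x'| ≤ B) : Integrable (Function.uncurry H) (Q.prod Q) :=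
  integrable_of_abs_le hH fun _ => hB _ _

/-- The crude bound by absolute values, for functions that are small in mean; no cancellation is
used. -/
theorem pairDev_le_add (hV : ∀ t, Measurable (V t)) [IsProbabilityMeasure Q] (n : ℕ)
    {H : E → E → ℝ} (hH : Measurable (Function.uncurry H)) :
    pairDev μ V Q n H ≤ pairMean μ V n H + ∫⁻ x, ∫⁻ x', ‖H x x'‖ₑ ∂Q ∂Q := by
  unfold pairDev
  calc _ ≤ ∫⁻ ω, (‖pairAvg V n H ω‖ₑ + ‖∫ x, ∫ x', H x x' ∂Q ∂Q‖ₑ) ∂μ :=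
        lintegral_mono fun ω => enorm_sub_le
    _ = ∫⁻ ω, ‖pairAvg V n H ω‖ₑ ∂μ + ‖∫ x, ∫ x', H x x' ∂Q ∂Q‖ₑ := by
        rw [lintegral_add_right _ measurable_const]; simp
    _ ≤ _ := by
        gcongr
        · exact lintegral_enorm_pairAvg_le hV n hH
        · refine (enorm_integral_le_lintegral_enorm _).trans (lintegral_mono fun x => ?_)
          exact enorm_integral_le_lintegral_enorm _

theorem pairAvg_add (n : ℕ) (H H' : E → E → ℝ) (ω : Ω) :
    pairAvg V n (fun x x' => H x x' + H' x x') ω = pairAvg V n H ω + pairAvg V n H' ω := by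
  simp only [pairAvg, Finset.sum_add_distrib, mul_add]

theorem pairAvg_const_mul (n : ℕ) (c : ℝ) (H : E → E → ℝ) (ω : Ω) :
    pairAvg V n (fun x x' => c * H x x') ω = c * pairAvg V n H ω := by
  simp only [pairAvg, ← Finset.mul_sum]
  ring

theorem integral_integral_add [IsFiniteMeasure Q] {H H' : E → E → ℝ}
    (hH : Measurable (Function.uncurry H)) (hH' : Measurable (Function.uncurry H'))
    {B B' : ℝ} (hB : ∀ x x', |H x x'| ≤ B) (hB' : ∀ x x', |H' x x'| ≤ B') :
    ∫ x, ∫ x', (H x x' + H' x x') ∂Q ∂Q = ∫ x, ∫ x', H x x' ∂Q ∂Q + ∫ x, ∫ x', H' x x' ∂Q ∂Q := by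
  have h1 := integrable_pair (Q := Q) hH hB
  have h2 := integrable_pair (Q := Q) hH' hB'
  exact MeasureTheory.integral_integral_add h1 h2

theorem pairDev_add_le (hV : ∀ t, Measurable (V t)) [IsProbabilityMeasure Q] (n : ℕ)
    {H H' : E → E → ℝ} (hH : Measurable (Function.uncurry H))
    (hH' : Measurable (Function.uncurry H'))
    {B B' : ℝ} (hB : ∀ x x', |H x x'| ≤ B) (hB' : ∀ x x', |H' x x'| ≤ B') :
    pairDev μ V Q n (fun x x' => H x x' + H' x x') ≤ pairDev μ V Q n H + pairDev μ V Q n H' := by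
  unfold pairDev
  rw [← lintegral_add_left ((measurable_pairAvg hV n hH).sub_const _).enorm]
  refine lintegral_mono fun ω => ?_
  rw [pairAvg_add, integral_integral_add hH hH' hB hB', add_sub_add_comm]
  exact enorm_add_le _ _

theorem pairDev_const_mul (n : ℕ) (c : ℝ) (H : E → E → ℝ) :
    pairDev μ V Q n (fun x x' => c * H x x') = ‖c‖ₑ * pairDev μ V Q n H := by
  unfold pairDev
  simp_rw [pairAvg_const_mul, integral_const_mul, ← mul_sub, enorm_mul]
  rw [lintegral_const_mul' _ _ (by simp)]

open MixingSequence

theorem pairAvg_mul (n : ℕ) (f g : E → ℝ) (ω : Ω) :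
    pairAvg V n (fun x x' => f x * g x') ω =
      avg V n f ω * avg V n g ω - (n : ℝ)⁻¹ * avg V n (fun x => f x * g x) ω := by
  unfold pairAvg avg
  have : ∀ t ∈ Finset.Icc (1 : ℤ) n, ∑ s ∈ (Finset.Icc (1 : ℤ) n).erase t, f (V t ω) * g (V s ω) =
      (∑ s ∈ Finset.Icc (1 : ℤ) n, f (V t ω) * g (V s ω)) - f (V t ω) * g (V t ω) := by
    intro t ht
    rw [← Finset.sum_erase_add _ _ ht]; ring
  rw [Finset.sum_congr rfl this, Finset.sum_sub_distrib, ← Finset.sum_mul_sum]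
  ring

/-- Off the diagonal, the average of `f(V_t) g(V_s)` is the product of the two sample means minus
`n⁻¹` times a mean of `f g`. Each sample mean is within `√(total a / n)` of its limit in `L¹`, and
the diagonal costs `n⁻¹`. -/
theorem integral_abs_pairAvg_mul_sub_le (hV : MixingSequence μ V Q a) {n : ℕ} (hn : 0 < n)
    {f g : E → ℝ} (hf : Measurable f) (hg : Measurable g) (hf1 : ∀ x, |f x| ≤ 1)
    (hg1 : ∀ x, |g x| ≤ 1) :
    ∫ ω, |pairAvg V n (fun x x' => f x * g x') ω - (∫ x, f x ∂Q) * ∫ x, g x ∂Q| ∂μ ≤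
      2 * √(total a / n) + (n : ℝ)⁻¹ := by
  have := hV.isProbabilityMeasure
  have hfg1 : ∀ x, |f x * g x| ≤ 1 := fun x => by
    rw [abs_mul]; exact mul_le_one₀ (hf1 _) (abs_nonneg _) (hg1 _)
  set c := ∫ x, f x ∂Q
  set c' := ∫ x, g x ∂Q
  have hc : |c| ≤ 1 := abs_integral_le_of_abs_le hf1
  have b1 : ∀ ω, |avg V n f ω - c| ≤ 2 := fun ω =>
    (abs_sub _ _).trans (by linarith [abs_avg_le (V := V) n zero_le_one hf1 ω])
  have hc' : |c'| ≤ 1 := abs_integral_le_of_abs_le hg1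
  have b2 : ∀ ω, |avg V n g ω - c'| ≤ 2 := fun ω =>
    (abs_sub _ _).trans (by linarith [abs_avg_le (V := V) n zero_le_one hg1 ω])
  have m1 := hV.measurable_avg n hf
  have m2 := hV.measurable_avg n hg
  have i1 : Integrable (fun ω => |avg V n f ω - c|) μ :=
    integrable_of_abs_le (by fun_prop) (B := 2) fun ω => by rw [abs_abs]; exact b1 ω
  have i2 : Integrable (fun ω => |avg V n g ω - c'|) μ :=
    integrable_of_abs_le (by fun_prop) (B := 2) fun ω => by rw [abs_abs]; exact b2 ω
  have hpt : ∀ ω, |pairAvg V n (fun x x' => f x * g x') ω - c * c'| ≤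
      |avg V n f ω - c| + |avg V n g ω - c'| + (n : ℝ)⁻¹ := by
    intro ω
    rw [pairAvg_mul]
    have e : avg V n f ω * avg V n g ω - (n : ℝ)⁻¹ * avg V n (fun x => f x * g x) ω - c * c' =
        (avg V n f ω - c) * avg V n g ω + c * (avg V n g ω - c') +
          -((n : ℝ)⁻¹ * avg V n (fun x => f x * g x) ω) := by ring
    rw [e]
    refine (abs_add_three _ _ _).trans ?_
    rw [abs_mul, abs_mul, abs_neg, abs_mul, abs_of_nonneg (by positivity : (0 : ℝ) ≤ (n : ℝ)⁻¹)]
    have h1 := abs_avg_le (V := V) n zero_le_one hg1 ω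
    have h2 := abs_avg_le (V := V) n zero_le_one hfg1 ω
    gcongr
    · exact mul_le_of_le_one_right (abs_nonneg _) h1
    · exact mul_le_of_le_one_left (abs_nonneg _) hc
    · exact mul_le_of_le_one_right (by positivity) h2
  have i3 : Integrable (fun ω => |avg V n f ω - c| + |avg V n g ω - c'|) μ := i1.add i2
  refine (integral_mono_of_nonneg (.of_forall fun ω => abs_nonneg _)
    (i3.add (integrable_const _)) (.of_forall hpt)).trans ?_
  simp only [Pi.add_apply]
  rw [integral_add i3 (integrable_const _), integral_add i1 i2]
  have h1 := hV.integral_abs_avg_sub_le hn hf hf1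
  have h2 := hV.integral_abs_avg_sub_le hn hg hg1
  simp only [integral_const, probReal_univ, one_smul]
  linarith

/-- The constant in the bound for deviations of pair averages. -/
def devConst (a : ℕ → ℝ) : ℝ := 2 * √(total a) + 1

theorem devConst_nonneg (a : ℕ → ℝ) : 0 ≤ devConst a := by unfold devConst; positivity

/-- Pair averages of mixtures of products of bounded functions are close to their value under
independence. -/
theorem pairDev_mixture_le (hV : MixingSequence μ V Q a) {n : ℕ} (hn : 0 < n)
    {Θ : Type*} [MeasurableSpace Θ] (ν : Measure Θ) [IsFiniteMeasure ν] {f g : Θ → E → ℝ}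
    (hf : Measurable (Function.uncurry f)) (hg : Measurable (Function.uncurry g))
    (hf1 : ∀ θ x, |f θ x| ≤ 1) (hg1 : ∀ θ x, |g θ x| ≤ 1) :
    pairDev μ V Q n (fun x x' => ∫ θ, f θ x * g θ x' ∂ν) ≤
      ν Set.univ * ENNReal.ofReal (devConst a / √n) := by
  have := hV.isProbabilityMeasure
  have hn' : (1 : ℝ) ≤ n := by exact_mod_cast hn
  have hfm : ∀ θ, Measurable (f θ) := fun θ => hf.comp measurable_prodMk_left
  have hgm : ∀ θ, Measurable (g θ) := fun θ => hg.comp measurable_prodMk_left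
  have hfm' : ∀ x, Measurable fun θ => f θ x := fun x => hf.comp measurable_prodMk_right
  have hgm' : ∀ x, Measurable fun θ => g θ x := fun x => hg.comp measurable_prodMk_right
  have hfg1 : ∀ θ x x', |f θ x * g θ x'| ≤ 1 := fun θ x x' => by
    rw [abs_mul]; exact mul_le_one₀ (hf1 _ _) (abs_nonneg _) (hg1 _ _)
  have hint : ∀ x x', Integrable (fun θ => f θ x * g θ x') ν := fun x x' =>
    integrable_of_abs_le ((hfm' x).mul (hgm' x')) fun θ => hfg1 θ x x'
  set X : Ω → Θ → ℝ := fun ω θ => pairAvg V n (fun x x' => f θ x * g θ x') ω with hX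
  set c : Θ → ℝ := fun θ => (∫ x, f θ x ∂Q) * ∫ x, g θ x ∂Q with hc
  have hXm : Measurable (Function.uncurry X) := by
    refine (Finset.measurable_fun_sum _ fun t _ => Finset.measurable_fun_sum _ fun s _ => ?_).const_mul _
    exact (hf.comp (measurable_snd.prodMk ((hV.measurable t).comp measurable_fst))).mul
      (hg.comp (measurable_snd.prodMk ((hV.measurable s).comp measurable_fst)))
  have hIf : Measurable fun θ => ∫ x, f θ x ∂Q :=
    (hf.stronglyMeasurable.integral_prod_right' (ν := Q)).measurable
  have hIg : Measurable fun θ => ∫ x, g θ x ∂Q :=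
    (hg.stronglyMeasurable.integral_prod_right' (ν := Q)).measurable
  have hcm : Measurable c := hIf.mul hIg
  have hIg1 : ∀ θ, |∫ x, g θ x ∂Q| ≤ 1 := fun θ =>
    abs_integral_le_of_abs_le (hg1 θ)
  have hIf1 : ∀ θ, |∫ x, f θ x ∂Q| ≤ 1 := fun θ =>
    abs_integral_le_of_abs_le (hf1 θ)
  have hci : Integrable c ν := integrable_of_abs_le hcm (B := 1) fun θ => by
    rw [abs_mul]; exact mul_le_one₀ (hIf1 _) (abs_nonneg _) (hIg1 _)
  have hXi : ∀ ω, Integrable (X ω) ν := fun ω =>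
    (integrable_finsetSum _ fun t _ => integrable_finsetSum _ fun s _ => hint _ _).const_mul _
  have e1 : ∀ ω, pairAvg V n (fun x x' => ∫ θ, f θ x * g θ x' ∂ν) ω = ∫ θ, X ω θ ∂ν := by
    intro ω
    simp only [hX, pairAvg]
    rw [integral_const_mul, integral_finsetSum _ fun t _ => integrable_finsetSum _ fun s _ => hint _ _]
    congr 1
    exact Finset.sum_congr rfl fun t _ => (integral_finsetSum _ fun s _ => hint _ _).symm
  have e2 : ∫ x, ∫ x', ∫ θ, f θ x * g θ x' ∂ν ∂Q ∂Q = ∫ θ, c θ ∂ν := by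
    have h1 : ∀ x, ∫ x', ∫ θ, f θ x * g θ x' ∂ν ∂Q = ∫ θ, f θ x * ∫ x', g θ x' ∂Q ∂ν := by
      intro x
      rw [integral_integral_swap]
      · simp_rw [integral_const_mul]
      · refine integrable_of_abs_le (B := 1) ?_ fun p => hfg1 _ _ _
        exact ((hfm' x).comp measurable_snd).mul (hg.comp measurable_swap)
    simp_rw [h1]
    rw [integral_integral_swap]
    · simp_rw [integral_mul_const, hc]
    · refine integrable_of_abs_le (B := 1) ?_ fun p => ?_
      · exact (hf.comp measurable_swap).mul (hIg.comp measurable_snd)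
      · simp only [Function.uncurry]
        rw [abs_mul]; exact mul_le_one₀ (hf1 _ _) (abs_nonneg _) (hIg1 _)
  have hθ : ∀ θ, ∫⁻ ω, ‖X ω θ - c θ‖ₑ ∂μ ≤ ENNReal.ofReal (devConst a / √n) := by
    intro θ
    have hm : Measurable fun ω => X ω θ - c θ := (hXm.comp measurable_prodMk_right).sub_const _
    have hi : Integrable (fun ω => X ω θ - c θ) μ := by
      have : Integrable (fun ω => X ω θ) μ := by
        refine (integrable_finsetSum _ fun t _ => integrable_finsetSum _ fun s _ => ?_).const_mul _
        exact integrable_of_abs_le (((hfm θ).comp (hV.measurable t)).mul ((hgm θ).comp (hV.measurable s)))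
          fun ω => hfg1 θ _ _
      exact this.sub (integrable_const _)
    rw [← ofReal_integral_norm_eq_lintegral_enorm hi]
    refine ENNReal.ofReal_le_ofReal ?_
    refine (integral_abs_pairAvg_mul_sub_le hV hn (hfm θ) (hgm θ) (hf1 θ) (hg1 θ)).trans ?_
    unfold devConst
    rw [Real.sqrt_div hV.total_nonneg, add_div, mul_div_assoc]
    gcongr
    rw [one_div]
    refine inv_anti₀ (by positivity) ?_
    rw [Real.sqrt_le_left (by positivity)]
    nlinarith
  unfold pairDev
  -- The deviation of the mixture is the mixture of the deviations, so Tonelli reduces the bound to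
  -- one that is uniform in `θ`.
  calc _ = ∫⁻ ω, ‖∫ θ, (X ω θ - c θ) ∂ν‖ₑ ∂μ := by
        refine lintegral_congr fun ω => ?_
        rw [e1, e2, integral_sub (hXi ω) hci]
    _ ≤ ∫⁻ ω, ∫⁻ θ, ‖X ω θ - c θ‖ₑ ∂ν ∂μ :=
        lintegral_mono fun ω => enorm_integral_le_lintegral_enorm _
    _ = ∫⁻ θ, ∫⁻ ω, ‖X ω θ - c θ‖ₑ ∂μ ∂ν := by
        rw [lintegral_lintegral_swap]
        exact (hXm.sub (hcm.comp measurable_snd)).enorm.aemeasurable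
    _ ≤ ∫⁻ θ, ENNReal.ofReal (devConst a / √n) ∂ν := lintegral_mono hθ
    _ = _ := by rw [lintegral_const, mul_comm]

end PairAverages

/-! ### Kernels that are mixtures of cosines -/

section CosineMixtures

/-- A product of characteristic functions is a mixture of cosines. -/
theorem prod_charFun_eq_integral_cos {ι : Type*} [Fintype ι] (ν : Measure ℝ) [IsFiniteMeasure ν]
    {ψ : ℝ → ℝ} (hψ : ∀ t, charFun ν t = (ψ t : ℂ)) (u : ι → ℝ) :
    ∏ j, ψ (u j) = ∫ ξ : ι → ℝ, Real.cos (∑ j, u j * ξ j) ∂(Measure.pi fun _ : ι => ν) := by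
  have h1 : ((∏ j, ψ (u j) : ℝ) : ℂ) =
      ∫ ξ : ι → ℝ, Complex.exp ((∑ j, u j * ξ j : ℝ) * Complex.I) ∂(Measure.pi fun _ : ι => ν) := by
    have h2 := integral_fintype_prod_eq_prod (μ := fun _ : ι => ν)
      (fun (j : ι) (x : ℝ) => Complex.exp ((u j : ℂ) * x * Complex.I))
    simp_rw [← charFun_apply_real, hψ] at h2
    rw [Complex.ofReal_prod, ← h2]
    refine integral_congr_ae (.of_forall fun ξ => ?_)
    simp only [← Complex.exp_sum]
    congr 1
    push_cast
    rw [Finset.sum_mul]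
  have hi : Integrable (fun ξ : ι → ℝ => Complex.exp ((∑ j, u j * ξ j : ℝ) * Complex.I))
      (Measure.pi fun _ : ι => ν) := by
    refine Integrable.of_bound (Continuous.aestronglyMeasurable (by fun_prop)) 1 (.of_forall fun ξ => ?_)
    rw [Complex.norm_exp_ofReal_mul_I]
  have h3 := congrArg Complex.re h1
  rw [Complex.ofReal_re] at h3
  have h4 := integral_re hi
  simp only [RCLike.re_eq_complex_re] at h4
  rw [h3, ← h4]
  refine integral_congr_ae (.of_forall fun ξ => ?_)
  simp only [Complex.exp_ofReal_mul_I_re]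

variable {Ω E : Type*} [MeasurableSpace Ω] [MeasurableSpace E]
variable {μ : Measure Ω} [IsProbabilityMeasure μ] {V : ℤ → Ω → E} {Q : Measure E} {a : ℕ → ℝ}

/-- By the addition formula the cosine of `ℓ θ x - ℓ' θ x'` is a sum of two products of a function
of `x` and a function of `x'`. Each product gives a mixture covered by `pairDev_mixture_le`, whence
the factor `2`. The weight `s` carries signs, so that `ν` may be a positive measure. -/
theorem pairDev_cos_le (hV : MixingSequence μ V Q a) {n : ℕ} (hn : 0 < n)
    {Θ : Type*} [MeasurableSpace Θ] (ν : Measure Θ) [IsFiniteMeasure ν] {ℓ ℓ' : Θ → E → ℝ} {s : Θ → ℝ}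
    {f g : E → ℝ} (hℓ : Measurable (Function.uncurry ℓ)) (hℓ' : Measurable (Function.uncurry ℓ'))
    (hs : Measurable s) (hs1 : ∀ θ, |s θ| ≤ 1)
    (hf : Measurable f) (hg : Measurable g) (hf1 : ∀ x, |f x| ≤ 1) (hg1 : ∀ x, |g x| ≤ 1) :
    pairDev μ V Q n (fun x x' => f x * g x' * ∫ θ, s θ * Real.cos (ℓ θ x - ℓ' θ x') ∂ν) ≤
      2 * (ν Set.univ * ENNReal.ofReal (devConst a / √n)) := by
  have := hV.isProbabilityMeasure
  have aux : ∀ (c : ℝ → ℝ), Measurable c → (∀ r, |c r| ≤ 1) →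
      Measurable (Function.uncurry fun θ x => s θ * (f x * c (ℓ θ x))) ∧
      Measurable (Function.uncurry fun θ x => g x * c (ℓ' θ x)) ∧
      (∀ θ x, |s θ * (f x * c (ℓ θ x))| ≤ 1) ∧ (∀ θ x, |g x * c (ℓ' θ x)| ≤ 1) := by
    intro c hc hc1
    refine ⟨(hs.comp measurable_fst).mul ((hf.comp measurable_snd).mul (hc.comp hℓ)),
      (hg.comp measurable_snd).mul (hc.comp hℓ'), fun θ x => ?_, fun θ x => ?_⟩
    · rw [abs_mul, abs_mul]
      exact mul_le_one₀ (hs1 _) (by positivity) (mul_le_one₀ (hf1 _) (by positivity) (hc1 _))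
    · rw [abs_mul]
      exact mul_le_one₀ (hg1 _) (by positivity) (hc1 _)
  obtain ⟨c1, c2, c3, c4⟩ := aux Real.cos (by fun_prop) Real.abs_cos_le_one
  obtain ⟨s1, s2, s3, s4⟩ := aux Real.sin (by fun_prop) Real.abs_sin_le_one
  set F : E → E → ℝ := fun x x' => ∫ θ, s θ * (f x * Real.cos (ℓ θ x)) * (g x' * Real.cos (ℓ' θ x')) ∂ν
  set G : E → E → ℝ := fun x x' => ∫ θ, s θ * (f x * Real.sin (ℓ θ x)) * (g x' * Real.sin (ℓ' θ x')) ∂ν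
  have meas : ∀ {p q : Θ → E → ℝ}, Measurable (Function.uncurry p) → Measurable (Function.uncurry q) →
      Measurable (Function.uncurry fun x x' => ∫ θ, p θ x * q θ x' ∂ν) := by
    intro p q hp hq
    have h : Measurable fun z : (E × E) × Θ => p z.2 z.1.1 * q z.2 z.1.2 :=
      (hp.comp (by fun_prop : Measurable fun z : (E × E) × Θ => (z.2, z.1.1))).mul
        (hq.comp (by fun_prop : Measurable fun z : (E × E) × Θ => (z.2, z.1.2)))
    exact (h.stronglyMeasurable.integral_prod_right' (ν := ν)).measurable
  have bd : ∀ {p q : Θ → E → ℝ}, (∀ θ x, |p θ x| ≤ 1) → (∀ θ x, |q θ x| ≤ 1) →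
      ∀ x x', |∫ θ, p θ x * q θ x' ∂ν| ≤ 1 * ν.real Set.univ := by
    intro p q hp hq x x'
    have h : ∀ᵐ θ ∂ν, ‖p θ x * q θ x'‖ ≤ 1 := .of_forall fun θ => by
      rw [norm_mul]; exact mul_le_one₀ (hp _ _) (norm_nonneg _) (hq _ _)
    exact norm_integral_le_of_norm_le_const h
  have int : ∀ {p q : Θ → E → ℝ}, Measurable (Function.uncurry p) → Measurable (Function.uncurry q) →
      (∀ θ x, |p θ x| ≤ 1) → (∀ θ x, |q θ x| ≤ 1) → ∀ x x', Integrable (fun θ => p θ x * q θ x') ν := by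
    intro p q hp hq hp1 hq1 x x'
    refine integrable_of_abs_le ((hp.comp measurable_prodMk_right).mul (hq.comp measurable_prodMk_right))
      (B := 1) fun θ => ?_
    rw [abs_mul]; exact mul_le_one₀ (hp1 _ _) (abs_nonneg _) (hq1 _ _)
  have e : (fun x x' => f x * g x' * ∫ θ, s θ * Real.cos (ℓ θ x - ℓ' θ x') ∂ν) =
      fun x x' => F x x' + G x x' := by
    ext x x'
    rw [← integral_const_mul, ← integral_add (int c1 c2 c3 c4 x x') (int s1 s2 s3 s4 x x')]
    refine integral_congr_ae (.of_forall fun θ => ?_)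
    simp only [Real.cos_sub]
    ring
  rw [e, two_mul]
  refine (pairDev_add_le hV.measurable n (meas c1 c2) (meas s1 s2) (bd c3 c4) (bd s3 s4)).trans ?_
  exact add_le_add (pairDev_mixture_le hV hn ν c1 c2 c3 c4) (pairDev_mixture_le hV hn ν s1 s2 s3 s4)

end CosineMixtures

/-! ### Approximate identities in `L¹` -/

section Mollification

variable {ι : Type*} [Fintype ι]

theorem measurePreserving_sub_const (z : ι → ℝ) :
    MeasurePreserving (fun x : ι → ℝ => x - z) volume volume := measurePreserving_sub_right volume z

/-- Continuity of translations in `L¹`, obtained from the continuity of composition with a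
continuous family of measure-preserving maps. -/
theorem tendsto_lintegral_translate {B : (ι → ℝ) → ℝ} (hB : Integrable B) :
    Tendsto (fun z : ι → ℝ => ∫⁻ x, ‖B (x - z) - B x‖ₑ) (𝓝 0) (𝓝 0) := by
  have hmem : MemLp B 1 (volume : Measure (ι → ℝ)) := memLp_one_iff_integrable.2 hB
  set b : Lp ℝ 1 (volume : Measure (ι → ℝ)) := hmem.toLp B with hb
  let g : (ι → ℝ) → C(ι → ℝ, ι → ℝ) := fun z => ⟨fun x => x - z, by fun_prop⟩
  have hg : Continuous g := by
    refine ContinuousMap.continuous_of_continuous_uncurry _ ?_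
    change Continuous fun p : (ι → ℝ) × (ι → ℝ) => p.2 - p.1
    fun_prop
  have hgm : ∀ z, MeasurePreserving (g z) (volume : Measure (ι → ℝ)) volume :=
    measurePreserving_sub_const
  have hcont := Continuous.compMeasurePreservingLp (f := fun _ : ι → ℝ => b) continuous_const hg hgm
    (by simp)
  have ht := (hcont.tendsto 0).edist (tendsto_const_nhds (x := b))
  have hcoe : ∀ z, (Lp.compMeasurePreserving (g z) (hgm z) b : (ι → ℝ) → ℝ) =ᵐ[volume]
      fun x => B (x - z) := by
    intro z
    refine (Lp.coeFn_compMeasurePreserving b (hgm z)).trans ?_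
    exact (hgm z).quasiMeasurePreserving.ae_eq_comp hmem.coeFn_toLp
  have hed : ∀ z, edist (Lp.compMeasurePreserving (g z) (hgm z) b) b = ∫⁻ x, ‖B (x - z) - B x‖ₑ := by
    intro z
    rw [Lp.edist_def, eLpNorm_one_eq_lintegral_enorm]
    refine lintegral_congr_ae ?_
    filter_upwards [hcoe z, hmem.coeFn_toLp] with x h1 h2
    rw [Pi.sub_apply, h1, hb, h2]
  simp_rw [hed] at ht
  simpa using ht

/-- The smoothing of `B` by the kernel `γ` with bandwidth `h`. -/
def smoothing (γ : (ι → ℝ) → ℝ) (h : ℝ) (B : (ι → ℝ) → ℝ) (x : ι → ℝ) : ℝ :=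
  ∫ v, γ v * B (x - h • v)

theorem integrable_smoothing_integrand {γ B : (ι → ℝ) → ℝ} (hγ : Integrable γ) (hB : Measurable B)
    {C : ℝ} (hC : ∀ x, |B x| ≤ C) (h : ℝ) (x : ι → ℝ) : Integrable fun v => γ v * B (x - h • v) :=
  hγ.mul_bdd (c := C) (Measurable.aestronglyMeasurable (by fun_prop)) (.of_forall fun v => hC _)

theorem measurable_smoothing {γ B : (ι → ℝ) → ℝ} (hγ : Measurable γ) (hB : Measurable B) (h : ℝ) :
    Measurable (smoothing γ h B) := by
  have : Measurable fun p : (ι → ℝ) × (ι → ℝ) => γ p.2 * B (p.1 - h • p.2) := by fun_prop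
  exact (this.stronglyMeasurable.integral_prod_right' (ν := (volume : Measure (ι → ℝ)))).measurable

theorem abs_smoothing_le {γ B : (ι → ℝ) → ℝ} (hγ : Integrable γ)
    {C : ℝ} (hC : ∀ x, |B x| ≤ C) (h : ℝ) (x : ι → ℝ) : |smoothing γ h B x| ≤ (∫ v, |γ v|) * C := by
  unfold smoothing
  rw [← integral_mul_const]
  refine (abs_integral_le_integral_abs).trans ?_
  refine integral_mono_of_nonneg (.of_forall fun v => abs_nonneg _) (hγ.abs.mul_const C)
    (.of_forall fun v => ?_)
  simp only [abs_mul]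
  exact mul_le_mul_of_nonneg_left (hC _) (abs_nonneg _)

/-- Smoothing by an integrable kernel is an approximate identity in `L¹`. -/
theorem tendsto_lintegral_smoothing {γ B : (ι → ℝ) → ℝ} (hγ : Integrable γ) (hγm : Measurable γ)
    (hB : Measurable B) (hBi : Integrable B) {C : ℝ} (hC : ∀ x, |B x| ≤ C) :
    Tendsto (fun h : ℝ => ∫⁻ x, ‖smoothing γ h B x - (∫ v, γ v) * B x‖ₑ) (𝓝 0) (𝓝 0) := by
  set w : (ι → ℝ) → ℝ≥0∞ := fun z => ∫⁻ x, ‖B (x - z) - B x‖ₑ with hw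
  have hwm : Measurable w := by
    have : Measurable fun p : (ι → ℝ) × (ι → ℝ) => ‖B (p.2 - p.1) - B p.2‖ₑ := by fun_prop
    exact this.lintegral_prod_right'
  have hwle : ∀ z, w z ≤ 2 * ∫⁻ x, ‖B x‖ₑ := by
    intro z
    calc w z ≤ ∫⁻ x, (‖B (x - z)‖ₑ + ‖B x‖ₑ) := lintegral_mono fun x => enorm_sub_le
      _ = (∫⁻ x, ‖B (x - z)‖ₑ) + ∫⁻ x, ‖B x‖ₑ := lintegral_add_right _ hB.enorm
      _ = 2 * ∫⁻ x, ‖B x‖ₑ := by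
        rw [lintegral_sub_right_eq_self (fun x => ‖B x‖ₑ) z, two_mul]
  have hle : ∀ h : ℝ, ∫⁻ x, ‖smoothing γ h B x - (∫ v, γ v) * B x‖ₑ ≤ ∫⁻ v, ‖γ v‖ₑ * w (h • v) := by
    intro h
    calc _ ≤ ∫⁻ x, ∫⁻ v, ‖γ v‖ₑ * ‖B (x - h • v) - B x‖ₑ := by
          refine lintegral_mono fun x => ?_
          unfold smoothing
          rw [← integral_mul_const, ← integral_sub (integrable_smoothing_integrand hγ hB hC h x)
            (hγ.mul_const _)]
          refine (enorm_integral_le_lintegral_enorm _).trans_eq (lintegral_congr fun v => ?_)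
          rw [← mul_sub, enorm_mul]
      _ = ∫⁻ v, ∫⁻ x, ‖γ v‖ₑ * ‖B (x - h • v) - B x‖ₑ := by
          rw [lintegral_lintegral_swap]
          exact Measurable.aemeasurable (by fun_prop)
      _ = _ := by
          refine lintegral_congr fun v => ?_
          rw [lintegral_const_mul _ (by fun_prop)]
  have hlim : Tendsto (fun h : ℝ => ∫⁻ v, ‖γ v‖ₑ * w (h • v)) (𝓝 0) (𝓝 0) := by
    have hdom := tendsto_lintegral_filter_of_dominated_convergence (μ := (volume : Measure (ι → ℝ)))
      (l := 𝓝 (0 : ℝ)) (F := fun h v => ‖γ v‖ₑ * w (h • v)) (f := fun _ => 0)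
      (fun v => ‖γ v‖ₑ * (2 * ∫⁻ x, ‖B x‖ₑ)) (.of_forall fun h => by fun_prop)
      (.of_forall fun h => .of_forall fun v => by gcongr; exact hwle _) ?_ ?_
    · simpa using hdom
    · rw [lintegral_mul_const _ hγm.enorm]
      exact ENNReal.mul_ne_top hγ.2.ne (ENNReal.mul_ne_top (by simp) hBi.2.ne)
    · refine .of_forall fun v => ?_
      have h1 : Tendsto (fun h : ℝ => h • v) (𝓝 0) (𝓝 0) := by
        have : Continuous fun h : ℝ => h • v := by fun_prop
        simpa using this.tendsto 0
      have h2 := ENNReal.Tendsto.const_mul (a := ‖γ v‖ₑ)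
        ((tendsto_lintegral_translate hBi).comp h1) (Or.inr (by simp))
      simpa using h2
  exact tendsto_of_tendsto_of_tendsto_of_le_of_le tendsto_const_nhds hlim (fun _ => zero_le) hle

theorem integral_scaled_kernel_eq_smoothing (γ B : (ι → ℝ) → ℝ) {h : ℝ} (hh : 0 < h) (x : ι → ℝ) :
    ∫ y, (h ^ Fintype.card ι)⁻¹ * γ (h⁻¹ • (x - y)) * B y = smoothing γ h B x := by
  have h1 := integral_sub_left_eq_self
    (fun u => (h ^ Fintype.card ι)⁻¹ * γ (h⁻¹ • u) * B (x - u)) (volume : Measure (ι → ℝ)) x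
  simp only [sub_sub_cancel] at h1
  rw [h1]
  have h2 := Measure.integral_comp_inv_smul_of_nonneg (volume : Measure (ι → ℝ))
    (fun v => γ v * B (x - h • v)) hh.le
  simp only [smul_inv_smul₀ hh.ne', Module.finrank_fintype_fun_eq_card] at h2
  simp_rw [mul_assoc, integral_const_mul]
  rw [h2, smul_eq_mul, inv_mul_cancel_left₀ (by positivity)]
  rfl

theorem lintegral_scaled_kernel {γ : (ι → ℝ) → ℝ} (hγ : Measurable γ) {h : ℝ} (hh : 0 < h)
    (x : ι → ℝ) :
    ∫⁻ y, ‖(h ^ Fintype.card ι)⁻¹ * γ (h⁻¹ • (x - y))‖ₑ = ∫⁻ y, ‖γ y‖ₑ := by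
  simp_rw [enorm_mul]
  rw [lintegral_const_mul _ (by fun_prop),
    lintegral_sub_left_eq_self (fun u : ι → ℝ => ‖γ (h⁻¹ • u)‖ₑ) x]
  have h1 := Measure.map_addHaar_smul (volume : Measure (ι → ℝ)) (inv_ne_zero hh.ne')
  have h2 : ∫⁻ u, ‖γ (h⁻¹ • u)‖ₑ = ∫⁻ u, ‖γ u‖ₑ ∂(Measure.map (h⁻¹ • ·) (volume : Measure (ι → ℝ))) := by
    rw [lintegral_map hγ.enorm (by fun_prop)]
  rw [h2, h1, lintegral_smul_measure, smul_eq_mul, ← mul_assoc]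
  have h3 : ‖(h ^ Fintype.card ι)⁻¹‖ₑ * ENNReal.ofReal |((h⁻¹) ^ Module.finrank ℝ (ι → ℝ))⁻¹| = 1 := by
    rw [Module.finrank_fintype_fun_eq_card, Real.enorm_eq_ofReal_abs,
      ← ENNReal.ofReal_mul (abs_nonneg _), ← abs_mul]
    simp [hh.ne']
  rw [h3, one_mul]

end Mollification

/-! ### Gaussian smoothing of a kernel as a mixture of cosines -/

section GaussianKernel

variable {ι : Type*} [Fintype ι]

/-- The standard Gaussian density on `ι → ℝ`. -/
def gaussKernel (x : ι → ℝ) : ℝ := ∏ j, gaussianPDFReal 0 1 (x j)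

theorem measurable_gaussKernel : Measurable (gaussKernel : (ι → ℝ) → ℝ) :=
  Finset.measurable_fun_prod _ fun j _ => (measurable_gaussianPDFReal 0 1).comp (measurable_pi_apply j)

theorem integrable_gaussKernel : Integrable (gaussKernel : (ι → ℝ) → ℝ) :=
  Integrable.fintype_prod fun _ => integrable_gaussianPDFReal 0 1

theorem gaussKernel_nonneg (x : ι → ℝ) : 0 ≤ gaussKernel x :=
  Finset.prod_nonneg fun _ _ => gaussianPDFReal_nonneg _ _ _

theorem integral_gaussKernel : ∫ x : ι → ℝ, gaussKernel x = 1 := by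
  unfold gaussKernel
  rw [integral_fintype_prod_volume_eq_prod (fun _ : ι => gaussianPDFReal 0 1)]
  simp [integral_gaussianPDFReal_eq_one 0 one_ne_zero]

theorem charFun_gaussianReal_zero (v : ℝ≥0) (t : ℝ) :
    charFun (gaussianReal 0 v) t = ((Real.exp (-(v * t ^ 2) / 2) : ℝ) : ℂ) := by
  rw [charFun_gaussianReal]
  push_cast
  congr 1
  ring

/-- The standard Gaussian density is, up to a constant, its own characteristic function. -/
theorem gaussKernel_eq_integral_cos (x : ι → ℝ) :
    gaussKernel x = (√(2 * Real.pi))⁻¹ ^ Fintype.card ι *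
      ∫ ξ : ι → ℝ, Real.cos (∑ j, x j * ξ j) ∂(Measure.pi fun _ : ι => gaussianReal 0 1) := by
  rw [← prod_charFun_eq_integral_cos (gaussianReal 0 1) (charFun_gaussianReal_zero 1) x,
    ← Finset.card_univ, ← Finset.prod_const, ← Finset.prod_mul_distrib]
  refine Finset.prod_congr rfl fun j _ => ?_
  simp [gaussianPDFReal]

/-- The mixing measure in the representation of the Gaussian smoothing of `K` by cosines. -/
def smoothingMeasure (K : (ι → ℝ) → ℝ) : Measure ((ι → ℝ) × (ι → ℝ)) :=
  (volume.withDensity fun y => ‖K y‖ₑ).prod (Measure.pi fun _ : ι => gaussianReal 0 1)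

theorem isFiniteMeasure_smoothingMeasure {K : (ι → ℝ) → ℝ} (hK : Integrable K) :
    IsFiniteMeasure (smoothingMeasure K) := by
  have : IsFiniteMeasure ((volume : Measure (ι → ℝ)).withDensity fun y => ‖K y‖ₑ) :=
    isFiniteMeasure_withDensity hK.2.ne
  unfold smoothingMeasure
  infer_instance

/-- In the convolution of `K` with the Gaussian of width `σ`, write `K` as `|K|` times its sign, and
the Gaussian as an average of cosines. The measure `|K| dy` is finite, so any integrable `K`
becomes, after smoothing, a finite mixture of signed cosines. The quotient `K / |K|` is `0` where
`K` vanishes, a set without mass. -/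
theorem smoothing_gaussKernel_eq {K : (ι → ℝ) → ℝ} (hK : Measurable K) (hKi : Integrable K) {σ : ℝ}
    (hσ : 0 < σ) (u : ι → ℝ) :
    smoothing gaussKernel σ K u =
      (σ ^ Fintype.card ι)⁻¹ * (√(2 * Real.pi))⁻¹ ^ Fintype.card ι *
        ∫ θ, K θ.1 / |K θ.1| * Real.cos (∑ j, σ⁻¹ * (u j - θ.1 j) * θ.2 j) ∂(smoothingMeasure K) := by
  have hfin : IsFiniteMeasure ((volume : Measure (ι → ℝ)).withDensity fun y => ‖K y‖ₑ) :=
    isFiniteMeasure_withDensity hKi.2.ne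
  rw [← integral_scaled_kernel_eq_smoothing _ _ hσ, smoothingMeasure, integral_prod]
  · have hd : (fun y => ‖K y‖ₑ) = fun y => ((‖K y‖₊ : ℝ≥0) : ℝ≥0∞) := rfl
    rw [hd, integral_withDensity_eq_integral_smul hK.nnnorm, ← integral_const_mul]
    refine integral_congr_ae (.of_forall fun y => ?_)
    simp only [gaussKernel_eq_integral_cos, integral_const_mul, Pi.smul_apply, Pi.sub_apply,
      smul_eq_mul, NNReal.smul_def, coe_nnnorm, Real.norm_eq_abs]
    have : |K y| * (K y / |K y|) = K y := by
      by_cases h0 : K y = 0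
      · simp [h0]
      · rw [mul_div_cancel₀ _ (abs_ne_zero.2 h0)]
    rw [← mul_assoc |K y|, this]
    ring
  · refine integrable_of_abs_le (B := 1) (by fun_prop) fun θ => ?_
    rw [abs_mul]
    refine mul_le_one₀ ?_ (abs_nonneg _) (Real.abs_cos_le_one _)
    rw [abs_div, abs_abs]
    exact div_self_le_one _

end GaussianKernel

/-! ### Rescaled kernels evaluated at pairs -/

section KernelPairs

variable {Ω E ι : Type*} [MeasurableSpace Ω] [MeasurableSpace E] [Fintype ι]
variable {μ : Measure Ω} [IsProbabilityMeasure μ] {V : ℤ → Ω → E} {Q : Measure E} {a : ℕ → ℝ}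
  {π : E → ι → ℝ}

/-- The rescaled kernel `h^{-d} K((π x - π x') / h)`. -/
def scaledKernel (π : E → ι → ℝ) (K : (ι → ℝ) → ℝ) (h : ℝ) (x x' : E) : ℝ :=
  (h ^ Fintype.card ι)⁻¹ * K (h⁻¹ • (π x - π x'))

theorem measurable_scaledKernel (hπ : Measurable π) {K : (ι → ℝ) → ℝ} (hK : Measurable K) (h : ℝ) :
    Measurable (Function.uncurry (scaledKernel π K h)) := by
  unfold scaledKernel Function.uncurry
  fun_prop

theorem abs_scaledKernel_le {K : (ι → ℝ) → ℝ} {B : ℝ} (hB : ∀ u, |K u| ≤ B) {h : ℝ} (hh : 0 < h)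
    (x x' : E) : |scaledKernel π K h x x'| ≤ (h ^ Fintype.card ι)⁻¹ * B := by
  unfold scaledKernel
  rw [abs_mul, abs_of_pos (by positivity : (0 : ℝ) < (h ^ Fintype.card ι)⁻¹)]
  gcongr
  exact hB _

/-- For fixed `σ` the smoothed kernel has a mixing measure of fixed mass; the error is `n^{-1/2}`
times the factor `h^{-d}` of the rescaling. The phase at `(π x - π x') / h` splits into a part in
`x` and a part in `x'`, so the cosine bound applies. -/
theorem pairDev_smoothing_le (hV : MixingSequence μ V Q a) (hπ : Measurable π) {n : ℕ} (hn : 0 < n)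
    {K : (ι → ℝ) → ℝ} (hK : Measurable K) (hKi : Integrable K) {σ : ℝ} (hσ : 0 < σ) {h : ℝ}
    (hh : 0 < h) {f g : E → ℝ} (hf : Measurable f) (hg : Measurable g) (hf1 : ∀ x, |f x| ≤ 1)
    (hg1 : ∀ x, |g x| ≤ 1) :
    pairDev μ V Q n (fun x x' => scaledKernel π (smoothing gaussKernel σ K) h x x' * (f x * g x')) ≤
      ENNReal.ofReal (2 * ((σ ^ Fintype.card ι)⁻¹ * (√(2 * Real.pi))⁻¹ ^ Fintype.card ι) *
        (smoothingMeasure K).real Set.univ * devConst a * (√n * h ^ Fintype.card ι)⁻¹) := by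
  have := isFiniteMeasure_smoothingMeasure hKi
  set C := (σ ^ Fintype.card ι)⁻¹ * (√(2 * Real.pi))⁻¹ ^ Fintype.card ι with hC
  have hC0 : 0 ≤ C := by positivity
  have hs1 : ∀ θ : (ι → ℝ) × (ι → ℝ), |K θ.1 / (|K θ.1|)| ≤ 1 := fun θ => by
    rw [abs_div, abs_abs]; exact div_self_le_one _
  have key := pairDev_cos_le hV hn (smoothingMeasure K)
    (ℓ := fun θ x => ∑ j, σ⁻¹ * (h⁻¹ * π x j - θ.1 j) * θ.2 j)
    (ℓ' := fun θ x => ∑ j, σ⁻¹ * (h⁻¹ * π x j) * θ.2 j)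
    (s := fun θ => K θ.1 / |K θ.1|) (f := f) (g := g)
    (by unfold Function.uncurry; fun_prop) (by unfold Function.uncurry; fun_prop) (by fun_prop) hs1
    hf hg hf1 hg1
  have e : (fun x x' => scaledKernel π (smoothing gaussKernel σ K) h x x' * (f x * g x')) =
      fun x x' => ((h ^ Fintype.card ι)⁻¹ * C) * (f x * g x' * ∫ θ, K θ.1 / |K θ.1| *
        Real.cos (∑ j, σ⁻¹ * (h⁻¹ * π x j - θ.1 j) * θ.2 j - ∑ j, σ⁻¹ * (h⁻¹ * π x' j) * θ.2 j)
          ∂(smoothingMeasure K)) := by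
    ext x x'
    rw [scaledKernel, smoothing_gaussKernel_eq hK hKi hσ, ← hC]
    have : ∀ θ : (ι → ℝ) × (ι → ℝ), ∑ j, σ⁻¹ * ((h⁻¹ • (π x - π x')) j - θ.1 j) * θ.2 j =
        ∑ j, σ⁻¹ * (h⁻¹ * π x j - θ.1 j) * θ.2 j - ∑ j, σ⁻¹ * (h⁻¹ * π x' j) * θ.2 j := by
      intro θ
      rw [← Finset.sum_sub_distrib]
      refine Finset.sum_congr rfl fun j _ => ?_
      simp only [Pi.smul_apply, Pi.sub_apply, smul_eq_mul]
      ring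
    simp_rw [this]
    ring
  rw [e, pairDev_const_mul]
  refine (mul_le_mul_right key _).trans (le_of_eq ?_)
  rw [Real.enorm_of_nonneg (by positivity), ← ofReal_measureReal (by simp),
    ← ENNReal.ofReal_mul (by positivity),
    show (2 : ℝ≥0∞) = ENNReal.ofReal 2 by simp, ← ENNReal.ofReal_mul (by positivity),
    ← ENNReal.ofReal_mul (by positivity)]
  congr 1
  rw [mul_inv]
  ring

theorem card_near_le (n : ℕ) (t : ℤ) (p : ℕ) :
    ((Finset.Icc (1 : ℤ) n).filter fun s => |t - s| < p).card ≤ 2 * p := by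
  have hsub : ((Finset.Icc (1 : ℤ) n).filter fun s => |t - s| < p) ⊆ Finset.Ioo (t - p) (t + p) := by
    intro s hs
    rw [Finset.mem_filter, abs_lt] at hs
    rw [Finset.mem_Ioo]
    omega
  refine (Finset.card_le_card hsub).trans ?_
  rw [Int.card_Ioo]
  omega

/-- Each `t` has at most `2p` partners `s` with `|t - s| < p`, for which no joint density is at
hand; they are estimated by the supremum `b`, which after division by `n²` leaves `2pb/n`. All
others are estimated in mean by `c`. -/
theorem pairMean_le_near_far {n : ℕ} (hn : 0 < n) (p : ℕ) {H : E → E → ℝ} {b c : ℝ≥0∞}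
    (hb : ∀ x x', ‖H x x'‖ₑ ≤ b)
    (hc : ∀ t s : ℤ, 1 ≤ t → 1 ≤ s → t ≠ s → (p : ℤ) ≤ |t - s| →
      ∫⁻ ω, ‖H (V t ω) (V s ω)‖ₑ ∂μ ≤ c) :
    pairMean μ V n H ≤ c + (n : ℝ≥0∞)⁻¹ * (2 * p * b) := by
  have hn0 : (n : ℝ≥0∞) ≠ 0 := by exact_mod_cast hn.ne'
  have hnt : (n : ℝ≥0∞) ≠ ∞ := ENNReal.natCast_ne_top n
  have h1 : ∀ t ∈ Finset.Icc (1 : ℤ) n, ∑ s ∈ (Finset.Icc (1 : ℤ) n).erase t,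
      ∫⁻ ω, ‖H (V t ω) (V s ω)‖ₑ ∂μ ≤ n * c + 2 * p * b := by
    intro t ht
    calc _ ≤ ∑ s ∈ (Finset.Icc (1 : ℤ) n).erase t, (c + if |t - s| < p then b else 0) := by
          refine Finset.sum_le_sum fun s hs => ?_
          rw [Finset.mem_erase, Finset.mem_Icc] at hs
          split_ifs with h
          · refine le_add_left ?_
            calc _ ≤ ∫⁻ _, b ∂μ := lintegral_mono fun ω => hb _ _
              _ = b := by simp
          · rw [add_zero]
            exact hc t s (Finset.mem_Icc.1 ht).1 hs.2.1 hs.1.symm (not_lt.1 h)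
      _ ≤ ∑ s ∈ Finset.Icc (1 : ℤ) n, (c + if |t - s| < p then b else 0) :=
          Finset.sum_le_sum_of_subset (Finset.erase_subset _ _)
      _ ≤ n * c + 2 * p * b := by
          rw [Finset.sum_add_distrib, ← Finset.sum_filter, Finset.sum_const, Finset.sum_const]
          simp only [nsmul_eq_mul, Int.card_Icc, add_sub_cancel_right, Int.toNat_natCast]
          gcongr
          exact_mod_cast card_near_le n t p
  unfold pairMean
  calc _ ≤ ((n : ℝ≥0∞) ^ 2)⁻¹ * (n * (n * c + 2 * p * b)) := by
        gcongr
        refine (Finset.sum_le_card_nsmul _ _ _ h1).trans (le_of_eq ?_)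
        simp [mul_add]
    _ = _ := by
        rw [sq, ENNReal.mul_inv (Or.inl hn0) (Or.inl hnt), mul_assoc, ← mul_assoc _ (n : ℝ≥0∞),
          ENNReal.inv_mul_cancel hn0 hnt, one_mul, mul_add, ← mul_assoc,
          ENNReal.inv_mul_cancel hn0 hnt, one_mul]

theorem lintegral_scaledKernel_le (hπ : Measurable π) {M : ℝ≥0}
    (hM : Q.map π ≤ (M : ℝ≥0∞) • volume) {K : (ι → ℝ) → ℝ} (hK : Measurable K) {h : ℝ} (hh : 0 < h)
    (x : E) : ∫⁻ x', ‖scaledKernel π K h x x'‖ₑ ∂Q ≤ M * ∫⁻ u, ‖K u‖ₑ := by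
  have e : ∫⁻ x', ‖scaledKernel π K h x x'‖ₑ ∂Q =
      ∫⁻ y, ‖(h ^ Fintype.card ι)⁻¹ * K (h⁻¹ • (π x - y))‖ₑ ∂(Q.map π) := by
    rw [lintegral_map (by fun_prop) hπ]
    rfl
  rw [e]
  refine (lintegral_mono' hM le_rfl).trans (le_of_eq ?_)
  rw [lintegral_smul_measure, lintegral_scaled_kernel hK hh, smul_eq_mul]

/-- The joint density is compared with Lebesgue measure on the product, which is infinite. The first
point is therefore confined to `S`: integrating over the second point gives the `L¹` norm of `K`,
and over the first the volume of `S`. -/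
theorem lintegral_pair_scaledKernel_le (hVm : ∀ t, Measurable (V t)) (hπ : Measurable π) {M : ℝ≥0}
    {t s : ℤ}
    (hM : μ.map (fun ω => (π (V t ω), π (V s ω))) ≤ (M : ℝ≥0∞) • volume) {K : (ι → ℝ) → ℝ}
    (hK : Measurable K) {h : ℝ} (hh : 0 < h) (S : Set (ι → ℝ)) (hS : MeasurableSet S) :
    ∫⁻ ω, ‖scaledKernel π K h (V t ω) (V s ω) * (π ⁻¹' S).indicator (fun _ => 1) (V t ω)‖ₑ ∂μ ≤
      M * (volume S * ∫⁻ u, ‖K u‖ₑ) := by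
  have hm : Measurable fun q : (ι → ℝ) × (ι → ℝ) =>
      ‖(h ^ Fintype.card ι)⁻¹ * K (h⁻¹ • (q.1 - q.2)) * S.indicator (fun _ => (1 : ℝ)) q.1‖ₑ := by
    have : Measurable (S.indicator fun _ => (1 : ℝ)) := measurable_const.indicator hS
    fun_prop
  have e : ∫⁻ ω, ‖scaledKernel π K h (V t ω) (V s ω) * (π ⁻¹' S).indicator (fun _ => 1) (V t ω)‖ₑ ∂μ =
      ∫⁻ q, ‖(h ^ Fintype.card ι)⁻¹ * K (h⁻¹ • (q.1 - q.2)) * S.indicator (fun _ => (1 : ℝ)) q.1‖ₑ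
        ∂(μ.map (fun ω => (π (V t ω), π (V s ω)))) := by
    have hp : Measurable fun ω => (π (V t ω), π (V s ω)) :=
      (hπ.comp (hVm t)).prodMk (hπ.comp (hVm s))
    rw [lintegral_map hm hp]
    rfl
  rw [e]
  refine (lintegral_mono' hM le_rfl).trans ?_
  rw [lintegral_smul_measure, smul_eq_mul]
  gcongr
  rw [Measure.volume_eq_prod, lintegral_prod _ hm.aemeasurable]
  simp_rw [enorm_mul _ (S.indicator _ _)]
  have e2 : ∀ x : ι → ℝ, ∫⁻ y, ‖(h ^ Fintype.card ι)⁻¹ * K (h⁻¹ • (x - y))‖ₑ *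
      ‖S.indicator (fun _ => (1 : ℝ)) x‖ₑ = (∫⁻ u, ‖K u‖ₑ) * S.indicator (fun _ => 1) x := by
    intro x
    rw [lintegral_mul_const _ (by fun_prop), lintegral_scaled_kernel hK hh]
    congr 1
    by_cases hx : x ∈ S <;> simp [hx]
  simp_rw [e2]
  rw [lintegral_const_mul _ (measurable_const.indicator hS), lintegral_indicator hS]
  simp [mul_comm]

end KernelPairs

/-! ### Decoupling for general kernels -/

section KernelAverages

variable {Ω E ι : Type*} [MeasurableSpace Ω] [MeasurableSpace E] [Fintype ι]

/-- A mixing sequence `V`, a vector `π V_t` of covariates with bounded marginal and pairwise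
densities, and bandwidths `h` with `n h^{2d} → ∞`. -/
structure KernelDesign (μ : Measure Ω) (V : ℤ → Ω → E) (Q : Measure E) (a : ℕ → ℝ) (π : E → ι → ℝ)
    (h : ℕ → ℝ) : Prop where
  mixing : MixingSequence μ V Q a
  measurable_proj : Measurable π
  density : ∃ M : ℝ≥0, Q.map π ≤ (M : ℝ≥0∞) • volume
  joint_density : ∃ (p : ℕ) (M : ℝ≥0), ∀ t s : ℤ, 1 ≤ t → 1 ≤ s → t ≠ s → (p : ℤ) ≤ |t - s| →
    μ.map (fun ω => (π (V t ω), π (V s ω))) ≤ (M : ℝ≥0∞) • volume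
  bandwidth_pos : ∀ n, 0 < h n
  bandwidth_tendsto : Tendsto h atTop (𝓝 0)
  rate : Tendsto (fun n : ℕ => √n * h n ^ Fintype.card ι) atTop atTop

/-- Pairs with a remote first member contribute little to kernel averages. -/
def TailCondition (μ : Measure Ω) (V : ℤ → Ω → E) (π : E → ι → ℝ) (K : (ι → ℝ) → ℝ)
    (h : ℕ → ℝ) : Prop :=
  ∀ ε : ℝ≥0∞, 0 < ε → ∃ A₀ : ℝ, ∀ A ≥ A₀, ∀ᶠ n in atTop, pairMean μ V n (fun x x' =>
    scaledKernel π K (h n) x x' * (π ⁻¹' (Metric.closedBall 0 A)ᶜ).indicator (fun _ => 1) x) ≤ ε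

variable {μ : Measure Ω} [IsProbabilityMeasure μ] {V : ℤ → Ω → E} {Q : Measure E} {a : ℕ → ℝ}
  {π : E → ι → ℝ} {h : ℕ → ℝ}

theorem tendsto_measure_compl_closedBall [IsFiniteMeasure Q] (hπ : Measurable π) :
    Tendsto (fun A : ℝ => Q (π ⁻¹' (Metric.closedBall 0 A)ᶜ)) atTop (𝓝 0) := by
  have hanti : Antitone fun A : ℝ => π ⁻¹' (Metric.closedBall 0 A)ᶜ := fun A A' hA =>
    Set.preimage_mono (Set.compl_subset_compl.2 (Metric.closedBall_subset_closedBall hA))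
  have hemp : ⋂ A : ℝ, π ⁻¹' (Metric.closedBall 0 A)ᶜ = ∅ := by
    refine Set.eq_empty_of_forall_notMem fun x hx => ?_
    have := Set.mem_iInter.1 hx ‖π x‖
    simp at this
  have ht := tendsto_measure_iInter_atTop (μ := Q)
    (s := fun A : ℝ => π ⁻¹' (Metric.closedBall 0 A)ᶜ)
    (fun A => (hπ Metric.isClosed_closedBall.measurableSet.compl).nullMeasurableSet) hanti
    ⟨0, measure_ne_top _ _⟩
  rwa [hemp, measure_empty] at ht

theorem KernelDesign.rate_inv (hD : KernelDesign μ V Q a π h) (C : ℝ) :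
    Tendsto (fun n : ℕ => ENNReal.ofReal (C * (√n * h n ^ Fintype.card ι)⁻¹)) atTop (𝓝 0) := by
  have := (hD.rate.inv_tendsto_atTop).const_mul C
  rw [mul_zero] at this
  simpa using ENNReal.tendsto_ofReal this

/-- Kernel pair averages are asymptotically equal to their value under independence. -/
theorem KernelDesign.tendsto_pairDev (hD : KernelDesign μ V Q a π h) {K : (ι → ℝ) → ℝ}
    (hK : Measurable K) (hKi : Integrable K) {B : ℝ} (hB : ∀ u, |K u| ≤ B)
    (htail : TailCondition μ V π K h) {f g : E → ℝ} (hf : Measurable f) (hg : Measurable g)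
    (hf1 : ∀ x, |f x| ≤ 1) (hg1 : ∀ x, |g x| ≤ 1) :
    Tendsto (fun n => pairDev μ V Q n (fun x x' => scaledKernel π K (h n) x x' * (f x * g x')))
      atTop (𝓝 0) := by
  have hQ := hD.mixing.isProbabilityMeasure
  have hπ := hD.measurable_proj
  have hVm := hD.mixing.measurable
  obtain ⟨M, hM⟩ := hD.density
  obtain ⟨p, M₂, hM₂⟩ := hD.joint_density
  have hB0 : 0 ≤ B := (abs_nonneg _).trans (hB 0)
  rw [ENNReal.tendsto_nhds_zero]
  intro ε hε
  -- Four contributions: the far part of the smoothing error, the remote pairs, the remote part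
  -- under independence, and the terms of order `(√n h^d)⁻¹` together.
  set δ := ε / 4 with hδ
  have hδ0 : 0 < δ := ENNReal.div_pos hε.ne' (by simp)
  have hIK : (∫⁻ u, ‖K u‖ₑ) ≠ ∞ := hKi.2.ne
  obtain ⟨A₀, hA₀⟩ := htail δ hδ0
  have hmeas : Tendsto (fun A : ℝ => Q (π ⁻¹' (Metric.closedBall 0 A)ᶜ) * (M * ∫⁻ u, ‖K u‖ₑ))
      atTop (𝓝 0) := by
    have := ENNReal.Tendsto.mul_const (b := M * ∫⁻ u, ‖K u‖ₑ)
      (tendsto_measure_compl_closedBall (Q := Q) hπ) (Or.inr (ENNReal.mul_ne_top (by simp) hIK))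
    simpa using this
  obtain ⟨A, hAδ, hA⟩ := ((ENNReal.tendsto_nhds_zero.1 hmeas δ hδ0).and (eventually_ge_atTop A₀)).exists
  set S : Set (ι → ℝ) := Metric.closedBall 0 A with hS
  have hSm : MeasurableSet S := Metric.isClosed_closedBall.measurableSet
  have hSfin : volume S ≠ ∞ := (isCompact_closedBall (0 : ι → ℝ) A).measure_lt_top.ne
  -- The smoothing error enters twice: through far pairs, with factor `M₂ * volume S`, and through
  -- the value under independence, with factor `M`.
  set c₀ : ℝ≥0∞ := M₂ * volume S + M with hc₀
  have hc₀t : c₀ ≠ ∞ := ENNReal.add_ne_top.2 ⟨ENNReal.mul_ne_top (by simp) hSfin, by simp⟩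
  have hsm : Tendsto (fun σ : ℝ => c₀ * ∫⁻ x, ‖smoothing gaussKernel σ K x - K x‖ₑ) (𝓝[>] 0) (𝓝 0) := by
    have h1 := tendsto_lintegral_smoothing (ι := ι) integrable_gaussKernel measurable_gaussKernel hK hKi hB
    simp_rw [integral_gaussKernel, one_mul] at h1
    have h2 := ENNReal.Tendsto.const_mul (a := c₀) h1 (Or.inr hc₀t)
    rw [mul_zero] at h2
    exact h2.mono_left nhdsWithin_le_nhds
  -- The order of choices matters: first the ball `S`, then `σ` depending on `S`, and only then `n`,
  -- so that the constant `Cσ` is fixed while `√n h^d → ∞`.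
  obtain ⟨σ, hσδ, hσ⟩ := ((ENNReal.tendsto_nhds_zero.1 hsm δ hδ0).and self_mem_nhdsWithin).exists
  have hσ0 : 0 < σ := hσ
  set Kσ := smoothing gaussKernel σ K with hKσ
  have hKσm : Measurable Kσ := measurable_smoothing measurable_gaussKernel hK σ
  have hKσB : ∀ u, |Kσ u| ≤ B := fun u => by
    refine (abs_smoothing_le integrable_gaussKernel hB σ u).trans (le_of_eq ?_)
    simp_rw [abs_of_nonneg (gaussKernel_nonneg _), integral_gaussKernel, one_mul]
  set D : (ι → ℝ) → ℝ := fun u => K u - Kσ u with hDdef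
  have hDm : Measurable D := hK.sub hKσm
  have hDB : ∀ u, |D u| ≤ 2 * B := fun u =>
    (abs_sub _ _).trans (by linarith [hB u, hKσB u])
  have hDint : c₀ * ∫⁻ u, ‖D u‖ₑ ≤ δ := by
    refine le_trans (le_of_eq ?_) hσδ
    congr 1
    exact lintegral_congr fun u => by rw [hDdef, enorm_sub_rev]
  have hin : Measurable ((π ⁻¹' S).indicator fun _ => (1 : ℝ)) := measurable_const.indicator (hπ hSm)
  have hout : Measurable ((π ⁻¹' Sᶜ).indicator fun _ => (1 : ℝ)) :=
    measurable_const.indicator (hπ hSm.compl)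
  have hind1 : ∀ (T : Set E) x, |T.indicator (fun _ => (1 : ℝ)) x| ≤ 1 := fun T x => by
    by_cases hx : x ∈ T <;> simp [hx]
  set fA : E → ℝ := fun x => f x * (π ⁻¹' S).indicator (fun _ => 1) x with hfA
  set fO : E → ℝ := fun x => f x * (π ⁻¹' Sᶜ).indicator (fun _ => 1) x with hfO
  have hfAm : Measurable fA := hf.mul hin
  have hfOm : Measurable fO := hf.mul hout
  have hfA1 : ∀ x, |fA x| ≤ 1 := fun x => by
    rw [hfA, abs_mul]; exact mul_le_one₀ (hf1 x) (abs_nonneg _) (hind1 _ x)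
  have hfO1 : ∀ x, |fO x| ≤ 1 := fun x => by
    rw [hfO, abs_mul]; exact mul_le_one₀ (hf1 x) (abs_nonneg _) (hind1 _ x)
  have hcut : ∀ (T : Set E) x x', ‖f x * T.indicator (fun _ => (1 : ℝ)) x * g x'‖ ≤
      ‖T.indicator (fun _ => (1 : ℝ)) x‖ := fun T x x' => by
    rw [norm_mul, norm_mul, mul_right_comm]
    exact mul_le_of_le_one_left (norm_nonneg _) (mul_le_one₀ (hf1 _) (norm_nonneg _) (hg1 _))
  have hsplit : ∀ x, f x = fA x + fO x := fun x => by
    by_cases hx : x ∈ π ⁻¹' S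
    · simp [hfA, hfO, hx]
    · simp [hfA, hfO, hx]
  set Cσ := 2 * ((σ ^ Fintype.card ι)⁻¹ * (√(2 * Real.pi))⁻¹ ^ Fintype.card ι) *
    (smoothingMeasure K).real Set.univ * devConst a with hCσ
  have hr := ENNReal.tendsto_nhds_zero.1 (hD.rate_inv (Cσ + 2 * p * (2 * B))) δ hδ0
  filter_upwards [hA₀ A hA, hr, eventually_gt_atTop 0] with n hn1 hn2 hn
  have hh := hD.bandwidth_pos n
  have hn' : (1 : ℝ) ≤ n := by exact_mod_cast hn
  have hCσ0 : 0 ≤ Cσ := by have := devConst_nonneg a; positivity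
  set ρ := (√n * h n ^ Fintype.card ι)⁻¹ with hρ
  have hρ0 : 0 ≤ ρ := by positivity
  have meas : ∀ {L : (ι → ℝ) → ℝ} {u : E → ℝ}, Measurable L → Measurable u →
      Measurable (Function.uncurry fun x x' => scaledKernel π L (h n) x x' * (u x * g x')) := by
    intro L u hL hu
    exact (measurable_scaledKernel hπ hL (h n)).mul
      ((hu.comp measurable_fst).mul (hg.comp measurable_snd))
  have bd : ∀ {L : (ι → ℝ) → ℝ} {u : E → ℝ} {b : ℝ}, (∀ v, |L v| ≤ b) → (∀ x, |u x| ≤ 1) →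
      ∀ x x', |scaledKernel π L (h n) x x' * (u x * g x')| ≤ (h n ^ Fintype.card ι)⁻¹ * b := by
    intro L u b hL hu x x'
    rw [abs_mul, abs_mul]
    exact (mul_le_of_le_one_right (abs_nonneg _) (mul_le_one₀ (hu x) (abs_nonneg _) (hg1 x'))).trans
      (abs_scaledKernel_le hL hh x x')
  have T3 : pairDev μ V Q n (fun x x' => scaledKernel π Kσ (h n) x x' * (fA x * g x')) ≤
      ENNReal.ofReal (Cσ * ρ) :=
    pairDev_smoothing_le hD.mixing hπ hn hK hKi hσ0 hh hfAm hg hfA1 hg1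
  have T2 : pairDev μ V Q n (fun x x' => scaledKernel π D (h n) x x' * (fA x * g x')) ≤
      δ + ENNReal.ofReal (2 * p * (2 * B) * ρ) := by
    refine (pairDev_le_add hVm n (meas hDm hfAm)).trans ?_
    have hfar := pairMean_le_near_far (μ := μ) (V := V) hn p
      (H := fun x x' => scaledKernel π D (h n) x x' * (fA x * g x'))
      (b := ENNReal.ofReal ((h n ^ Fintype.card ι)⁻¹ * (2 * B)))
      (c := M₂ * (volume S * ∫⁻ u, ‖D u‖ₑ)) (fun x x' => ?_) (fun t s ht hs hts hp => ?_)
    · have hQQ : ∫⁻ x, ∫⁻ x', ‖scaledKernel π D (h n) x x' * (fA x * g x')‖ₑ ∂Q ∂Q ≤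
          M * ∫⁻ u, ‖D u‖ₑ := by
        calc _ ≤ ∫⁻ x, (M * ∫⁻ u, ‖D u‖ₑ) ∂Q := by
              refine lintegral_mono fun x => le_trans (lintegral_mono fun x' => ?_)
                (lintegral_scaledKernel_le hπ hM hDm hh x)
              rw [enorm_le_iff_norm_le, norm_mul, norm_mul]
              exact mul_le_of_le_one_right (norm_nonneg _)
                (mul_le_one₀ (hfA1 x) (norm_nonneg _) (hg1 x'))
          _ = _ := by simp
      have hnear : (n : ℝ≥0∞)⁻¹ * (2 * p * ENNReal.ofReal ((h n ^ Fintype.card ι)⁻¹ * (2 * B))) ≤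
          ENNReal.ofReal (2 * p * (2 * B) * ρ) := by
        have e1 : (n : ℝ≥0∞)⁻¹ = ENNReal.ofReal ((n : ℝ)⁻¹) := by
          rw [ENNReal.ofReal_inv_of_pos (by linarith), ENNReal.ofReal_natCast]
        have e2 : (2 * p : ℝ≥0∞) = ENNReal.ofReal (2 * p) := by
          rw [ENNReal.ofReal_mul (by norm_num)]; simp
        rw [e1, e2, ← ENNReal.ofReal_mul (by positivity), ← ENNReal.ofReal_mul (by positivity)]
        refine ENNReal.ofReal_le_ofReal ?_
        -- Near pairs contribute order `1 / (n h^d)`, which is weakened to the rate `1 / (√n h^d)`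
        -- of the main term.
        have hsq : (n : ℝ)⁻¹ ≤ (√n)⁻¹ := by
          refine inv_anti₀ (by positivity) ?_
          rw [Real.sqrt_le_left (by positivity)]
          nlinarith
        calc (n : ℝ)⁻¹ * (2 * p * ((h n ^ Fintype.card ι)⁻¹ * (2 * B))) ≤
            (√n)⁻¹ * (2 * p * ((h n ^ Fintype.card ι)⁻¹ * (2 * B))) := by gcongr
          _ = _ := by rw [hρ, mul_inv]; ring
      calc _ ≤ (M₂ * (volume S * ∫⁻ u, ‖D u‖ₑ) + ENNReal.ofReal (2 * p * (2 * B) * ρ)) +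
            M * ∫⁻ u, ‖D u‖ₑ := add_le_add (hfar.trans (by gcongr)) hQQ
        _ = c₀ * (∫⁻ u, ‖D u‖ₑ) + ENNReal.ofReal (2 * p * (2 * B) * ρ) := by
            rw [hc₀]; ring
        _ ≤ _ := by gcongr
    · rw [Real.enorm_eq_ofReal_abs]
      exact ENNReal.ofReal_le_ofReal (bd hDB hfA1 x x')
    · refine le_trans (lintegral_mono fun ω => ?_)
        (lintegral_pair_scaledKernel_le hVm hπ (hM₂ t s ht hs hts hp) hDm hh S hSm)
      rw [enorm_le_iff_norm_le, norm_mul, norm_mul (scaledKernel π D (h n) (V t ω) (V s ω))]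
      exact mul_le_mul_of_nonneg_left (hcut _ _ _) (norm_nonneg _)
  have T1 : pairDev μ V Q n (fun x x' => scaledKernel π K (h n) x x' * (fO x * g x')) ≤ δ + δ := by
    refine (pairDev_le_add hVm n (meas hK hfOm)).trans (add_le_add ?_ ?_)
    · refine (pairMean_mono n fun x x' => ?_).trans hn1
      rw [norm_mul, norm_mul (scaledKernel π K (h n) x x')]
      exact mul_le_mul_of_nonneg_left (hcut _ _ _) (norm_nonneg _)
    · refine le_trans ?_ hAδ
      calc _ ≤ ∫⁻ x, (π ⁻¹' Sᶜ).indicator (fun _ => 1) x * (M * ∫⁻ u, ‖K u‖ₑ) ∂Q := by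
            refine lintegral_mono fun x => ?_
            by_cases hx : x ∈ π ⁻¹' Sᶜ
            · rw [Set.indicator_of_mem hx, one_mul]
              refine le_trans (lintegral_mono fun x' => ?_) (lintegral_scaledKernel_le hπ hM hK hh x)
              rw [enorm_le_iff_norm_le, norm_mul, norm_mul]
              exact mul_le_of_le_one_right (norm_nonneg _)
                (mul_le_one₀ (hfO1 x) (norm_nonneg _) (hg1 x'))
            · have : fO x = 0 := by simp only [hfO, Set.indicator_of_notMem hx, mul_zero]
              simp [this]
        _ = _ := by
            rw [lintegral_mul_const _ (measurable_const.indicator (hπ hSm.compl)),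
              lintegral_indicator (hπ hSm.compl)]
            simp
  -- Inside the ball the kernel is split into its smoothing `Kσ` and the remainder `D`; outside it
  -- is left as it is.
  have e : (fun x x' => scaledKernel π K (h n) x x' * (f x * g x')) = fun x x' =>
      scaledKernel π Kσ (h n) x x' * (fA x * g x') +
        (scaledKernel π D (h n) x x' * (fA x * g x') + scaledKernel π K (h n) x x' * (fO x * g x')) := by
    ext x x'
    rw [hsplit x]
    simp only [scaledKernel, hDdef]
    ring
  rw [e]
  have hsum : Measurable (Function.uncurry fun x x' => scaledKernel π D (h n) x x' * (fA x * g x') +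
      scaledKernel π K (h n) x x' * (fO x * g x')) := (meas hDm hfAm).add (meas hK hfOm)
  refine (pairDev_add_le hVm n (meas hKσm hfAm) hsum (bd hKσB hfA1)
    (fun x x' => (abs_add_le _ _).trans (add_le_add (bd hDB hfA1 x x') (bd hB hfO1 x x')))).trans ?_
  refine (add_le_add T3 ((pairDev_add_le hVm n (meas hDm hfAm) (meas hK hfOm) (bd hDB hfA1)
    (bd hB hfO1)).trans (add_le_add T2 T1))).trans ?_
  calc _ = (ENNReal.ofReal (Cσ * ρ) + ENNReal.ofReal (2 * p * (2 * B) * ρ)) + (δ + (δ + δ)) := by ring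
    _ = ENNReal.ofReal ((Cσ + 2 * p * (2 * B)) * ρ) + (δ + (δ + δ)) := by
        rw [← ENNReal.ofReal_add (by positivity) (by positivity), add_mul]
    _ ≤ δ + (δ + (δ + δ)) := by gcongr
    _ = 4 * δ := by ring
    _ = ε := by rw [hδ]; exact ENNReal.mul_div_cancel (by simp) (by simp)

end KernelAverages

/-! ### Integrable majorants that are characteristic functions -/

section GaussianMajorant

/-- A function with an integrable nonincreasing majorant is dominated by an integrable
characteristic function of a finite measure, a mixture of centred Gaussian laws. -/
theorem HasMonotoneMajorant.exists_charFun {k : ℝ → ℝ} (hk : HasMonotoneMajorant k) :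
    ∃ (ν : Measure ℝ) (ψ : ℝ → ℝ), IsFiniteMeasure ν ∧ (∀ t, charFun ν t = (ψ t : ℂ)) ∧
      Measurable ψ ∧ Integrable ψ ∧ ∀ x, |k x| ≤ ψ x := by
  obtain ⟨g, hg, hgi, hkg⟩ := hk
  have hg0 : ∀ t, 0 ≤ t → 0 ≤ g t := fun t ht => by
    have := hkg t
    rw [abs_of_nonneg ht] at this
    exact (abs_nonneg _).trans this
  have hgI : IntegrableOn g (Set.Ioi 0) := by
    refine (hgi.integrableOn (s := Set.Ioi 0)).congr_fun (fun x hx => ?_) measurableSet_Ioi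
    simp only [abs_of_pos (Set.mem_Ioi.1 hx)]
  have hsumg : Summable fun n : ℕ => g n :=
    hg.summable_of_integrableOn_Ioi_zero hgI fun t ht => hg0 t (le_of_lt ht)
  -- Cauchy condensation turns integrability of the nonincreasing `g` into summability over dyadic
  -- shells.
  have hcond : Summable fun m : ℕ => (2 : ℝ) ^ m * g ((2 : ℝ) ^ m) := by
    have := (summable_condensed_iff_of_nonneg (f := fun n : ℕ => g n) (fun n => hg0 _ (by positivity))
      (fun m n _ hmn => hg (Set.mem_Ici.2 (by positivity)) (Set.mem_Ici.2 (by positivity))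
        (by exact_mod_cast hmn))).2 hsumg
    simpa using this
  -- The term of index `m + 1` serves the shell `2^m ≤ |x| < 2^(m+1)`, on which `g |x| ≤ g (2^m)`;
  -- the term of index `0` serves `|x| < 1`. The factor `e` outweighs the loss in the Gaussian,
  -- whose exponent on its shell is at least `-1/2`.
  set c : ℕ → ℝ := fun m => Real.exp 1 * (if m = 0 then g 0 else g ((2 : ℝ) ^ (m - 1))) with hc
  have hc0 : ∀ m, 0 ≤ c m := fun m => by
    refine mul_nonneg (by positivity) ?_
    split_ifs
    · exact hg0 0 le_rfl
    · exact hg0 _ (by positivity)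
  have hcs : Summable fun m => c m * 2 ^ m := by
    rw [← summable_nat_add_iff 1]
    refine (hcond.mul_left (2 * Real.exp 1)).congr fun m => ?_
    simp only [hc, Nat.add_eq_zero_iff, one_ne_zero, and_false, if_false, Nat.add_sub_cancel, pow_succ]
    ring
  have hcs' : Summable c := by
    refine Summable.of_nonneg_of_le hc0 (fun m => ?_) hcs
    exact le_mul_of_one_le_right (hc0 m) (one_le_pow₀ (by norm_num))
  -- Variance `4^{-m}`, so that the characteristic function is a bump of width of order `2^m` with
  -- integral `√(2π) 2^m`.
  set v : ℕ → ℝ≥0 := fun m => ((4 : ℝ≥0) ^ m)⁻¹ with hv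
  set e : ℕ → ℝ → ℝ := fun m x => Real.exp (-(v m * x ^ 2) / 2) with he
  have he0 : ∀ m x, 0 ≤ e m x := fun m x => (Real.exp_pos _).le
  have he1 : ∀ m x, e m x ≤ 1 := fun m x => by
    rw [he, Real.exp_le_one_iff]
    have : 0 ≤ (v m : ℝ) * x ^ 2 := by positivity
    linarith
  have hpt : ∀ x, Summable fun m => c m * e m x := fun x =>
    Summable.of_nonneg_of_le (fun m => mul_nonneg (hc0 m) (he0 m x))
      (fun m => mul_le_of_le_one_right (hc0 m) (he1 m x)) hcs'
  set ψ : ℝ → ℝ := fun x => ∑' m, c m * e m x with hψ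
  set ν : Measure ℝ := Measure.sum fun m => ENNReal.ofReal (c m) • gaussianReal 0 (v m) with hν
  have hνfin : IsFiniteMeasure ν := by
    refine ⟨?_⟩
    rw [hν, Measure.sum_apply _ MeasurableSet.univ]
    simp only [Measure.smul_apply, measure_univ, smul_eq_mul, mul_one]
    rw [← ENNReal.ofReal_tsum_of_nonneg hc0 hcs']
    exact ENNReal.ofReal_lt_top
  have hem : ∀ m, Measurable (e m) := fun m => by fun_prop
  have hψm : Measurable ψ := by
    have h1 : ψ = fun x => (∑' m, ENNReal.ofReal (c m * e m x)).toReal := by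
      ext x
      rw [← ENNReal.ofReal_tsum_of_nonneg (fun m => mul_nonneg (hc0 m) (he0 m x)) (hpt x),
        ENNReal.toReal_ofReal (tsum_nonneg fun m => mul_nonneg (hc0 m) (he0 m x))]
    rw [h1]
    exact (Measurable.tsum fun m => ((hem m).const_mul _).ennreal_ofReal).ennreal_toReal
  refine ⟨ν, ψ, hνfin, fun t => ?_, hψm, ?_, fun x => ?_⟩
  · rw [charFun_apply_real]
    have hi : Integrable (fun x : ℝ => Complex.exp (t * x * Complex.I)) ν := by
      refine Integrable.of_bound (Continuous.aestronglyMeasurable (by fun_prop)) 1 (.of_forall fun x => ?_)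
      rw [← Complex.ofReal_mul, Complex.norm_exp_ofReal_mul_I]
    have h1 := hasSum_integral_measure hi
    have h2 : ∀ m, ∫ x : ℝ, Complex.exp (t * x * Complex.I) ∂(ENNReal.ofReal (c m) • gaussianReal 0 (v m)) =
        ((c m * e m t : ℝ) : ℂ) := by
      intro m
      rw [integral_smul_measure, ← charFun_apply_real, charFun_gaussianReal_zero,
        ENNReal.toReal_ofReal (hc0 m)]
      simp [he]
    simp_rw [h2] at h1
    exact h1.unique (Complex.hasSum_ofReal.2 (hpt t).hasSum)
  · refine ⟨hψm.aestronglyMeasurable, ?_⟩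
    have h1 : ∀ x, ‖ψ x‖ₑ = ∑' m, ENNReal.ofReal (c m * e m x) := fun x => by
      rw [Real.enorm_of_nonneg (tsum_nonneg fun m => mul_nonneg (hc0 m) (he0 m x)),
        ENNReal.ofReal_tsum_of_nonneg (fun m => mul_nonneg (hc0 m) (he0 m x)) (hpt x)]
    rw [HasFiniteIntegral]
    simp_rw [h1]
    rw [lintegral_tsum fun m => ((hem m).const_mul _).ennreal_ofReal.aemeasurable]
    have h2 : ∀ m, ∫⁻ x, ENNReal.ofReal (c m * e m x) = ENNReal.ofReal (√(2 * Real.pi) * (c m * 2 ^ m)) := by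
      intro m
      have hb : (0 : ℝ) < (v m : ℝ) / 2 := by simp only [hv]; positivity
      have hee : ∀ x, e m x = Real.exp (-((v m : ℝ) / 2) * x ^ 2) := fun x => by
        simp only [he]; congr 1; ring
      have hint : Integrable (fun x => c m * e m x) := by
        simp_rw [hee]
        exact (integrable_exp_neg_mul_sq hb).const_mul _
      rw [← ofReal_integral_eq_lintegral_ofReal hint (.of_forall fun x => mul_nonneg (hc0 m) (he0 m x)),
        integral_const_mul]
      simp_rw [hee]
      rw [integral_gaussian]
      congr 1
      have h3 : Real.pi / ((v m : ℝ) / 2) = 2 * Real.pi * (2 ^ m) ^ 2 := by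
        simp only [hv, NNReal.coe_inv, NNReal.coe_pow, NNReal.coe_ofNat]
        have h4 : ((2 : ℝ) ^ m) ^ 2 = 4 ^ m := by rw [← pow_mul, mul_comm m 2, pow_mul]; norm_num
        rw [h4]
        field_simp
      rw [h3, Real.sqrt_mul (by positivity), Real.sqrt_sq (by positivity)]
      ring
    simp_rw [h2]
    rw [← ENNReal.ofReal_tsum_of_nonneg (fun m => by have := hc0 m; positivity) (hcs.mul_left _)]
    exact ENNReal.ofReal_lt_top
  · refine (hkg x).trans ?_
    have hkey : ∃ m, g |x| ≤ c m * e m x := by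
      have hexp : ∀ r : ℝ, -1 ≤ r → 1 ≤ Real.exp 1 * Real.exp r := fun r hr => by
        rw [← Real.exp_add]; exact Real.one_le_exp (by linarith)
      by_cases hx : |x| < 1
      · refine ⟨0, ?_⟩
        have h1 : g |x| ≤ g 0 := hg (Set.mem_Ici.2 le_rfl) (Set.mem_Ici.2 (abs_nonneg x)) (abs_nonneg x)
        have h2 : x ^ 2 ≤ 1 := by rw [← sq_abs]; nlinarith [abs_nonneg x]
        have h3 := hexp (-((v 0 : ℝ) * x ^ 2) / 2) (by simp only [hv, pow_zero, inv_one, NNReal.coe_one]; linarith)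
        simp only [hc, he, if_true]
        nlinarith [hg0 0 le_rfl]
      · obtain ⟨m, hm1, hm2⟩ := exists_nat_pow_near (not_lt.1 hx) (by norm_num : (1 : ℝ) < 2)
        refine ⟨m + 1, ?_⟩
        have h1 : g |x| ≤ g (2 ^ m) :=
          hg (Set.mem_Ici.2 (by positivity)) (Set.mem_Ici.2 (abs_nonneg x)) hm1
        have h2 : (v (m + 1) : ℝ) * x ^ 2 ≤ 1 := by
          simp only [hv, NNReal.coe_inv, NNReal.coe_pow, NNReal.coe_ofNat]
          rw [inv_mul_le_iff₀ (by positivity), mul_one, ← sq_abs]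
          calc |x| ^ 2 ≤ (2 ^ (m + 1)) ^ 2 := by gcongr
            _ = 4 ^ (m + 1) := by rw [← pow_mul, mul_comm, pow_mul]; norm_num
        have h3 := hexp (-((v (m + 1) : ℝ) * x ^ 2) / 2) (by linarith)
        simp only [hc, he, Nat.add_eq_zero_iff, one_ne_zero, and_false, if_false, Nat.add_sub_cancel]
        have h4 := hg0 (2 ^ m) (by positivity)
        nlinarith
    obtain ⟨m, hm⟩ := hkey
    exact hm.trans ((hpt x).le_tsum m fun j _ => mul_nonneg (hc0 j) (he0 j x))

end GaussianMajorant

/-! ### Remote pairs -/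

section Tails

variable {Ω E ι : Type*} [MeasurableSpace Ω] [MeasurableSpace E] [Fintype ι]
variable {μ : Measure Ω} [IsProbabilityMeasure μ] {V : ℤ → Ω → E} {Q : Measure E} {a : ℕ → ℝ}
  {π : E → ι → ℝ} {h : ℕ → ℝ}

theorem pairMean_eq_of_nonneg (hVm : ∀ t, Measurable (V t)) (n : ℕ) {H : E → E → ℝ}
    (hH : Measurable (Function.uncurry H)) (h0 : ∀ x x', 0 ≤ H x x') :
    pairMean μ V n H = ∫⁻ ω, ‖pairAvg V n H ω‖ₑ ∂μ := by
  have hm : ∀ t s, Measurable fun ω => ‖H (V t ω) (V s ω)‖ₑ := fun t s =>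
    (hH.comp ((hVm t).prodMk (hVm s))).enorm
  rcases n.eq_zero_or_pos with rfl | hn
  · simp [pairMean, pairAvg]
  have e : ∀ ω, ‖pairAvg V n H ω‖ₑ = ((n : ℝ≥0∞) ^ 2)⁻¹ * ∑ t ∈ Finset.Icc (1 : ℤ) n,
      ∑ s ∈ (Finset.Icc (1 : ℤ) n).erase t, ‖H (V t ω) (V s ω)‖ₑ := by
    intro ω
    rw [pairAvg, enorm_mul, enorm_inv (by positivity)]
    congr 1
    · simp [enorm_pow]
    · rw [Real.enorm_of_nonneg (Finset.sum_nonneg fun t _ => Finset.sum_nonneg fun s _ => h0 _ _),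
        ENNReal.ofReal_sum_of_nonneg fun t _ => Finset.sum_nonneg fun s _ => h0 _ _]
      refine Finset.sum_congr rfl fun t _ => ?_
      rw [ENNReal.ofReal_sum_of_nonneg fun s _ => h0 _ _]
      exact Finset.sum_congr rfl fun s _ => (Real.enorm_of_nonneg (h0 _ _)).symm
  simp_rw [e]
  rw [lintegral_const_mul _ (Finset.measurable_fun_sum _ fun t _ =>
      Finset.measurable_fun_sum _ fun s _ => hm t s),
    lintegral_finsetSum _ fun t _ => Finset.measurable_fun_sum _ fun s _ => hm t s]
  simp_rw [fun t => lintegral_finsetSum ((Finset.Icc (1 : ℤ) n).erase t)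
    (μ := μ) (f := fun s ω => ‖H (V t ω) (V s ω)‖ₑ) fun s _ => hm t s]
  rfl

theorem tailCondition_of_bounded (hV : MixingSequence μ V Q a)
    {K : (ι → ℝ) → ℝ} {R : ℝ} (hR : ∀ᵐ x ∂Q, ‖π x‖ ≤ R) : TailCondition μ V π K h := by
  intro ε hε
  refine ⟨R, fun A hA => .of_forall fun n => ?_⟩
  have h0 : ∀ t, ∀ᵐ ω ∂μ, ‖π (V t ω)‖ ≤ R := fun t => by
    rw [← hV.map_eq t] at hR
    exact ae_of_ae_map (hV.measurable t).aemeasurable hR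
  have : pairMean μ V n (fun x x' => scaledKernel π K (h n) x x' *
      (π ⁻¹' (Metric.closedBall 0 A)ᶜ).indicator (fun _ => 1) x) = 0 := by
    unfold pairMean
    refine mul_eq_zero_of_right _ (Finset.sum_eq_zero fun t _ => Finset.sum_eq_zero fun s _ => ?_)
    refine (lintegral_congr_ae ?_).trans lintegral_zero
    filter_upwards [h0 t] with ω hω
    have : V t ω ∉ π ⁻¹' (Metric.closedBall 0 A)ᶜ := by
      simpa using hω.trans hA
    simp only [Set.indicator_of_notMem this, mul_zero, enorm_zero]
  rw [this]
  exact zero_le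

/-- Bounded joint densities say nothing uniform over a region of infinite volume. Instead `K` is
replaced by the nonnegative majorant `G = ∏ ψ`, for which the mean over pairs is the expectation of
the pair average. That is at most the deviation plus the value under independence. The deviation is
of order `(√n h^d)⁻¹`, as `G` itself is a mixture of cosines, and the independence value is at most
`M ∫ G` times the probability of a remote point. -/
theorem KernelDesign.tailCondition_of_charFun (hD : KernelDesign μ V Q a π h) {K : (ι → ℝ) → ℝ}
    {ν : Measure ℝ} [IsFiniteMeasure ν] {ψ : ℝ → ℝ} (hψ : ∀ t, charFun ν t = (ψ t : ℂ))
    (hψm : Measurable ψ) (hψi : Integrable ψ) (hψ0 : ∀ t, 0 ≤ ψ t)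
    (hK : ∀ u, |K u| ≤ ∏ j, ψ (u j)) : TailCondition μ V π K h := by
  have hQ := hD.mixing.isProbabilityMeasure
  have hπ := hD.measurable_proj
  have hVm := hD.mixing.measurable
  obtain ⟨M, hM⟩ := hD.density
  set G : (ι → ℝ) → ℝ := fun u => ∏ j, ψ (u j) with hG
  have hG0 : ∀ u, 0 ≤ G u := fun u => Finset.prod_nonneg fun j _ => hψ0 _
  have hGm : Measurable G := Finset.measurable_fun_prod _ fun j _ => hψm.comp (measurable_pi_apply j)
  have hGi : Integrable G := Integrable.fintype_prod fun _ => hψi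
  have hIG : (∫⁻ u, ‖G u‖ₑ) ≠ ∞ := hGi.2.ne
  set Ξ : Measure (ι → ℝ) := Measure.pi fun _ : ι => ν
  intro ε hε
  have hε2 : 0 < ε / 2 := ENNReal.half_pos hε.ne'
  have hmeas : Tendsto (fun A : ℝ => Q (π ⁻¹' (Metric.closedBall 0 A)ᶜ) * (M * ∫⁻ u, ‖G u‖ₑ))
      atTop (𝓝 0) := by
    have := ENNReal.Tendsto.mul_const (b := M * ∫⁻ u, ‖G u‖ₑ)
      (tendsto_measure_compl_closedBall (Q := Q) hπ) (Or.inr (ENNReal.mul_ne_top (by simp) hIG))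
    simpa using this
  obtain ⟨A₀, hA₀⟩ := eventually_atTop.1 (ENNReal.tendsto_nhds_zero.1 hmeas (ε / 2) hε2)
  refine ⟨A₀, fun A hA => ?_⟩
  set O : Set E := π ⁻¹' (Metric.closedBall 0 A)ᶜ with hO
  have hOm : MeasurableSet O := hπ Metric.isClosed_closedBall.measurableSet.compl
  have hind1 : ∀ x, |O.indicator (fun _ => (1 : ℝ)) x| ≤ 1 := fun x => by
    by_cases hx : x ∈ O <;> simp [hx]
  have hind0 : ∀ x, 0 ≤ O.indicator (fun _ => (1 : ℝ)) x := fun x => by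
    by_cases hx : x ∈ O <;> simp [hx]
  have hindm : Measurable (O.indicator fun _ => (1 : ℝ)) := measurable_const.indicator hOm
  filter_upwards [ENNReal.tendsto_nhds_zero.1 (hD.rate_inv (2 * (Ξ.real Set.univ * devConst a))) (ε / 2)
    hε2, eventually_gt_atTop 0] with n hn1 hn
  have hh := hD.bandwidth_pos n
  set H : E → E → ℝ := fun x x' => scaledKernel π G (h n) x x' * O.indicator (fun _ => 1) x with hH
  have hHm : Measurable (Function.uncurry H) :=
    (measurable_scaledKernel hπ hGm (h n)).mul (hindm.comp measurable_fst)
  have hs0 : ∀ x x', 0 ≤ scaledKernel π G (h n) x x' := fun x x' => by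
    unfold scaledKernel; have := hG0 ((h n)⁻¹ • (π x - π x')); positivity
  have hH0 : ∀ x x', 0 ≤ H x x' := fun x x' => mul_nonneg (hs0 x x') (hind0 x)
  have hmono : pairMean μ V n (fun x x' => scaledKernel π K (h n) x x' * O.indicator (fun _ => 1) x) ≤
      pairMean μ V n H := by
    refine pairMean_mono n fun x x' => ?_
    rw [norm_mul, hH, norm_mul]
    gcongr
    unfold scaledKernel
    rw [norm_mul, norm_mul]
    gcongr
    exact (hK _).trans (le_abs_self _)
  have hdev : pairDev μ V Q n H ≤ ENNReal.ofReal (2 * (Ξ.real Set.univ * devConst a) *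
      (√n * h n ^ Fintype.card ι)⁻¹) := by
    have key := pairDev_cos_le hD.mixing hn Ξ
      (ℓ := fun ξ x => ∑ j, (h n)⁻¹ * π x j * ξ j) (ℓ' := fun ξ x => ∑ j, (h n)⁻¹ * π x j * ξ j)
      (s := fun _ => 1) (f := O.indicator fun _ => (1 : ℝ)) (g := fun _ => 1)
      (by unfold Function.uncurry; fun_prop) (by unfold Function.uncurry; fun_prop) (by fun_prop)
      (by simp) hindm measurable_const hind1 (by simp)
    have e : H = fun x x' => (h n ^ Fintype.card ι)⁻¹ * (O.indicator (fun _ => (1 : ℝ)) x * 1 *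
        ∫ ξ, 1 * Real.cos (∑ j, (h n)⁻¹ * π x j * ξ j - ∑ j, (h n)⁻¹ * π x' j * ξ j) ∂Ξ) := by
      ext x x'
      simp only [hH, scaledKernel, hG]
      rw [prod_charFun_eq_integral_cos ν hψ]
      have : ∀ ξ : ι → ℝ, ∑ j, ((h n)⁻¹ • (π x - π x')) j * ξ j =
          ∑ j, (h n)⁻¹ * π x j * ξ j - ∑ j, (h n)⁻¹ * π x' j * ξ j := by
        intro ξ
        rw [← Finset.sum_sub_distrib]
        refine Finset.sum_congr rfl fun j _ => ?_
        simp only [Pi.smul_apply, Pi.sub_apply, smul_eq_mul]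
        ring
      simp_rw [this, one_mul]
      ring
    rw [e, pairDev_const_mul]
    refine (mul_le_mul_right key _).trans (le_of_eq ?_)
    have hdc := devConst_nonneg a
    rw [Real.enorm_of_nonneg (by positivity), ← ofReal_measureReal (by simp),
      ← ENNReal.ofReal_mul (by positivity),
      show (2 : ℝ≥0∞) = ENNReal.ofReal 2 by simp, ← ENNReal.ofReal_mul (by positivity),
      ← ENNReal.ofReal_mul (by positivity)]
    congr 1
    rw [mul_inv]
    ring
  have hQQ : ∫⁻ x, ∫⁻ x', ‖H x x'‖ₑ ∂Q ∂Q ≤ ε / 2 := by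
    refine le_trans ?_ (hA₀ A hA)
    calc _ ≤ ∫⁻ x, O.indicator (fun _ => 1) x * (M * ∫⁻ u, ‖G u‖ₑ) ∂Q := by
          refine lintegral_mono fun x => ?_
          by_cases hx : x ∈ O
          · simp only [hH, Set.indicator_of_mem hx, mul_one, one_mul]
            exact lintegral_scaledKernel_le hπ hM hGm hh x
          · simp [hH, hx]
      _ = _ := by
          rw [lintegral_mul_const _ (measurable_const.indicator hOm), lintegral_indicator hOm]
          simp only [lintegral_const, Measure.restrict_apply MeasurableSet.univ, Set.univ_inter, one_mul, hO]
  refine hmono.trans ?_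
  rw [pairMean_eq_of_nonneg hVm n hHm hH0]
  calc _ ≤ ∫⁻ ω, (‖pairAvg V n H ω - ∫ x, ∫ x', H x x' ∂Q ∂Q‖ₑ + ‖∫ x, ∫ x', H x x' ∂Q ∂Q‖ₑ) ∂μ := by
        refine lintegral_mono fun ω => ?_
        refine le_trans (le_of_eq ?_) (enorm_add_le _ _)
        rw [sub_add_cancel]
    _ = pairDev μ V Q n H + ‖∫ x, ∫ x', H x x' ∂Q ∂Q‖ₑ := by
        rw [lintegral_add_right _ measurable_const]; simp [pairDev]
    _ ≤ ε / 2 + ε / 2 := by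
        refine add_le_add (hdev.trans hn1) (le_trans ?_ hQQ)
        refine (enorm_integral_le_lintegral_enorm _).trans (lintegral_mono fun x => ?_)
        exact enorm_integral_le_lintegral_enorm _
    _ = ε := ENNReal.add_halves ε

end Tails

/-! ### The limit of kernel pair averages -/

section KernelLimit

variable {Ω R ι : Type*} [MeasurableSpace Ω] [MeasurableSpace R] [Fintype ι]
variable {μ : Measure Ω} [IsProbabilityMeasure μ] {V : ℤ → Ω → (ι → ℝ) × R} {a : ℕ → ℝ} {h : ℕ → ℝ}
  {P : Measure (ι → ℝ)} {κ : Kernel (ι → ℝ) R} {fW : (ι → ℝ) → ℝ≥0∞} {M : ℝ≥0}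

/-- The regression function `u ↦ E[f(U, ·) | U = u]`. -/
def condMean (κ : Kernel (ι → ℝ) R) (f : (ι → ℝ) × R → ℝ) (u : ι → ℝ) : ℝ := ∫ r, f (u, r) ∂κ u

/-- The value `E[a(U) b(U) f_U(U)]`, with `a`, `b` the regression functions of `f`, `g`. -/
def pairLimit (P : Measure (ι → ℝ)) (κ : Kernel (ι → ℝ) R) (fW : (ι → ℝ) → ℝ≥0∞)
    (f g : (ι → ℝ) × R → ℝ) : ℝ :=
  ∫ u, condMean κ f u * condMean κ g u * (fW u).toReal ∂P

theorem measurable_condMean [IsMarkovKernel κ] {f : (ι → ℝ) × R → ℝ} (hf : Measurable f) :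
    Measurable (condMean κ f) :=
  (hf.stronglyMeasurable.integral_kernel_prod_right' (κ := κ)).measurable

theorem abs_condMean_le [IsMarkovKernel κ] {f : (ι → ℝ) × R → ℝ} {A : ℝ} (hf : ∀ x, |f x| ≤ A)
    (u : ι → ℝ) : |condMean κ f u| ≤ A := by
  have := norm_integral_le_of_norm_le_const (μ := κ u) (f := fun r => f (u, r)) (C := A)
    (.of_forall fun r => hf (u, r))
  simpa [condMean] using this

theorem integral_fst_mul_compProd [IsMarkovKernel κ] [IsFiniteMeasure P] {f : (ι → ℝ) × R → ℝ}
    (hf : Measurable f) (hf1 : ∀ x, |f x| ≤ 1) {G : (ι → ℝ) → ℝ} (hG : Measurable G) {A : ℝ}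
    (hA : ∀ u, |G u| ≤ A) :
    ∫ x, G x.1 * f x ∂(P ⊗ₘ κ) = ∫ u, G u * condMean κ f u ∂P := by
  rw [Measure.integral_compProd]
  · simp only [integral_const_mul, condMean]
  · refine integrable_of_abs_le (B := A) (by fun_prop) fun x => ?_
    rw [abs_mul]
    calc |G x.1| * |f x| ≤ A * 1 := mul_le_mul (hA _) (hf1 _) (abs_nonneg _) ((abs_nonneg _).trans (hA 0))
      _ = A := mul_one A

theorem toReal_density_le (hle : ∀ u, fW u ≤ M) (u : ι → ℝ) : |(fW u).toReal| ≤ M := by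
  rw [abs_of_nonneg ENNReal.toReal_nonneg]
  exact ENNReal.toReal_le_of_le_ofReal M.2 (by simpa using hle u)

theorem integrable_toReal_density [IsFiniteMeasure P] (hfW : Measurable fW)
    (hP : P = volume.withDensity fW) : Integrable fun u => (fW u).toReal := by
  refine integrable_toReal_of_lintegral_ne_top hfW.aemeasurable ?_
  have : ∫⁻ u, fW u = P Set.univ := by rw [hP, withDensity_apply _ MeasurableSet.univ, setLIntegral_univ]
  rw [this]
  exact measure_ne_top _ _

/-- Under independence, kernel pair averages converge to `pairLimit`. -/
theorem tendsto_integral_scaledKernel [IsMarkovKernel κ] [IsProbabilityMeasure P]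
    (hfW : Measurable fW) (hle : ∀ u, fW u ≤ M) (hP : P = volume.withDensity fW)
    (hpos : ∀ n, 0 < h n) (hlim : Tendsto h atTop (𝓝 0)) {K : (ι → ℝ) → ℝ}
    (hK : Measurable K) (hKi : Integrable K) {B : ℝ} (hB : ∀ u, |K u| ≤ B)
    {f g : (ι → ℝ) × R → ℝ} (hf : Measurable f) (hg : Measurable g)
    (hf1 : ∀ x, |f x| ≤ 1) (hg1 : ∀ x, |g x| ≤ 1) :
    Tendsto (fun n => ∫ x, ∫ x', scaledKernel Prod.fst K (h n) x x' * (f x * g x') ∂(P ⊗ₘ κ) ∂(P ⊗ₘ κ))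
      atTop (𝓝 ((∫ u, K u) * pairLimit P κ fW f g)) := by
  set b : (ι → ℝ) → ℝ := fun u => condMean κ g u * (fW u).toReal with hb
  have hbm : Measurable b := (measurable_condMean hg).mul hfW.ennreal_toReal
  have hb1 : ∀ u, |b u| ≤ M := fun u => by
    rw [hb, abs_mul]
    calc _ ≤ 1 * (M : ℝ) := mul_le_mul (abs_condMean_le hg1 u) (toReal_density_le hle u) (abs_nonneg _) zero_le_one
      _ = M := one_mul _
  have hbi : Integrable b := by
    refine (integrable_toReal_density hfW hP).bdd_mul (c := 1)
      (measurable_condMean hg).aestronglyMeasurable (.of_forall fun u => abs_condMean_le hg1 u)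
  -- Conditioning the second point on its covariate turns the inner integral into a smoothing of
  -- `b`, the regression of `g` times the density. Its `L¹` convergence to `(∫ K) b` transfers to
  -- `P`, whose density is at most `M`.
  have hinner : ∀ n x, ∫ x', scaledKernel Prod.fst K (h n) x x' * (f x * g x') ∂(P ⊗ₘ κ) =
      smoothing K (h n) b x.1 * f x := by
    intro n x
    have e1 : ∀ x' : (ι → ℝ) × R, scaledKernel Prod.fst K (h n) x x' * (f x * g x') =
        f x * (((h n ^ Fintype.card ι)⁻¹ * K ((h n)⁻¹ • (x.1 - x'.1))) * g x') := fun x' => by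
      unfold scaledKernel; ring
    simp_rw [e1]
    rw [integral_const_mul, integral_fst_mul_compProd hg hg1
      (G := fun u => (h n ^ Fintype.card ι)⁻¹ * K ((h n)⁻¹ • (x.1 - u)))
      (by fun_prop) (A := (h n ^ Fintype.card ι)⁻¹ * B) (fun u => ?_), hP,
      integral_withDensity_eq_integral_toReal_smul hfW (.of_forall fun u => (hle u).trans_lt (by simp)),
      ← integral_scaled_kernel_eq_smoothing _ _ (hpos n), mul_comm]
    · congr 1
      refine integral_congr_ae (.of_forall fun u => ?_)
      simp only [smul_eq_mul, hb]
      ring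
    · have := hpos n
      rw [abs_mul, abs_of_pos (by positivity)]
      gcongr
      exact hB _
  simp_rw [hinner]
  have hsm : ∀ n, Measurable (smoothing K (h n) b) := fun n => measurable_smoothing hK hbm _
  have houter : ∀ n, ∫ x, smoothing K (h n) b x.1 * f x ∂(P ⊗ₘ κ) =
      ∫ u, smoothing K (h n) b u * condMean κ f u ∂P := fun n =>
    integral_fst_mul_compProd hf hf1 (hsm n) (abs_smoothing_le hKi hb1 (h n))
  simp_rw [houter]
  rw [tendsto_iff_edist_tendsto_0]
  have hbound := ENNReal.Tendsto.const_mul (a := (M : ℝ≥0∞))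
    ((tendsto_lintegral_smoothing hKi hK hbm hbi hb1).comp hlim) (Or.inr (by simp))
  rw [mul_zero] at hbound
  refine tendsto_of_tendsto_of_tendsto_of_le_of_le tendsto_const_nhds hbound (fun _ => zero_le) fun n => ?_
  have hcf := measurable_condMean (κ := κ) hf
  have e2 : (∫ u, K u) * pairLimit P κ fW f g = ∫ u, ((∫ v, K v) * b u) * condMean κ f u ∂P := by
    rw [pairLimit, ← integral_const_mul]
    refine integral_congr_ae (.of_forall fun u => ?_)
    simp only [hb]; ring
  have hi1 : Integrable (fun u => smoothing K (h n) b u * condMean κ f u) P := by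
    refine Integrable.mul_bdd (c := 1) (integrable_of_abs_le (hsm n) (abs_smoothing_le hKi hb1 (h n)))
      hcf.aestronglyMeasurable (.of_forall fun u => abs_condMean_le hf1 u)
  have hi2 : Integrable (fun u => ((∫ v, K v) * b u) * condMean κ f u) P := by
    refine Integrable.mul_bdd (c := 1) ((integrable_of_abs_le hbm hb1).const_mul _)
      hcf.aestronglyMeasurable (.of_forall fun u => abs_condMean_le hf1 u)
  rw [e2, edist_eq_enorm_sub, ← integral_sub hi1 hi2]
  refine (enorm_integral_le_lintegral_enorm _).trans ?_
  calc _ ≤ ∫⁻ u, ‖smoothing K (h n) b u - (∫ v, K v) * b u‖ₑ ∂P := by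
        refine lintegral_mono fun u => ?_
        rw [← sub_mul, enorm_mul]
        refine mul_le_of_le_one_right zero_le ?_
        rw [Real.enorm_eq_ofReal_abs, ENNReal.ofReal_le_one]
        exact abs_condMean_le hf1 u
    _ ≤ ∫⁻ u, ‖smoothing K (h n) b u - (∫ v, K v) * b u‖ₑ ∂((M : ℝ≥0∞) • volume) := by
        refine lintegral_mono' ?_ le_rfl
        rw [hP, ← withDensity_const]
        exact withDensity_mono (.of_forall hle)
    _ = _ := by rw [lintegral_smul_measure]; rfl

theorem pairLimit_const_mul (c c' : ℝ) (f g : (ι → ℝ) × R → ℝ) :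
    pairLimit P κ fW (fun x => c * f x) (fun x => c' * g x) = c * c' * pairLimit P κ fW f g := by
  unfold pairLimit condMean
  rw [← integral_const_mul]
  refine integral_congr_ae (.of_forall fun u => ?_)
  simp only [integral_const_mul]
  ring

/-- Convergence in probability of kernel pair averages. -/
theorem KernelDesign.tendstoInMeasure [IsMarkovKernel κ] [IsProbabilityMeasure P]
    (hD : KernelDesign μ V (P ⊗ₘ κ) a Prod.fst h)
    (hfW : Measurable fW) (hle : ∀ u, fW u ≤ M) (hP : P = volume.withDensity fW) {K : (ι → ℝ) → ℝ}
    (hK : Measurable K) (hKi : Integrable K) {B : ℝ} (hB : ∀ u, |K u| ≤ B)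
    (htail : TailCondition μ V Prod.fst K h) {f g : (ι → ℝ) × R → ℝ} (hf : Measurable f)
    (hg : Measurable g) {A A' : ℝ} (hfA : ∀ x, |f x| ≤ A) (hgA : ∀ x, |g x| ≤ A') :
    TendstoInMeasure μ (fun n => pairAvg V n (fun x x' => scaledKernel Prod.fst K (h n) x x' * (f x * g x')))
      atTop (fun _ => (∫ u, K u) * pairLimit P κ fW f g) := by
  have hVm := hD.mixing.measurable
  have hHm : ∀ n, Measurable (Function.uncurry fun x x' => scaledKernel Prod.fst K (h n) x x' * (f x * g x')) :=
    fun n => (measurable_scaledKernel measurable_fst hK (h n)).mul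
      ((hf.comp measurable_fst).mul (hg.comp measurable_snd))
  refine tendstoInMeasure_of_tendsto_eLpNorm one_ne_zero
    (fun n => (measurable_pairAvg hVm n (hHm n)).aestronglyMeasurable) aestronglyMeasurable_const ?_
  simp_rw [eLpNorm_one_eq_lintegral_enorm]
  -- Rescaling to functions bounded by one; the `+ 1` excludes division by zero.
  set f' : (ι → ℝ) × R → ℝ := fun x => (|A| + 1)⁻¹ * f x with hf'
  set g' : (ι → ℝ) × R → ℝ := fun x => (|A'| + 1)⁻¹ * g x with hg'
  have hscale : ∀ (C : ℝ) (f : (ι → ℝ) × R → ℝ), (∀ x, |f x| ≤ C) → ∀ x, |(|C| + 1)⁻¹ * f x| ≤ 1 := by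
    intro C f hC x
    rw [abs_mul, abs_of_pos (by positivity), inv_mul_le_iff₀ (by positivity)]
    linarith [hC x, le_abs_self C]
  have hf1 := hscale A f hfA
  have hg1 := hscale A' g hgA
  have hf'm : Measurable f' := hf.const_mul _
  have hg'm : Measurable g' := hg.const_mul _
  have t1 := hD.tendsto_pairDev hK hKi hB htail hf'm hg'm hf1 hg1
  have t2 := tendsto_integral_scaledKernel (κ := κ) hfW hle hP hD.bandwidth_pos hD.bandwidth_tendsto hK hKi hB
    hf'm hg'm hf1 hg1
  rw [tendsto_iff_edist_tendsto_0] at t2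
  have t3 := ENNReal.Tendsto.const_mul (a := ‖(|A| + 1) * (|A'| + 1)‖ₑ) (t1.add t2) (Or.inr enorm_ne_top)
  rw [add_zero, mul_zero] at t3
  refine tendsto_of_tendsto_of_tendsto_of_le_of_le tendsto_const_nhds t3 (fun _ => zero_le) fun n => ?_
  set c := (|A| + 1) * (|A'| + 1) with hc
  have hc0 : (|A| + 1) ≠ 0 := by positivity
  have hc0' : (|A'| + 1) ≠ 0 := by positivity
  have e1 : ∀ ω, pairAvg V n (fun x x' => scaledKernel Prod.fst K (h n) x x' * (f x * g x')) ω =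
      c * pairAvg V n (fun x x' => scaledKernel Prod.fst K (h n) x x' * (f' x * g' x')) ω := by
    intro ω
    rw [← pairAvg_const_mul]
    congr 1
    ext x x'
    simp only [hf', hg', hc]
    field_simp
  have e2 : (∫ u, K u) * pairLimit P κ fW f g = c * ((∫ u, K u) * pairLimit P κ fW f' g') := by
    rw [hf', hg', pairLimit_const_mul]
    simp only [hc]
    field_simp
  have e3 : ∀ ω, ‖pairAvg V n (fun x x' => scaledKernel Prod.fst K (h n) x x' * (f x * g x')) ω -
      (∫ u, K u) * pairLimit P κ fW f g‖ₑ = ‖c‖ₑ *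
      ‖pairAvg V n (fun x x' => scaledKernel Prod.fst K (h n) x x' * (f' x * g' x')) ω -
        (∫ u, K u) * pairLimit P κ fW f' g'‖ₑ := by
    intro ω
    rw [e1, e2, ← mul_sub, enorm_mul]
  calc _ = ‖c‖ₑ * ∫⁻ ω, ‖pairAvg V n (fun x x' => scaledKernel Prod.fst K (h n) x x' * (f' x * g' x')) ω -
        (∫ u, K u) * pairLimit P κ fW f' g'‖ₑ ∂μ := by
        rw [← lintegral_const_mul' _ _ (by simp)]
        exact lintegral_congr e3
    _ ≤ _ := by
        gcongr
        rw [pairDev, edist_eq_enorm_sub]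
        calc _ ≤ ∫⁻ ω, (‖pairAvg V n (fun x x' => scaledKernel Prod.fst K (h n) x x' * (f' x * g' x')) ω -
              ∫ x, ∫ x', scaledKernel Prod.fst K (h n) x x' * (f' x * g' x') ∂(P ⊗ₘ κ) ∂(P ⊗ₘ κ)‖ₑ +
              ‖∫ x, ∫ x', scaledKernel Prod.fst K (h n) x x' * (f' x * g' x') ∂(P ⊗ₘ κ) ∂(P ⊗ₘ κ) -
                (∫ u, K u) * pairLimit P κ fW f' g'‖ₑ) ∂μ := by
              refine lintegral_mono fun ω => le_trans (le_of_eq ?_) (enorm_add_le _ _)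
              rw [sub_add_sub_cancel]
          _ = _ := by
              rw [lintegral_add_right _ measurable_const]
              simp

/-- A bound for `pairLimit` in terms of the mean of one of the functions. -/
theorem pairLimit_le [IsMarkovKernel κ] [IsProbabilityMeasure P]
    (hle : ∀ u, fW u ≤ M) {e : (ι → ℝ) × R → ℝ} (he : Measurable e)
    (he0 : ∀ x, 0 ≤ e x) {A : ℝ} (heA : ∀ x, e x ≤ A) :
    pairLimit P κ fW e (fun _ => 1) ≤ M * ∫ x, e x ∂(P ⊗ₘ κ) := by
  have hA : ∀ x, |e x| ≤ A := fun x => by rw [abs_of_nonneg (he0 x)]; exact heA x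
  rw [Measure.integral_compProd (integrable_of_abs_le he hA), ← integral_const_mul]
  have hm := measurable_condMean (κ := κ) he
  have h1 : ∀ u, condMean κ (fun _ => (1 : ℝ)) u = 1 := fun u => by simp [condMean]
  have h0 : ∀ u, 0 ≤ condMean κ e u := fun u => integral_nonneg fun r => he0 _
  simp only [pairLimit, h1, mul_one]
  refine integral_mono_of_nonneg (.of_forall fun u => mul_nonneg (h0 u) ENNReal.toReal_nonneg)
    ((integrable_of_abs_le hm (abs_condMean_le hA)).const_mul _) (.of_forall fun u => ?_)
  have := (le_abs_self _).trans (toReal_density_le hle u)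
  simp only
  rw [mul_comm]
  exact mul_le_mul_of_nonneg_right this (h0 u)

theorem pairLimit_comm (f g : (ι → ℝ) × R → ℝ) : pairLimit P κ fW f g = pairLimit P κ fW g f := by
  unfold pairLimit
  simp_rw [mul_comm (condMean κ f _)]

end KernelLimit

/-! ### Uniform convergence in probability from finite partitions -/

section InProbability

variable {Ω F : Type*} [MeasurableSpace Ω] [NormedAddCommGroup F] {μ : Measure Ω}

theorem tendsto_measure_zero_of_eventually_subset {s t : ℕ → Set Ω}
    (ht : Tendsto (fun n => μ (t n)) atTop (𝓝 0)) (hst : ∀ᶠ n in atTop, s n ⊆ t n) :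
    Tendsto (fun n => μ (s n)) atTop (𝓝 0) :=
  tendsto_of_tendsto_of_tendsto_of_le_of_le' tendsto_const_nhds ht (.of_forall fun _ => zero_le)
    (hst.mono fun _ hn => measure_mono hn)

theorem tendsto_measure_union_zero {s t : ℕ → Set Ω} (hs : Tendsto (fun n => μ (s n)) atTop (𝓝 0))
    (ht : Tendsto (fun n => μ (t n)) atTop (𝓝 0)) : Tendsto (fun n => μ (s n ∪ t n)) atTop (𝓝 0) := by
  have := hs.add ht
  rw [add_zero] at this
  exact tendsto_of_tendsto_of_tendsto_of_le_of_le tendsto_const_nhds this (fun _ => zero_le)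
    fun n => measure_union_le _ _

theorem tendsto_measure_biUnion_zero {J : Type*} (A : Finset J) {s : J → ℕ → Set Ω}
    (hs : ∀ c ∈ A, Tendsto (fun n => μ (s c n)) atTop (𝓝 0)) :
    Tendsto (fun n => μ (⋃ c ∈ A, s c n)) atTop (𝓝 0) := by
  have := tendsto_finsetSum A hs
  rw [Finset.sum_const_zero] at this
  exact tendsto_of_tendsto_of_tendsto_of_le_of_le tendsto_const_nhds this (fun _ => zero_le)
    fun n => measure_biUnion_finset_le _ _

theorem TendstoInMeasure.const_seq_smul [NormedSpace ℝ F] {r : ℕ → ℝ} (hr : Tendsto r atTop (𝓝 1))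
    {X : ℕ → Ω → F} {c : F} (hX : TendstoInMeasure μ X atTop fun _ => c) :
    TendstoInMeasure μ (fun n ω => r n • X n ω) atTop fun _ => c := by
  rw [tendstoInMeasure_iff_norm] at hX ⊢
  intro ε hε
  refine tendsto_measure_zero_of_eventually_subset (hX (ε / 4) (by positivity)) ?_
  have h1 : ∀ᶠ n in atTop, |r n| < 2 := by
    have := hr.abs
    rw [abs_one] at this
    exact this.eventually_lt_const (by norm_num)
  have h2 : ∀ᶠ n in atTop, |r n - 1| * ‖c‖ < ε / 2 := by
    have := ((hr.sub_const 1).abs.mul_const ‖c‖)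
    rw [sub_self, abs_zero, zero_mul] at this
    exact this.eventually_lt_const (by positivity)
  filter_upwards [h1, h2] with n hn1 hn2 ω hω
  simp only [Set.mem_ofPred_eq] at hω ⊢
  by_contra hlt
  push Not at hlt
  have e : r n • X n ω - c = r n • (X n ω - c) + (r n - 1) • c := by
    rw [smul_sub, sub_smul, one_smul]; abel
  have := norm_add_le (r n • (X n ω - c)) ((r n - 1) • c)
  rw [← e, norm_smul, norm_smul, Real.norm_eq_abs, Real.norm_eq_abs] at this
  nlinarith [abs_nonneg (r n), norm_nonneg (X n ω - c)]

theorem TendstoInMeasure.add_const_limits {X X' : ℕ → Ω → F} {c c' : F}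
    (hX : TendstoInMeasure μ X atTop fun _ => c) (hX' : TendstoInMeasure μ X' atTop fun _ => c') :
    TendstoInMeasure μ (fun n ω => X n ω + X' n ω) atTop fun _ => c + c' := by
  rw [tendstoInMeasure_iff_norm] at hX hX' ⊢
  intro ε hε
  refine tendsto_measure_zero_of_eventually_subset
    (tendsto_measure_union_zero (hX (ε / 2) (by positivity)) (hX' (ε / 2) (by positivity)))
    (.of_forall fun n ω hω => ?_)
  simp only [Set.mem_ofPred_eq, Set.mem_union] at hω ⊢
  by_contra hlt
  push Not at hlt
  have := norm_add_le (X n ω - c) (X' n ω - c')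
  rw [← add_sub_add_comm] at this
  linarith

/-- Uniform convergence in probability over `S` to a deterministic function. -/
def UniformInProbability {I : Type*} (μ : Measure Ω) (S : Set I) (T : ℕ → I → Ω → F) (L : I → F) : Prop :=
  ∀ δ : ℝ, 0 < δ → Tendsto (fun n => μ {ω | ∃ q ∈ S, δ ≤ ‖T n q ω - L q‖}) atTop (𝓝 0)

/-- `S` can be divided into finitely many cells, on which the oscillation of `T n` is bounded by
variables with small limits in probability. -/
def HasBrackets {I : Type*} [MeasurableSpace I] (μ : Measure Ω) (S : Set I) (T : ℕ → I → Ω → F) : Prop :=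
  ∀ ε : ℝ, 0 < ε → ∃ j : I → ℕ, Measurable j ∧ (j '' S).Finite ∧
    ∀ c, ∃ (D : ℕ → Ω → ℝ) (ℓ : ℝ), ℓ ≤ ε ∧ TendstoInMeasure μ D atTop (fun _ => ℓ) ∧
      ∀ n ω, ∀ q ∈ S, ∀ q' ∈ S, j q = c → j q' = c → ‖T n q ω - T n q' ω‖ ≤ D n ω

/-- The oscillation of `L` on the cells of some finite measurable partition of `S` is small. -/
def HasSmallOscillation {I : Type*} [MeasurableSpace I] (S : Set I) (L : I → F) : Prop :=
  ∀ ε : ℝ, 0 < ε → ∃ j : I → ℕ, Measurable j ∧ (j '' S).Finite ∧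
    ∀ q ∈ S, ∀ q' ∈ S, j q = j q' → ‖L q - L q'‖ ≤ ε

variable [IsProbabilityMeasure μ]

/-- Three events whose probabilities tend to zero cannot cover the space for every `n`; at a point
outside them the random inequality carries over to the limits, up to `3δ`. -/
theorem norm_sub_le_of_tendstoInMeasure {X X' : ℕ → Ω → F} {D : ℕ → Ω → ℝ} {c c' : F} {ℓ : ℝ}
    (hX : TendstoInMeasure μ X atTop fun _ => c) (hX' : TendstoInMeasure μ X' atTop fun _ => c')
    (hD : TendstoInMeasure μ D atTop fun _ => ℓ) (hle : ∀ n ω, ‖X n ω - X' n ω‖ ≤ D n ω) :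
    ‖c - c'‖ ≤ ℓ := by
  by_contra hlt
  push Not at hlt
  rw [tendstoInMeasure_iff_norm] at hX hX' hD
  set δ := (‖c - c'‖ - ℓ) / 3 with hδ
  have hδ0 : 0 < δ := by rw [hδ]; linarith
  have h0 := tendsto_measure_union_zero (tendsto_measure_union_zero (hX δ hδ0) (hX' δ hδ0)) (hD δ hδ0)
  obtain ⟨n, hn⟩ := (h0.eventually_lt_const (u := 1) (by norm_num)).exists
  have hne : ∃ ω, ω ∉ ({ω | δ ≤ ‖X n ω - c‖} ∪ {ω | δ ≤ ‖X' n ω - c'‖} ∪ {ω | δ ≤ ‖D n ω - ℓ‖}) := by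
    by_contra hall
    push Not at hall
    rw [Set.eq_univ_of_forall hall, measure_univ] at hn
    exact lt_irrefl _ hn
  obtain ⟨ω, hω⟩ := hne
  simp only [Set.mem_union, Set.mem_ofPred_eq, not_or, not_le] at hω
  obtain ⟨⟨h1, h2⟩, h3⟩ := hω
  have e : c - c' = -(X n ω - c) + (X' n ω - c') + (X n ω - X' n ω) := by abel
  have h4 : ‖c - c'‖ ≤ ‖X n ω - c‖ + ‖X' n ω - c'‖ + ‖X n ω - X' n ω‖ := by
    rw [e]
    refine (norm_add_le _ _).trans (add_le_add_left ((norm_add_le _ _).trans_eq ?_) _)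
    rw [norm_neg]
  have h5 := hle n ω
  have h6 := (abs_lt.1 h3).2
  rw [hδ] at h1 h2 h6
  linarith

variable {I : Type*} [MeasurableSpace I] {S : Set I} {T : ℕ → I → Ω → F} {L : I → F}

/-- No continuity of the limit is assumed: its oscillation on a cell is bounded by the limit of the
random bound for the oscillation of `T n`. -/
theorem HasBrackets.hasSmallOscillation (hb : HasBrackets μ S T)
    (hT : ∀ q ∈ S, TendstoInMeasure μ (fun n => T n q) atTop fun _ => L q) :
    HasSmallOscillation S L := by
  intro ε hε
  obtain ⟨j, hj, hfin, hc⟩ := hb ε hε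
  refine ⟨j, hj, hfin, fun q hq q' hq' hqq => ?_⟩
  obtain ⟨D, ℓ, hℓ, hD, hle⟩ := hc (j q')
  exact (norm_sub_le_of_tendstoInMeasure (hT q hq) (hT q' hq') hD
    fun n ω => hle n ω q hq q' hq' hqq rfl).trans hℓ

/-- Compare `q` with the representative of its cell. Outside finitely many events of small
probability, the oscillation of `T n` is at most `2δ/5`, the error at the representative at most
`δ/5`, and the oscillation of the limit at most `δ/5`. -/
theorem HasBrackets.uniformInProbability (hb : HasBrackets μ S T)
    (hT : ∀ q ∈ S, TendstoInMeasure μ (fun n => T n q) atTop fun _ => L q) :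
    UniformInProbability μ S T L := by
  intro δ hδ
  obtain ⟨j, hj, hfin, hc⟩ := hb (δ / 5) (by positivity)
  choose D ℓ hℓ hD hle using hc
  rcases S.eq_empty_or_nonempty with rfl | ⟨q₀, -⟩
  · simp
  have : Nonempty I := ⟨q₀⟩
  have hrep : ∀ c ∈ j '' S, ∃ q ∈ S, j q = c := fun c hc => hc
  choose! rep hrS hrj using hrep
  set A := hfin.toFinset with hA
  have h1 : Tendsto (fun n => μ (⋃ c ∈ A, {ω | δ / 5 ≤ ‖T n (rep c) ω - L (rep c)‖})) atTop (𝓝 0) :=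
    tendsto_measure_biUnion_zero A fun c hcA =>
      tendstoInMeasure_iff_norm.1 (hT _ (hrS c (hfin.mem_toFinset.1 hcA))) _ (by positivity)
  have h2 : Tendsto (fun n => μ (⋃ c ∈ A, {ω | δ / 5 ≤ ‖D c n ω - ℓ c‖})) atTop (𝓝 0) :=
    tendsto_measure_biUnion_zero A fun c _ => tendstoInMeasure_iff_norm.1 (hD c) _ (by positivity)
  refine tendsto_measure_zero_of_eventually_subset (tendsto_measure_union_zero h1 h2)
    (.of_forall fun n ω hω => ?_)
  obtain ⟨q, hq, hqδ⟩ := hω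
  by_contra hnot
  simp only [Set.mem_union, Set.mem_iUnion, Set.mem_ofPred_eq, not_or, not_exists, not_le] at hnot
  have hmem : j q ∈ j '' S := ⟨q, hq, rfl⟩
  have hm1 := hnot.1 (j q) (hfin.mem_toFinset.2 hmem)
  have hm2 := hnot.2 (j q) (hfin.mem_toFinset.2 hmem)
  have hr := hrS _ hmem
  have hrq := hrj _ hmem
  have e1 := hle (j q) n ω q hq _ hr rfl hrq
  have e2 : ‖L (rep (j q)) - L q‖ ≤ ℓ (j q) :=
    norm_sub_le_of_tendstoInMeasure (hT _ hr) (hT _ hq) (hD (j q)) fun n ω =>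
      hle (j q) n ω _ hr q hq hrq rfl
  have e3 : T n q ω - L q = (T n q ω - T n (rep (j q)) ω) + (T n (rep (j q)) ω - L (rep (j q))) +
    (L (rep (j q)) - L q) := by abel
  have e4 := norm_add₃_le (a := T n q ω - T n (rep (j q)) ω) (b := T n (rep (j q)) ω - L (rep (j q)))
    (c := L (rep (j q)) - L q)
  rw [← e3] at e4
  have e5 := (abs_lt.1 hm2).2
  have e6 := hℓ (j q)
  linarith

theorem HasSmallOscillation.bounded (hL : HasSmallOscillation S L) : ∃ B, 0 ≤ B ∧ ∀ q ∈ S, ‖L q‖ ≤ B := by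
  obtain ⟨j, hj, hfin, hosc⟩ := hL 1 one_pos
  rcases S.eq_empty_or_nonempty with rfl | ⟨q₀, -⟩
  · exact ⟨0, le_rfl, by simp⟩
  have : Nonempty I := ⟨q₀⟩
  have hrep : ∀ c ∈ j '' S, ∃ q ∈ S, j q = c := fun c hc => hc
  choose! rep hrS hrj using hrep
  refine ⟨∑ c ∈ hfin.toFinset, ‖L (rep c)‖ + 1, by positivity, fun q hq => ?_⟩
  have hmem : j q ∈ j '' S := ⟨q, hq, rfl⟩
  have h1 := hosc q hq _ (hrS _ hmem) (hrj _ hmem).symm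
  have h2 : ‖L (rep (j q))‖ ≤ ∑ c ∈ hfin.toFinset, ‖L (rep c)‖ :=
    Finset.single_le_sum (f := fun c => ‖L (rep c)‖) (fun _ _ => norm_nonneg _) (hfin.mem_toFinset.2 hmem)
  have h3 := norm_le_norm_add_norm_sub (L (rep (j q))) (L q)
  rw [norm_sub_rev] at h3
  linarith

/-- Weights need not be jointly measurable in their two arguments. Measurability of the limit is
recovered by approximating it uniformly by functions that are constant on cells. -/
theorem HasSmallOscillation.aemeasurable [MeasurableSpace F] [BorelSpace F] (hL : HasSmallOscillation S L)
    {Q : Measure I} (hS : ∀ᵐ v ∂Q, v ∈ S) : AEMeasurable L Q := by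
  have hstep : ∀ m : ℕ, ∃ G : I → F, Measurable G ∧ ∀ v ∈ S, ‖G v - L v‖ ≤ 1 / ((m : ℝ) + 1) := by
    intro m
    obtain ⟨j, hj, hfin, hosc⟩ := hL (1 / ((m : ℝ) + 1)) (by positivity)
    rcases S.eq_empty_or_nonempty with rfl | ⟨q₀, -⟩
    · exact ⟨fun _ => 0, measurable_const, by simp⟩
    have : Nonempty I := ⟨q₀⟩
    have hrep : ∀ c ∈ j '' S, ∃ q ∈ S, j q = c := fun c hc => hc
    choose! rep hrS hrj using hrep
    refine ⟨fun v => L (rep (j v)), (Measurable.of_discrete (f := fun c : ℕ => L (rep c))).comp hj,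
      fun v hv => ?_⟩
    have hmem : j v ∈ j '' S := ⟨v, hv, rfl⟩
    exact hosc _ (hrS _ hmem) v hv (hrj _ hmem)
  choose G hGm hG using hstep
  refine aemeasurable_of_tendsto_metrizable_ae' (fun m => (hGm m).aemeasurable) (hS.mono fun v hv => ?_)
  rw [tendsto_iff_norm_sub_tendsto_zero]
  exact squeeze_zero (fun _ => norm_nonneg _) (fun m => hG m v hv) tendsto_one_div_add_atTop_nhds_zero_nat

/-- Convergence of suprema. -/
theorem UniformInProbability.tendstoInMeasure_iSup (hT : UniformInProbability μ S T L) (hS : S.Nonempty)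
    {B : ℝ} (hB : ∀ q ∈ S, ‖L q‖ ≤ B) :
    TendstoInMeasure μ (fun n ω => ⨆ q : S, ‖T n q ω‖) atTop fun _ => ⨆ q : S, ‖L q‖ := by
  have : Nonempty S := hS.to_subtype
  rw [tendstoInMeasure_iff_norm]
  intro ε hε
  refine tendsto_measure_zero_of_eventually_subset (hT (ε / 2) (by positivity)) (.of_forall fun n ω hω => ?_)
  by_contra hnot
  simp only [Set.mem_ofPred_eq, not_exists, not_and, not_le] at hnot hω
  have hbL : BddAbove (Set.range fun q : S => ‖L q‖) := ⟨B, by rintro _ ⟨q, rfl⟩; exact hB q q.2⟩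
  have h1 : ∀ q : S, ‖T n q ω‖ ≤ ‖L q‖ + ε / 2 := fun q => by
    have := norm_le_norm_add_norm_sub (L q) (T n q ω)
    rw [norm_sub_rev] at this
    linarith [hnot q q.2]
  have h2 : ∀ q : S, ‖L q‖ ≤ ‖T n q ω‖ + ε / 2 := fun q => by
    have := norm_le_norm_add_norm_sub' (L q) (T n q ω)
    rw [norm_sub_rev] at this
    linarith [hnot q q.2]
  -- Boundedness is needed because the real supremum of an unbounded family defaults to `0`.
  have hbT : BddAbove (Set.range fun q : S => ‖T n q ω‖) :=
    ⟨B + ε / 2, by rintro _ ⟨q, rfl⟩; exact (h1 q).trans (by linarith [hB q q.2])⟩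
  have h3 : ⨆ q : S, ‖T n q ω‖ ≤ (⨆ q : S, ‖L q‖) + ε / 2 :=
    ciSup_le fun q => (h1 q).trans (by linarith [le_ciSup hbL q])
  have h4 : ⨆ q : S, ‖L q‖ ≤ (⨆ q : S, ‖T n q ω‖) + ε / 2 :=
    ciSup_le fun q => (h2 q).trans (by linarith [le_ciSup hbT q])
  have h5 : ‖(⨆ q : S, ‖T n q ω‖) - ⨆ q : S, ‖L q‖‖ ≤ ε / 2 := by
    rw [Real.norm_eq_abs, abs_le]; constructor <;> linarith
  linarith

variable {V : ℤ → Ω → I} {Q : Measure I} {a : ℕ → ℝ}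

theorem MixingSequence.tendstoInMeasure_avg (hV : MixingSequence μ V Q a) {f : I → ℝ} (hf : Measurable f)
    {A : ℝ} (hA : ∀ x, |f x| ≤ A) :
    TendstoInMeasure μ (fun n => MixingSequence.avg V n f) atTop fun _ => ∫ x, f x ∂Q := by
  refine tendstoInMeasure_of_tendsto_eLpNorm one_ne_zero
    (fun n => (hV.measurable_avg n hf).aestronglyMeasurable) aestronglyMeasurable_const ?_
  set f' : I → ℝ := fun x => (|A| + 1)⁻¹ * f x with hf'
  have hf1 : ∀ x, |f' x| ≤ 1 := fun x => by
    rw [hf', abs_mul, abs_of_pos (by positivity), inv_mul_le_iff₀ (by positivity)]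
    linarith [hA x, le_abs_self A]
  have hf'm : Measurable f' := hf.const_mul _
  have hc0 : |A| + 1 ≠ 0 := by positivity
  have hlim : Tendsto (fun n : ℕ => ENNReal.ofReal ((|A| + 1) * √(MixingSequence.total a / n))) atTop (𝓝 0) := by
    have h1 : Tendsto (fun n : ℕ => MixingSequence.total a / n) atTop (𝓝 0) :=
      tendsto_const_div_atTop_nhds_zero_nat _
    have h2 := (h1.sqrt).const_mul (|A| + 1)
    rw [Real.sqrt_zero, mul_zero] at h2
    simpa using ENNReal.tendsto_ofReal h2
  refine tendsto_of_tendsto_of_tendsto_of_le_of_le' tendsto_const_nhds hlim (.of_forall fun _ => zero_le) ?_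
  filter_upwards [eventually_gt_atTop 0] with n hn
  have h3 := hV.integral_abs_avg_sub_le hn hf'm hf1
  have e1 : ∀ ω, MixingSequence.avg V n f ω - ∫ x, f x ∂Q =
      (|A| + 1) * (MixingSequence.avg V n f' ω - ∫ x, f' x ∂Q) := fun ω => by
    simp only [MixingSequence.avg, hf', integral_const_mul, ← Finset.mul_sum]
    field_simp
  have hi : Integrable (fun ω => MixingSequence.avg V n f ω - ∫ x, f x ∂Q) μ := by
    refine integrable_of_abs_le (B := |A| + |∫ x, f x ∂Q|) ((hV.measurable_avg n hf).sub_const _) fun ω => ?_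
    refine (abs_sub _ _).trans (add_le_add_left ?_ _)
    exact MixingSequence.abs_avg_le n (abs_nonneg A) (fun x => (hA x).trans (le_abs_self A)) ω
  rw [eLpNorm_one_eq_lintegral_enorm]
  calc _ = ∫⁻ ω, ‖MixingSequence.avg V n f ω - ∫ x, f x ∂Q‖ₑ ∂μ := rfl
    _ = ENNReal.ofReal (∫ ω, ‖MixingSequence.avg V n f ω - ∫ x, f x ∂Q‖ ∂μ) :=
        (ofReal_integral_norm_eq_lintegral_enorm hi).symm
    _ ≤ _ := by
        refine ENNReal.ofReal_le_ofReal ?_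
        simp_rw [e1, norm_mul, Real.norm_eq_abs]
        rw [integral_const_mul, abs_of_pos (by positivity : 0 < |A| + 1)]
        gcongr

/-- Convergence of empirical second moments of a uniformly convergent process. -/
theorem UniformInProbability.tendstoInMeasure_avg_norm_sq (hT : UniformInProbability μ S T L)
    (hV : MixingSequence μ V Q a) (hS : ∀ᵐ v ∂Q, v ∈ S) {B : ℝ} (hB0 : 0 ≤ B)
    (hB : ∀ q ∈ S, ‖L q‖ ≤ B) (hLm : AEMeasurable (fun v => ‖L v‖) Q) :
    TendstoInMeasure μ (fun (n : ℕ) ω => (n : ℝ)⁻¹ * ∑ t ∈ Finset.Icc (1 : ℤ) n, ‖T n (V t ω) ω‖ ^ 2) atTop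
      fun _ => ∫ v, ‖L v‖ ^ 2 ∂Q := by
  set g₀ := hLm.mk with hg₀
  -- A measurable version of `‖L‖²`, truncated so as to be bounded everywhere, as the law of large
  -- numbers requires; it agrees with `‖L‖²` along almost every trajectory.
  set g : I → ℝ := fun v => (max 0 (min B (g₀ v))) ^ 2 with hg
  have hgm : Measurable g := by have := hLm.measurable_mk; fun_prop
  have hgB : ∀ v, |g v| ≤ B ^ 2 := fun v => by
    rw [hg, abs_of_nonneg (sq_nonneg _)]
    exact pow_le_pow_left₀ (le_max_left _ _) (max_le hB0 (min_le_left _ _)) 2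
  have hgL : ∀ᵐ v ∂Q, v ∈ S ∧ g v = ‖L v‖ ^ 2 := by
    filter_upwards [hLm.ae_eq_mk, hS] with v hv hvS
    refine ⟨hvS, ?_⟩
    rw [hg]
    simp only [hg₀, ← hv]
    rw [min_eq_right (hB v hvS), max_eq_right (norm_nonneg _)]
  have hint : ∫ v, ‖L v‖ ^ 2 ∂Q = ∫ v, g v ∂Q := integral_congr_ae (hgL.mono fun v hv => hv.2.symm)
  have hVt : ∀ᵐ ω ∂μ, ∀ t, V t ω ∈ S ∧ g (V t ω) = ‖L (V t ω)‖ ^ 2 := by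
    rw [ae_all_iff]
    intro t
    rw [← hV.map_eq t] at hgL
    exact ae_of_ae_map (hV.measurable t).aemeasurable hgL
  have hnull : Tendsto (fun _ : ℕ => μ {ω | ¬ ∀ t, V t ω ∈ S ∧ g (V t ω) = ‖L (V t ω)‖ ^ 2}) atTop (𝓝 0) := by
    rw [ae_iff.1 hVt]; exact tendsto_const_nhds
  have hlln := tendstoInMeasure_iff_norm.1 (hV.tendstoInMeasure_avg hgm hgB)
  rw [tendstoInMeasure_iff_norm, hint]
  intro ε hε
  -- If two norms differ by at most `δ ≤ 1`, and the second is at most `B`, then their squares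
  -- differ by at most `(2B + 1) δ ≤ ε / 2`.
  set δ := min 1 (ε / (4 * (B + 1))) with hδ
  have hδ0 : 0 < δ := lt_min one_pos (by positivity)
  refine tendsto_measure_zero_of_eventually_subset
    (tendsto_measure_union_zero (tendsto_measure_union_zero (hT δ hδ0) hnull) (hlln (ε / 3) (by positivity))) ?_
  filter_upwards [eventually_gt_atTop 0] with n hn ω hω
  by_contra hnot
  simp only [Set.mem_union, Set.mem_ofPred_eq, not_or, not_not, not_le, not_exists, not_and] at hnot hω
  obtain ⟨⟨h1, h2⟩, h3⟩ := hnot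
  have hpt : ∀ t, |‖T n (V t ω) ω‖ ^ 2 - g (V t ω)| ≤ ε / 2 := fun t => by
    obtain ⟨hS, hgt⟩ := h2 t
    rw [hgt]
    have k1 := h1 _ hS
    have k2 := abs_norm_sub_norm_le (T n (V t ω) ω) (L (V t ω))
    have k3 := hB _ hS
    have k4 : δ ≤ 1 := min_le_left _ _
    have k5 : δ * (4 * (B + 1)) ≤ ε := by
      rw [← le_div_iff₀ (by positivity)]; exact min_le_right _ _
    have k6 : |‖T n (V t ω) ω‖ - ‖L (V t ω)‖| ≤ δ := k2.trans k1.le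
    have k7 : |‖T n (V t ω) ω‖ + ‖L (V t ω)‖| ≤ 2 * B + 1 := by
      rw [abs_of_nonneg (by positivity)]
      have := (abs_le.1 k6).2
      linarith
    rw [sq_sub_sq, abs_mul]
    calc _ ≤ (2 * B + 1) * δ := mul_le_mul k7 k6 (abs_nonneg _) (by positivity)
      _ ≤ _ := by nlinarith
  have hdiff : |(n : ℝ)⁻¹ * ∑ t ∈ Finset.Icc (1 : ℤ) n, ‖T n (V t ω) ω‖ ^ 2 - MixingSequence.avg V n g ω| ≤ ε / 2 := by
    rw [MixingSequence.avg, ← mul_sub, ← Finset.sum_sub_distrib, abs_mul, abs_of_nonneg (by positivity),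
      inv_mul_le_iff₀ (by positivity)]
    refine (Finset.abs_sum_le_sum_abs _ _).trans ((Finset.sum_le_card_nsmul _ _ _ fun t _ => hpt t).trans_eq ?_)
    simp
  rw [Real.norm_eq_abs] at h3 hω
  have := abs_sub_le ((n : ℝ)⁻¹ * ∑ t ∈ Finset.Icc (1 : ℤ) n, ‖T n (V t ω) ω‖ ^ 2) (MixingSequence.avg V n g ω)
    (∫ v, g v ∂Q)
  linarith

end InProbability

/-! ### Quantile cells -/

section Cells

/-- The index of the quantile cell of `x`, among `N` cells of equal probability. -/
def quantileCell (m : Measure ℝ) (N : ℕ) (x : ℝ) : ℤ := ⌊(N : ℝ) * cdf m x⌋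

theorem monotone_quantileCell (m : Measure ℝ) (N : ℕ) : Monotone (quantileCell m N) := fun x y hxy =>
  Int.floor_mono (mul_le_mul_of_nonneg_left (monotone_cdf m hxy) (by positivity))

theorem measurable_quantileCell (m : Measure ℝ) (N : ℕ) : Measurable (quantileCell m N) :=
  Int.measurable_floor.comp ((monotone_cdf m).measurable.const_mul _)

theorem quantileCell_mem (m : Measure ℝ) (N : ℕ) (x : ℝ) : quantileCell m N x ∈ Set.Icc (0 : ℤ) N := by
  have h0 := cdf_nonneg m x
  have h1 := cdf_le_one m x
  constructor
  · exact Int.floor_nonneg.2 (by positivity)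
  · have : (N : ℝ) * cdf m x ≤ N := mul_le_of_le_one_right (by positivity) h1
    have h2 := Int.floor_mono this
    rwa [Int.floor_natCast] at h2

/-- By inner regularity it is enough to bound compact subsets of the cell. Such a set lies between
its least and greatest elements `a`, `b`; without atoms `[a, b]` has measure `F(b) - F(a)`, and both
values of `N F` have the same integer part. -/
theorem measure_quantileCell_le (m : Measure ℝ) [IsProbabilityMeasure m] [NullSingletonClass m] {N : ℕ} (hN : 0 < N)
    (k : ℤ) : m.real {x | quantileCell m N x = k} ≤ (N : ℝ)⁻¹ := by
  have hms : MeasurableSet {x | quantileCell m N x = k} :=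
    measurable_quantileCell m N (measurableSet_singleton k)
  refine ENNReal.toReal_le_of_le_ofReal (by positivity) ?_
  rw [hms.measure_eq_iSup_isCompact]
  refine iSup_le fun C => iSup_le fun hC => iSup_le fun hcomp => ?_
  rcases C.eq_empty_or_nonempty with rfl | hne
  · simp
  obtain ⟨a, ha⟩ := hcomp.exists_isLeast hne
  obtain ⟨b, hb⟩ := hcomp.exists_isGreatest hne
  have hab : a ≤ b := ha.2 hb.1
  have hsub : C ⊆ Set.Icc a b := fun x hx => ⟨ha.2 hx, hb.2 hx⟩
  refine (measure_mono hsub).trans ?_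
  rw [← Ioc_ae_eq_Icc.measure_eq]
  conv_lhs => rw [← measure_cdf m]
  rw [StieltjesFunction.measure_Ioc]
  refine ENNReal.ofReal_le_ofReal ?_
  have h1 : ⌊(N : ℝ) * cdf m a⌋ = k := hC ha.1
  have h2 : ⌊(N : ℝ) * cdf m b⌋ = k := hC hb.1
  have h3 := Int.floor_le ((N : ℝ) * cdf m a)
  have h4 := Int.lt_floor_add_one ((N : ℝ) * cdf m b)
  rw [h1] at h3
  rw [h2] at h4
  rw [← one_div, le_div_iff₀ (by positivity)]
  linarith

theorem abs_ind_le {d : ℕ} (a b : Fin d → ℝ) : |ind a b| ≤ 1 := by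
  unfold ind; split_ifs <;> simp

theorem ind_nonneg {d : ℕ} (a b : Fin d → ℝ) : 0 ≤ ind a b := by
  unfold ind; split_ifs <;> simp

theorem measurable_ind {d : ℕ} (b : Fin d → ℝ) : Measurable fun a : Fin d → ℝ => ind a b :=
  Measurable.ite measurableSet_Iic measurable_const measurable_const

/-- If `a` is below one of `y`, `y'` but not the other, then some coordinate of `a` lies between
those of `y` and `y'`, hence in their common cell by monotonicity. -/
theorem abs_ind_sub_le {d : ℕ} {c : Fin d → ℝ → ℤ} (hc : ∀ i, Monotone (c i)) {y y' : Fin d → ℝ}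
    {k : Fin d → ℤ} (hy : ∀ i, c i (y i) = k i) (hy' : ∀ i, c i (y' i) = k i) (a : Fin d → ℝ) :
    |ind a y - ind a y'| ≤ ∑ i, if c i (a i) = k i then (1 : ℝ) else 0 := by
  have key : ∀ y y' : Fin d → ℝ, (∀ i, c i (y i) = k i) → (∀ i, c i (y' i) = k i) → a ≤ y → ¬ a ≤ y' →
      1 ≤ ∑ i, if c i (a i) = k i then (1 : ℝ) else 0 := by
    intro y y' hy hy' h h'
    rw [Pi.le_def] at h'
    push Not at h'
    obtain ⟨i, hi⟩ := h'
    have h1 : c i (a i) = k i :=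
      le_antisymm ((hc i (h i)).trans_eq (hy i)) ((hy' i).symm.trans_le (hc i hi.le))
    have h2 := Finset.single_le_sum (f := fun i => if c i (a i) = k i then (1 : ℝ) else 0)
      (fun i _ => by split_ifs <;> simp) (Finset.mem_univ i)
    simpa [h1] using h2
  unfold ind
  by_cases h : a ≤ y <;> by_cases h' : a ≤ y'
  · simp [h, h']
  · simpa [h, h'] using key y y' hy hy' h h'
  · simpa [h, h'] using key y' y hy' hy h' h
  · simp [h, h']

end Cells

/-! ### The process as a pair average, and its oscillation -/

section IndependenceStatistic

variable {Ω ι 𝕜 : Type*} [MeasurableSpace Ω] [Fintype ι] [RCLike 𝕜] {dy dz : ℕ}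

/-- The space of the observations `(W_t, Y_t, Z_t)`. -/
abbrev ObsSpace (ι : Type*) (dy dz : ℕ) : Type _ := (ι → ℝ) × ((Fin dy → ℝ) × (Fin dz → ℝ))

/-- The summands of the statistic, at the point `q = (w, y, z)`. -/
def summand (φ : (ι → ℝ) → (ι → ℝ) → 𝕜) (q x x' : ObsSpace ι dy dz) : 𝕜 :=
  (ind x.2.1 q.2.1 * (ind x.2.2 q.2.2 - ind x'.2.2 q.2.2)) • φ x.1 q.1

/-- The normalized process `n^{-1/2} S_n`. -/
def indepStat (V : ℤ → Ω → ObsSpace ι dy dz) (K : (ι → ℝ) → ℝ) (h : ℕ → ℝ)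
    (φ : (ι → ℝ) → (ι → ℝ) → 𝕜) (n : ℕ) (q : ObsSpace ι dy dz) (ω : Ω) : 𝕜 :=
  ((n : ℝ) / ((n : ℝ) - 1)) • ((n : ℝ) ^ 2)⁻¹ • ∑ t ∈ Finset.Icc (1 : ℤ) n,
    ∑ s ∈ (Finset.Icc (1 : ℤ) n).erase t,
      scaledKernel Prod.fst K (h n) (V t ω) (V s ω) • summand φ q (V t ω) (V s ω)

theorem div_sub_one_nonneg (n : ℕ) : 0 ≤ (n : ℝ) / ((n : ℝ) - 1) := by
  rcases n.eq_zero_or_pos with rfl | hn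
  · simp
  · have : (1 : ℝ) ≤ n := by exact_mod_cast hn
    exact div_nonneg (by positivity) (by linarith)

theorem tendsto_div_sub_one : Tendsto (fun n : ℕ => (n : ℝ) / ((n : ℝ) - 1)) atTop (𝓝 1) := by
  have h1 : Tendsto (fun n : ℕ => (1 : ℝ) / (1 - (n : ℝ)⁻¹)) atTop (𝓝 (1 / (1 - 0))) :=
    (tendsto_const_nhds).div (tendsto_const_nhds.sub tendsto_inv_atTop_nhds_zero_nat) (by norm_num)
  rw [sub_zero, div_one] at h1
  refine h1.congr' ?_
  filter_upwards [eventually_gt_atTop 1] with n hn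
  have h2 : (1 : ℝ) < n := by exact_mod_cast hn
  have : (n : ℝ) - 1 ≠ 0 := by linarith
  have : (1 : ℝ) - (n : ℝ)⁻¹ ≠ 0 := by
    have : (n : ℝ)⁻¹ < 1 := inv_lt_one_of_one_lt₀ h2
    linarith
  field_simp

variable {V : ℤ → Ω → ObsSpace ι dy dz} {K : (ι → ℝ) → ℝ} {h : ℕ → ℝ} {φ : (ι → ℝ) → (ι → ℝ) → 𝕜}

theorem norm_indepStat_sub_le (hh : ∀ n, 0 < h n) (n : ℕ) (q q' : ObsSpace ι dy dz)
    {e : ObsSpace ι dy dz → ℝ} (he : ∀ x x', ‖summand φ q x x' - summand φ q' x x'‖ ≤ e x + e x') (ω : Ω) :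
    ‖indepStat V K h φ n q ω - indepStat V K h φ n q' ω‖ ≤ ((n : ℝ) / ((n : ℝ) - 1)) *
      (pairAvg V n (fun x x' => scaledKernel Prod.fst (fun u => |K u|) (h n) x x' * (e x * 1)) ω +
       pairAvg V n (fun x x' => scaledKernel Prod.fst (fun u => |K u|) (h n) x x' * (1 * e x')) ω) := by
  unfold indepStat
  rw [← smul_sub, ← smul_sub, ← Finset.sum_sub_distrib, norm_smul, norm_smul,
    Real.norm_of_nonneg (div_sub_one_nonneg n), Real.norm_of_nonneg (by positivity), ← pairAvg_add]
  refine mul_le_mul_of_nonneg_left ?_ (div_sub_one_nonneg n)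
  unfold pairAvg
  refine mul_le_mul_of_nonneg_left ?_ (by positivity)
  refine (norm_sum_le _ _).trans (Finset.sum_le_sum fun t _ => ?_)
  rw [← Finset.sum_sub_distrib]
  refine (norm_sum_le _ _).trans (Finset.sum_le_sum fun s _ => ?_)
  rw [← smul_sub, norm_smul]
  have h1 := he (V t ω) (V s ω)
  have h2 : ‖scaledKernel Prod.fst K (h n) (V t ω) (V s ω)‖ =
      scaledKernel Prod.fst (fun u => |K u|) (h n) (V t ω) (V s ω) := by
    unfold scaledKernel
    rw [norm_mul, Real.norm_of_nonneg (by have := hh n; positivity), Real.norm_eq_abs]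
  have h3 : 0 ≤ scaledKernel Prod.fst (fun u => |K u|) (h n) (V t ω) (V s ω) := h2 ▸ norm_nonneg _
  rw [h2]
  calc _ ≤ _ := mul_le_mul_of_nonneg_left h1 h3
    _ = _ := by ring

/-- Uniform boundedness and Hölder continuity of the weights `φ(·, w)`, `w ∈ 𝒲`. -/
structure RegularWeights (P : Measure (ι → ℝ)) (𝒲 : Set (ι → ℝ)) (φ : (ι → ℝ) → (ι → ℝ) → 𝕜)
    (B : ℝ) (C : (ι → ℝ) → ℝ) (ν : ℝ) : Prop where
  measurable : ∀ w ∈ 𝒲, Measurable fun u => φ u w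
  bound_nonneg : 0 ≤ B
  bound : ∀ u, ∀ w ∈ 𝒲, ‖φ u w‖ ≤ B
  exponent_pos : 0 < ν
  measurable_const : Measurable C
  const_nonneg : ∀ u, 0 ≤ C u
  integrable_const : Integrable C P
  holder : ∀ u, ∀ w ∈ 𝒲, ∀ w' ∈ 𝒲, ‖φ u w - φ u w'‖ ≤ C u * ‖w - w'‖ ^ ν

/-- A bound for the oscillation of the summands over a cell. -/
def cellBound (B ρ ν : ℝ) (C : (ι → ℝ) → ℝ) (cY : Fin dy → ℝ → ℤ) (cZ : Fin dz → ℝ → ℤ)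
    (kY : Fin dy → ℤ) (kZ : Fin dz → ℤ) (x : ObsSpace ι dy dz) : ℝ :=
  min (2 * B) (C x.1 * ρ ^ ν) + B * (∑ i, if cY i (x.2.1 i) = kY i then (1 : ℝ) else 0) +
    B * (∑ i, if cZ i (x.2.2 i) = kZ i then (1 : ℝ) else 0)

/-- The weight, the indicator of `Y` and the difference of indicators of `Z` are changed one at a
time. The bound is a function of `x` plus the same function of `x'`, so that kernel pair averages of
it are of the decoupled form. -/
theorem norm_summand_sub_le {P : Measure (ι → ℝ)} {𝒲 : Set (ι → ℝ)} {B ν ρ : ℝ} {C : (ι → ℝ) → ℝ}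
    (hφ : RegularWeights P 𝒲 φ B C ν)
    {cY : Fin dy → ℝ → ℤ} {cZ : Fin dz → ℝ → ℤ} (hcY : ∀ i, Monotone (cY i)) (hcZ : ∀ i, Monotone (cZ i))
    {kY : Fin dy → ℤ} {kZ : Fin dz → ℤ} {q q' : ObsSpace ι dy dz} (hq : q.1 ∈ 𝒲) (hq' : q'.1 ∈ 𝒲)
    (hw : ‖q.1 - q'.1‖ ≤ ρ) (hy : ∀ i, cY i (q.2.1 i) = kY i) (hy' : ∀ i, cY i (q'.2.1 i) = kY i)
    (hz : ∀ i, cZ i (q.2.2 i) = kZ i) (hz' : ∀ i, cZ i (q'.2.2 i) = kZ i) (x x' : ObsSpace ι dy dz) :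
    ‖summand φ q x x' - summand φ q' x x'‖ ≤
      cellBound B ρ ν C cY cZ kY kZ x + cellBound B ρ ν C cY cZ kY kZ x' := by
  have hB := hφ.bound_nonneg
  have hρ : 0 ≤ ρ := (norm_nonneg _).trans hw
  have hψ0 : ∀ x : ObsSpace ι dy dz, 0 ≤ min (2 * B) (C x.1 * ρ ^ ν) := fun x =>
    le_min (by positivity) (mul_nonneg (hφ.const_nonneg _) (by positivity))
  have hφd : ‖φ x.1 q.1 - φ x.1 q'.1‖ ≤ min (2 * B) (C x.1 * ρ ^ ν) := by
    refine le_min ?_ ?_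
    · refine (norm_sub_le _ _).trans ?_
      linarith [hφ.bound x.1 _ hq, hφ.bound x.1 _ hq']
    · refine (hφ.holder x.1 _ hq _ hq').trans ?_
      have := hφ.const_nonneg x.1
      gcongr
      exact hφ.exponent_pos.le
  have hY := abs_ind_sub_le hcY hy hy' x.2.1
  have hZ := abs_ind_sub_le hcZ hz hz' x.2.2
  have hZ' := abs_ind_sub_le hcZ hz hz' x'.2.2
  have hY'0 : (0 : ℝ) ≤ ∑ i, if cY i (x'.2.1 i) = kY i then (1 : ℝ) else 0 :=
    Finset.sum_nonneg fun i _ => by split_ifs <;> simp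
  set sY := ∑ i, if cY i (x.2.1 i) = kY i then (1 : ℝ) else 0 with hsY
  set sZ := ∑ i, if cZ i (x.2.2 i) = kZ i then (1 : ℝ) else 0 with hsZ
  set sZ' := ∑ i, if cZ i (x'.2.2 i) = kZ i then (1 : ℝ) else 0 with hsZ'
  set A := ind x.2.1 q.2.1 with hA
  set A' := ind x.2.1 q'.2.1 with hA'
  set b := ind x.2.2 q.2.2 - ind x'.2.2 q.2.2 with hb
  set b' := ind x.2.2 q'.2.2 - ind x'.2.2 q'.2.2 with hb'
  have hAle : |A| ≤ 1 := abs_ind_le _ _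
  have hA'le : |A'| ≤ 1 := abs_ind_le _ _
  have hble : |b| ≤ 1 := by
    have h1 := ind_nonneg x.2.2 q.2.2
    have h2 := ind_nonneg x'.2.2 q.2.2
    have h3 := (abs_le.1 (abs_ind_le x.2.2 q.2.2)).2
    have h4 := (abs_le.1 (abs_ind_le x'.2.2 q.2.2)).2
    rw [hb, abs_le]; constructor <;> linarith
  have hbb : |b - b'| ≤ sZ + sZ' := by
    have : b - b' = (ind x.2.2 q.2.2 - ind x.2.2 q'.2.2) - (ind x'.2.2 q.2.2 - ind x'.2.2 q'.2.2) := by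
      rw [hb, hb']; ring
    rw [this]
    exact (abs_sub _ _).trans (add_le_add hZ hZ')
  have e : summand φ q x x' - summand φ q' x x' = (A * b) • (φ x.1 q.1 - φ x.1 q'.1) +
      ((A - A') * b + A' * (b - b')) • φ x.1 q'.1 := by
    unfold summand
    module
  rw [e]
  have h1 : ‖(A * b) • (φ x.1 q.1 - φ x.1 q'.1)‖ ≤ min (2 * B) (C x.1 * ρ ^ ν) := by
    rw [norm_smul, Real.norm_eq_abs, abs_mul]
    calc _ ≤ 1 * min (2 * B) (C x.1 * ρ ^ ν) :=
          mul_le_mul (mul_le_one₀ hAle (abs_nonneg _) hble) hφd (norm_nonneg _) zero_le_one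
      _ = _ := one_mul _
  have h2 : ‖((A - A') * b + A' * (b - b')) • φ x.1 q'.1‖ ≤ (sY + (sZ + sZ')) * B := by
    rw [norm_smul, Real.norm_eq_abs]
    refine mul_le_mul ((abs_add_le _ _).trans (add_le_add ?_ ?_)) (hφ.bound _ _ hq') (norm_nonneg _) ?_
    · rw [abs_mul]
      calc _ ≤ sY * 1 := mul_le_mul hY hble (abs_nonneg _) ((abs_nonneg _).trans hY)
        _ = sY := mul_one _
    · rw [abs_mul]
      calc _ ≤ 1 * (sZ + sZ') := mul_le_mul hA'le hbb (abs_nonneg _) zero_le_one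
        _ = _ := one_mul _
    · have := (abs_nonneg _).trans hY
      have := (abs_nonneg _).trans hbb
      linarith
  refine (norm_add_le _ _).trans ((add_le_add h1 h2).trans ?_)
  unfold cellBound
  have h3 := hψ0 x'
  have h4 := mul_nonneg hB hY'0
  rw [← hsY, ← hsZ, ← hsZ']
  nlinarith

end IndependenceStatistic

/-! ### Finite partitions for the process -/

section Brackets

variable {Ω ι 𝕜 : Type*} [MeasurableSpace Ω] [Fintype ι] [RCLike 𝕜] {dy dz : ℕ}

/-- The cell of a point `(w, y, z)`: a cube for `w`, quantile cells for the coordinates of `y`, `z`. -/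
def obsCell (ρ : ℝ) (cY : Fin dy → ℝ → ℤ) (cZ : Fin dz → ℝ → ℤ) (x : ObsSpace ι dy dz) :
    (ι → ℤ) × (Fin dy → ℤ) × (Fin dz → ℤ) :=
  (fun i => ⌊x.1 i / ρ⌋, fun i => cY i (x.2.1 i), fun i => cZ i (x.2.2 i))

theorem measurable_obsCell (ρ : ℝ) {cY : Fin dy → ℝ → ℤ} {cZ : Fin dz → ℝ → ℤ}
    (hcY : ∀ i, Measurable (cY i)) (hcZ : ∀ i, Measurable (cZ i)) :
    Measurable (obsCell (ι := ι) ρ cY cZ) := by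
  unfold obsCell
  refine Measurable.prodMk ?_ (Measurable.prodMk ?_ ?_)
  · exact measurable_pi_lambda _ fun i => Int.measurable_floor.comp (by fun_prop)
  · exact measurable_pi_lambda _ fun i => (hcY i).comp (by fun_prop)
  · exact measurable_pi_lambda _ fun i => (hcZ i).comp (by fun_prop)

theorem finite_image_obsCell {ρ : ℝ} (hρ : 0 < ρ) {cY : Fin dy → ℝ → ℤ} {cZ : Fin dz → ℝ → ℤ} {N : ℕ}
    (hcY : ∀ i x, cY i x ∈ Set.Icc (0 : ℤ) N) (hcZ : ∀ i x, cZ i x ∈ Set.Icc (0 : ℤ) N)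
    {𝒲 : Set (ι → ℝ)} (h𝒲 : Bornology.IsBounded 𝒲) :
    (obsCell ρ cY cZ '' (𝒲 ×ˢ Set.univ)).Finite := by
  obtain ⟨R, hR⟩ := h𝒲.exists_norm_le
  refine Set.Finite.subset ((Set.Finite.pi fun _ : ι => Set.finite_Icc ⌊-R / ρ⌋ ⌊R / ρ⌋).prod
    ((Set.Finite.pi fun _ : Fin dy => Set.finite_Icc (0 : ℤ) N).prod
      (Set.Finite.pi fun _ : Fin dz => Set.finite_Icc (0 : ℤ) N))) ?_
  rintro _ ⟨x, hx, rfl⟩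
  refine ⟨fun i _ => ?_, fun i _ => hcY i _, fun i _ => hcZ i _⟩
  have h1 := abs_le.1 ((norm_le_pi_norm x.1 i).trans (hR x.1 hx.1))
  exact ⟨Int.floor_mono (by gcongr; exact h1.1), Int.floor_mono (by gcongr; exact h1.2)⟩

theorem norm_sub_le_of_obsCell_eq {ρ : ℝ} (hρ : 0 < ρ) {cY : Fin dy → ℝ → ℤ} {cZ : Fin dz → ℝ → ℤ}
    {x x' : ObsSpace ι dy dz} (hx : obsCell ρ cY cZ x = obsCell ρ cY cZ x') : ‖x.1 - x'.1‖ ≤ ρ := by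
  refine (pi_norm_le_iff_of_nonneg hρ.le).2 fun i => ?_
  have h1 : ⌊x.1 i / ρ⌋ = ⌊x'.1 i / ρ⌋ := congrFun (congrArg Prod.fst hx) i
  have h2 := (Int.abs_sub_lt_one_of_floor_eq_floor h1).le
  rw [← sub_div, abs_div, abs_of_pos hρ, div_le_one hρ] at h2
  exact h2

variable {P : Measure (ι → ℝ)} {κ : Kernel (ι → ℝ) ((Fin dy → ℝ) × (Fin dz → ℝ))}
  {φ : (ι → ℝ) → (ι → ℝ) → 𝕜} {𝒲 : Set (ι → ℝ)} {B ν ρ : ℝ} {C : (ι → ℝ) → ℝ}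

theorem measurable_cellBound (hC : Measurable C) {cY : Fin dy → ℝ → ℤ} {cZ : Fin dz → ℝ → ℤ}
    (hcY : ∀ i, Measurable (cY i)) (hcZ : ∀ i, Measurable (cZ i)) (kY : Fin dy → ℤ) (kZ : Fin dz → ℤ) :
    Measurable (cellBound (ι := ι) B ρ ν C cY cZ kY kZ) := by
  have hm : ∀ {d : ℕ} {c : Fin d → ℝ → ℤ} (_ : ∀ i, Measurable (c i)) (k : Fin d → ℤ),
      Measurable fun y : Fin d → ℝ => ∑ i, if c i (y i) = k i then (1 : ℝ) else 0 := by
    intro d c hc k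
    refine Finset.measurable_fun_sum _ fun i _ => Measurable.ite ?_ measurable_const measurable_const
    exact ((hc i).comp (measurable_pi_apply i)) (measurableSet_singleton (k i))
  unfold cellBound
  have h1 : Measurable fun x : ObsSpace ι dy dz => ∑ i, if cY i (x.2.1 i) = kY i then (1 : ℝ) else 0 :=
    (hm hcY kY).comp (by fun_prop)
  have h2 : Measurable fun x : ObsSpace ι dy dz => ∑ i, if cZ i (x.2.2 i) = kZ i then (1 : ℝ) else 0 :=
    (hm hcZ kZ).comp (by fun_prop)
  exact (((measurable_const.min ((hC.comp measurable_fst).mul_const _)).add (h1.const_mul B))).add (h2.const_mul B)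

theorem sum_ite_nonneg {d : ℕ} (c : Fin d → ℝ → ℤ) (k : Fin d → ℤ) (y : Fin d → ℝ) :
    0 ≤ ∑ i, if c i (y i) = k i then (1 : ℝ) else 0 :=
  Finset.sum_nonneg fun i _ => by split_ifs <;> simp

theorem sum_ite_le {d : ℕ} (c : Fin d → ℝ → ℤ) (k : Fin d → ℤ) (y : Fin d → ℝ) :
    (∑ i, if c i (y i) = k i then (1 : ℝ) else 0) ≤ d := by
  refine (Finset.sum_le_card_nsmul _ _ 1 fun i _ => by split_ifs <;> simp).trans ?_
  simp

theorem cellBound_nonneg (hB : 0 ≤ B) (hρ : 0 ≤ ρ) (hC : ∀ u, 0 ≤ C u) (cY : Fin dy → ℝ → ℤ)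
    (cZ : Fin dz → ℝ → ℤ) (kY : Fin dy → ℤ) (kZ : Fin dz → ℤ) (x : ObsSpace ι dy dz) :
    0 ≤ cellBound B ρ ν C cY cZ kY kZ x := by
  have h1 := sum_ite_nonneg cY kY x.2.1
  have h2 := sum_ite_nonneg cZ kZ x.2.2
  have h3 := hC x.1
  have h4 : 0 ≤ min (2 * B) (C x.1 * ρ ^ ν) := le_min (by positivity) (by positivity)
  unfold cellBound
  positivity

theorem cellBound_le (hB : 0 ≤ B) (cY : Fin dy → ℝ → ℤ)
    (cZ : Fin dz → ℝ → ℤ) (kY : Fin dy → ℤ) (kZ : Fin dz → ℤ) (x : ObsSpace ι dy dz) :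
    cellBound B ρ ν C cY cZ kY kZ x ≤ 2 * B + B * dy + B * dz := by
  unfold cellBound
  gcongr
  · exact min_le_left _ _
  · exact sum_ite_le _ _ _
  · exact sum_ite_le _ _ _

theorem integral_sum_ite_le {E : Type*} [MeasurableSpace E] {Q : Measure E} [IsProbabilityMeasure Q] {d : ℕ}
    {N : ℕ} (hN : 0 < N) {y : E → Fin d → ℝ} (hy : Measurable y)
    (hna : ∀ i, NullSingletonClass (Q.map fun x => y x i)) (k : Fin d → ℤ) :
    ∫ x, (∑ i, if quantileCell (Q.map fun x => y x i) N (y x i) = k i then (1 : ℝ) else 0) ∂Q ≤ d * (N : ℝ)⁻¹ := by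
  have hyi : ∀ i, Measurable fun x => y x i := fun i => (measurable_pi_apply i).comp hy
  have hset : ∀ i, MeasurableSet {t | quantileCell (Q.map fun x => y x i) N t = k i} := fun i =>
    measurable_quantileCell _ N (measurableSet_singleton _)
  have hpre : ∀ i, MeasurableSet {x | quantileCell (Q.map fun x => y x i) N (y x i) = k i} := fun i =>
    hyi i (hset i)
  have e : ∀ i x, (if quantileCell (Q.map fun x => y x i) N (y x i) = k i then (1 : ℝ) else 0) =
      {x | quantileCell (Q.map fun x => y x i) N (y x i) = k i}.indicator (fun _ => 1) x := fun i x => by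
    simp [Set.indicator_apply]
  simp_rw [e]
  rw [integral_finsetSum _ fun i _ => (integrable_const 1).indicator (hpre i)]
  have h1 : ∀ i, ∫ x, {x | quantileCell (Q.map fun x => y x i) N (y x i) = k i}.indicator (fun _ => (1 : ℝ)) x ∂Q ≤
      (N : ℝ)⁻¹ := fun i => by
    have := hna i
    have : IsProbabilityMeasure (Q.map fun x => y x i) := Measure.isProbabilityMeasure_map (hyi i).aemeasurable
    rw [integral_indicator_const _ (hpre i), smul_eq_mul, mul_one]
    have := measure_quantileCell_le (Q.map fun x => y x i) hN (k i)
    rwa [map_measureReal_apply (hyi i) (hset i)] at this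
  refine (Finset.sum_le_card_nsmul _ _ _ fun i _ => h1 i).trans ?_
  simp

theorem integral_cellBound_le [IsProbabilityMeasure P] [IsMarkovKernel κ] (hφ : RegularWeights P 𝒲 φ B C ν)
    (hρ : 0 ≤ ρ) {N : ℕ} (hN : 0 < N)
    (hY : ∀ i, NullSingletonClass ((P ⊗ₘ κ).map fun x => x.2.1 i))
    (hZ : ∀ i, NullSingletonClass ((P ⊗ₘ κ).map fun x => x.2.2 i)) (kY : Fin dy → ℤ) (kZ : Fin dz → ℤ) :
    ∫ x, cellBound B ρ ν C (fun i => quantileCell ((P ⊗ₘ κ).map fun x => x.2.1 i) N)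
      (fun i => quantileCell ((P ⊗ₘ κ).map fun x => x.2.2 i) N) kY kZ x ∂(P ⊗ₘ κ) ≤
      ρ ^ ν * (∫ u, C u ∂P) + B * (dy * (N : ℝ)⁻¹) + B * (dz * (N : ℝ)⁻¹) := by
  have hm := hφ.measurable_const
  have hB := hφ.bound_nonneg
  have i1 : Integrable (fun x : ObsSpace ι dy dz => min (2 * B) (C x.1 * ρ ^ ν)) (P ⊗ₘ κ) := by
    refine integrable_of_abs_le (B := 2 * B) (by fun_prop) fun x => ?_
    have := hφ.const_nonneg x.1
    rw [abs_of_nonneg (le_min (by positivity) (by positivity))]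
    exact min_le_left _ _
  have iC : Integrable (fun x : ObsSpace ι dy dz => C x.1) (P ⊗ₘ κ) := by
    have : Integrable C ((P ⊗ₘ κ).map Prod.fst) := by
      have h1 : (P ⊗ₘ κ).map Prod.fst = P := Measure.fst_compProd P κ
      rw [h1]; exact hφ.integrable_const
    exact this.comp_measurable measurable_fst
  have eC : ∫ x, C x.1 ∂(P ⊗ₘ κ) = ∫ u, C u ∂P := by
    have h1 : (P ⊗ₘ κ).map Prod.fst = P := Measure.fst_compProd P κ
    conv_rhs => rw [← h1]
    rw [integral_map measurable_fst.aemeasurable hm.aestronglyMeasurable]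
  have i2 : ∀ {d : ℕ} (y : ObsSpace ι dy dz → Fin d → ℝ) (_ : Measurable y) (k : Fin d → ℤ), Integrable
      (fun x => ∑ i, if quantileCell ((P ⊗ₘ κ).map fun x => y x i) N (y x i) = k i then (1 : ℝ) else 0) (P ⊗ₘ κ) := by
    intro d y hy k
    refine integrable_of_abs_le (B := d) ?_ fun x => ?_
    · refine Finset.measurable_fun_sum _ fun i _ => Measurable.ite ?_ measurable_const measurable_const
      exact ((measurable_quantileCell _ N).comp ((measurable_pi_apply i).comp hy)) (measurableSet_singleton (k i))
    · rw [abs_of_nonneg (sum_ite_nonneg (fun i => quantileCell ((P ⊗ₘ κ).map fun x => y x i) N) k (y x))]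
      exact sum_ite_le (fun i => quantileCell ((P ⊗ₘ κ).map fun x => y x i) N) k (y x)
  have j1 := i2 (fun x => x.2.1) (by fun_prop) kY
  have j2 := i2 (fun x => x.2.2) (by fun_prop) kZ
  have h1 := integral_sum_ite_le (Q := P ⊗ₘ κ) hN (y := fun x => x.2.1) (by fun_prop) hY kY
  have h2 := integral_sum_ite_le (Q := P ⊗ₘ κ) hN (y := fun x => x.2.2) (by fun_prop) hZ kZ
  unfold cellBound
  have j3 := i1.add (j1.const_mul B)
  simp only [Pi.add_def] at j3
  simp only
  rw [integral_add j3 (j2.const_mul B), integral_add i1 (j1.const_mul B), integral_const_mul,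
    integral_const_mul]
  gcongr
  rw [← eC, ← integral_const_mul]
  refine integral_mono i1 (iC.const_mul _) fun x => ?_
  exact (min_le_right _ _).trans_eq (mul_comm _ _)

theorem TailCondition.abs {E : Type*} [MeasurableSpace E] {μ : Measure Ω} [IsProbabilityMeasure μ]
    {V : ℤ → Ω → E} {π : E → ι → ℝ}
    {K : (ι → ℝ) → ℝ} {h : ℕ → ℝ} (hK : TailCondition μ V π K h) : TailCondition μ V π (fun u => |K u|) h := by
  intro ε hε
  obtain ⟨A₀, hA₀⟩ := hK ε hε
  refine ⟨A₀, fun A hA => (hA₀ A hA).mono fun n hn => le_trans (pairMean_mono n fun x x' => ?_) hn⟩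
  unfold scaledKernel
  simp only [norm_mul, Real.norm_eq_abs, abs_abs, le_refl]

variable {μ : Measure Ω} [IsProbabilityMeasure μ] {V : ℤ → Ω → ObsSpace ι dy dz} {a : ℕ → ℝ} {h : ℕ → ℝ}
  {fW : (ι → ℝ) → ℝ≥0∞} {M : ℝ≥0} {K : (ι → ℝ) → ℝ}

/-- On a cell the oscillation is at most a pair average with kernel `|K|` and the functions `e`, `1`
in either order. The convergence theorem applies to it, and its limit is at most `2M (∫ |K|) E[e]`.
The mean `E[e]` is made small by fine cubes in `w` and many quantile cells in `y` and `z`. -/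
theorem hasBrackets_indepStat [IsProbabilityMeasure P] [IsMarkovKernel κ]
    (hD : KernelDesign μ V (P ⊗ₘ κ) a Prod.fst h)
    (hfW : Measurable fW) (hle : ∀ u, fW u ≤ M) (hP : P = volume.withDensity fW)
    (hK : Measurable K) (hKi : Integrable K) {BK : ℝ} (hBK : ∀ u, |K u| ≤ BK)
    (htail : TailCondition μ V Prod.fst K h) (hφ : RegularWeights P 𝒲 φ B C ν) (h𝒲 : Bornology.IsBounded 𝒲)
    (hY : ∀ i, NullSingletonClass ((P ⊗ₘ κ).map fun x => x.2.1 i))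
    (hZ : ∀ i, NullSingletonClass ((P ⊗ₘ κ).map fun x => x.2.2 i)) :
    HasBrackets μ (𝒲 ×ˢ Set.univ) (indepStat V K h φ) := by
  intro ε hε
  have hB := hφ.bound_nonneg
  set c₀ : ℝ := (∫ u, |K u|) * (2 * M) + 1 with hc₀
  have hIK : 0 ≤ ∫ u, |K u| := integral_nonneg fun u => abs_nonneg _
  have hc₀1 : 1 ≤ c₀ := by rw [hc₀]; have : 0 ≤ (∫ u, |K u|) * (2 * M) := by positivity
                           linarith
  set ε' : ℝ := ε / c₀ with hε'
  have hε'0 : 0 < ε' := by positivity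
  have hIC : 0 ≤ ∫ u, C u ∂P := integral_nonneg hφ.const_nonneg
  -- The cube side `ρ` solves `ρ^ν = r`, which makes the weight part of `E[e]` at most `ε'/2`; `N`
  -- is then chosen for the indicator part.
  set r : ℝ := ε' / (2 * ((∫ u, C u ∂P) + 1)) with hr
  have hr0 : 0 < r := by positivity
  set ρ : ℝ := r ^ ν⁻¹ with hρdef
  have hρ0 : 0 < ρ := Real.rpow_pos_of_pos hr0 _
  have hρν : ρ ^ ν = r := Real.rpow_inv_rpow hr0.le hφ.exponent_pos.ne'
  obtain ⟨N, hN⟩ := exists_nat_gt (B * (dy + dz) * (2 / ε'))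
  have hN0 : 0 < N := by
    have h1 : 0 ≤ B * (dy + dz) * (2 / ε') := by positivity
    exact_mod_cast h1.trans_lt hN
  set cY : Fin dy → ℝ → ℤ := fun i => quantileCell ((P ⊗ₘ κ).map fun x => x.2.1 i) N with hcY
  set cZ : Fin dz → ℝ → ℤ := fun i => quantileCell ((P ⊗ₘ κ).map fun x => x.2.2 i) N with hcZ
  have hcYm : ∀ i, Measurable (cY i) := fun i => measurable_quantileCell _ _
  have hcZm : ∀ i, Measurable (cZ i) := fun i => measurable_quantileCell _ _
  obtain ⟨enc, henc⟩ := exists_injective_nat ((ι → ℤ) × (Fin dy → ℤ) × (Fin dz → ℤ))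
  refine ⟨enc ∘ obsCell ρ cY cZ, (Measurable.of_discrete (f := enc)).comp (measurable_obsCell ρ hcYm hcZm), ?_,
    fun c => ?_⟩
  · rw [Set.image_comp]
    exact (finite_image_obsCell hρ0 (fun i x => quantileCell_mem _ _ _) (fun i x => quantileCell_mem _ _ _) h𝒲).image _
  -- The cell with code `c`. If `c` codes no cell then `k` is arbitrary, which is harmless: the
  -- limit bound holds for every `k`, and the oscillation bound is vacuous.
  set k := Function.invFun enc c with hk
  set e : ObsSpace ι dy dz → ℝ := cellBound B ρ ν C cY cZ k.2.1 k.2.2 with he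
  have hem : Measurable e := measurable_cellBound hφ.measurable_const hcYm hcZm _ _
  have he0 : ∀ x, 0 ≤ e x := cellBound_nonneg hB hρ0.le hφ.const_nonneg _ _ _ _
  have heA : ∀ x, e x ≤ 2 * B + B * dy + B * dz := cellBound_le hB _ _ _ _
  -- The truncation at `2B` inside `cellBound` keeps `e` bounded although the Hölder constant `C` is
  -- only integrable.
  have heabs : ∀ x, |e x| ≤ 2 * B + B * dy + B * dz := fun x => by rw [abs_of_nonneg (he0 x)]; exact heA x
  have heint : ∫ x, e x ∂(P ⊗ₘ κ) ≤ ε' := by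
    refine (integral_cellBound_le hφ hρ0.le hN0 hY hZ k.2.1 k.2.2).trans ?_
    rw [hρν, hr]
    have h1 : ε' / (2 * ((∫ u, C u ∂P) + 1)) * (∫ u, C u ∂P) ≤ ε' / 2 := by
      rw [div_mul_eq_mul_div, div_le_div_iff₀ (by positivity) (by positivity)]
      nlinarith
    have h2 : B * (dy * (N : ℝ)⁻¹) + B * (dz * (N : ℝ)⁻¹) ≤ ε' / 2 := by
      have e1 : B * (dy * (N : ℝ)⁻¹) + B * (dz * (N : ℝ)⁻¹) = B * (dy + dz) / N := by ring
      rw [e1, div_le_iff₀ (by positivity)]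
      have h3 := hN.le
      rw [← mul_div_assoc, div_le_iff₀ hε'0] at h3
      linarith
    linarith
  have hKam : Measurable fun u => |K u| := hK.abs
  have t1 := hD.tendstoInMeasure hfW hle hP hKam hKi.abs (B := BK) (fun u => by rw [abs_abs]; exact hBK u)
    htail.abs hem (measurable_const (a := (1 : ℝ))) heabs (A' := 1) (by simp)
  have t2 := hD.tendstoInMeasure hfW hle hP hKam hKi.abs (B := BK) (fun u => by rw [abs_abs]; exact hBK u)
    htail.abs (measurable_const (a := (1 : ℝ))) hem (A := 1) (by simp) heabs
  have t3 := TendstoInMeasure.const_seq_smul tendsto_div_sub_one (TendstoInMeasure.add_const_limits t1 t2)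
  refine ⟨_, _, ?_, t3, ?_⟩
  · rw [pairLimit_comm (fun _ => (1 : ℝ)) e, ← mul_add]
    have h1 := pairLimit_le (κ := κ) (P := P) hle hem he0 heA
    have h2 : (M : ℝ) * ∫ x, e x ∂(P ⊗ₘ κ) ≤ M * ε' := mul_le_mul_of_nonneg_left heint M.2
    calc _ ≤ (∫ u, |K u|) * (M * ε' + M * ε') := by gcongr <;> exact h1.trans h2
      _ ≤ c₀ * ε' := by rw [hc₀]; nlinarith
      _ = ε := by rw [hε']; field_simp
  · intro n ω q hq q' hq' hqc hqc'
    have hinv := Function.leftInverse_invFun henc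
    have k1 : obsCell ρ cY cZ q = k := by rw [hk, ← hqc]; exact (hinv _).symm
    have k2 : obsCell ρ cY cZ q' = k := by rw [hk, ← hqc']; exact (hinv _).symm
    refine norm_indepStat_sub_le hD.bandwidth_pos n q q' (fun x x' => ?_) ω
    refine norm_summand_sub_le hφ (fun i => monotone_quantileCell _ _) (fun i => monotone_quantileCell _ _)
      hq.1 hq'.1 (norm_sub_le_of_obsCell_eq hρ0 (k1.trans k2.symm)) (fun i => ?_) (fun i => ?_) (fun i => ?_)
      (fun i => ?_) x x'
    · exact congrFun (congrArg (fun k => k.2.1) k1) i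
    · exact congrFun (congrArg (fun k => k.2.1) k2) i
    · exact congrFun (congrArg (fun k => k.2.2) k1) i
    · exact congrFun (congrArg (fun k => k.2.2) k2) i

end Brackets

/-! ### Convergence at a fixed point -/

section PointwiseLimit

variable {Ω ι 𝕜 : Type*} [MeasurableSpace Ω] [Fintype ι] [RCLike 𝕜] {dy dz : ℕ}
variable {P : Measure (ι → ℝ)} {κ : Kernel (ι → ℝ) ((Fin dy → ℝ) × (Fin dz → ℝ))}
  {φ : (ι → ℝ) → (ι → ℝ) → 𝕜} {𝒲 : Set (ι → ℝ)} {B ν ρ : ℝ} {C : (ι → ℝ) → ℝ}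
variable {μ : Measure Ω} [IsProbabilityMeasure μ] {V : ℤ → Ω → ObsSpace ι dy dz} {a : ℕ → ℝ} {h : ℕ → ℝ}
  {fW : (ι → ℝ) → ℝ≥0∞} {M : ℝ≥0} {K : (ι → ℝ) → ℝ}

/-- The defect of conditional independence at `(y, z)`, times the density. -/
def dependence (κ : Kernel (ι → ℝ) ((Fin dy → ℝ) × (Fin dz → ℝ))) (fW : (ι → ℝ) → ℝ≥0∞)
    (r : (Fin dy → ℝ) × (Fin dz → ℝ)) (u : ι → ℝ) : ℝ :=
  ((κ u).real (Set.Iic r) - (κ u).fst.real (Set.Iic r.1) * (κ u).snd.real (Set.Iic r.2)) * (fW u).toReal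

/-- The probability limit of `n^{-1/2} S_n` at `q = (w, y, z)`. -/
def indepLimit (P : Measure (ι → ℝ)) (κ : Kernel (ι → ℝ) ((Fin dy → ℝ) × (Fin dz → ℝ)))
    (fW : (ι → ℝ) → ℝ≥0∞) (φ : (ι → ℝ) → (ι → ℝ) → 𝕜) (q : ObsSpace ι dy dz) : 𝕜 :=
  ∫ u, φ u q.1 * (dependence κ fW q.2 u : 𝕜) ∂P

theorem measurable_fst_real_Iic (y : Fin dy → ℝ) : Measurable fun u => (κ u).fst.real (Set.Iic y) := by
  have := (κ.fst.measurable_coe (measurableSet_Iic (a := y))).ennreal_toReal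
  simp only [Kernel.fst_apply] at this
  exact this

theorem measurable_snd_real_Iic (z : Fin dz → ℝ) : Measurable fun u => (κ u).snd.real (Set.Iic z) := by
  have := (κ.snd.measurable_coe (measurableSet_Iic (a := z))).ennreal_toReal
  simp only [Kernel.snd_apply] at this
  exact this

theorem measurable_dependence [IsMarkovKernel κ] (hfW : Measurable fW) (r : (Fin dy → ℝ) × (Fin dz → ℝ)) :
    Measurable (dependence κ fW r) := by
  unfold dependence
  have h1 : Measurable fun u => (κ u).real (Set.Iic r) := (κ.measurable_coe measurableSet_Iic).ennreal_toReal
  have h2 : Measurable fun u => (κ u).fst.real (Set.Iic r.1) :=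
      measurable_fst_real_Iic _
  have h3 : Measurable fun u => (κ u).snd.real (Set.Iic r.2) :=
      measurable_snd_real_Iic _
  exact (h1.sub (h2.mul h3)).mul hfW.ennreal_toReal

theorem abs_dependence_le [IsMarkovKernel κ] (hle : ∀ u, fW u ≤ M) (r : (Fin dy → ℝ) × (Fin dz → ℝ))
    (u : ι → ℝ) : |dependence κ fW r u| ≤ M := by
  have h1 : (κ u).real (Set.Iic r) ≤ 1 := measureReal_le_one
  have h2 : (κ u).fst.real (Set.Iic r.1) ≤ 1 := measureReal_le_one
  have h3 : (κ u).snd.real (Set.Iic r.2) ≤ 1 := measureReal_le_one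
  have h2' : 0 ≤ (κ u).fst.real (Set.Iic r.1) := measureReal_nonneg
  have h3' : 0 ≤ (κ u).snd.real (Set.Iic r.2) := measureReal_nonneg
  have h1' : 0 ≤ (κ u).real (Set.Iic r) := measureReal_nonneg
  unfold dependence
  rw [abs_mul]
  calc _ ≤ 1 * (M : ℝ) := mul_le_mul (abs_le.2 ⟨by nlinarith, by nlinarith⟩) (toReal_density_le hle u)
        (abs_nonneg _) zero_le_one
    _ = M := one_mul _

theorem integrable_indepLimit [IsProbabilityMeasure P] [IsMarkovKernel κ] (hfW : Measurable fW)
    (hle : ∀ u, fW u ≤ M) {g : (ι → ℝ) → 𝕜} (hg : Measurable g) (hB : ∀ u, ‖g u‖ ≤ B)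
    (r : (Fin dy → ℝ) × (Fin dz → ℝ)) : Integrable (fun u => g u * (dependence κ fW r u : 𝕜)) P := by
  have hm := measurable_dependence (κ := κ) hfW r
  refine Integrable.of_bound (C := B * M) (Measurable.aestronglyMeasurable (by fun_prop)) (.of_forall fun u => ?_)
  rw [norm_mul, RCLike.norm_ofReal]
  exact mul_le_mul (hB u) (abs_dependence_le hle r u) (abs_nonneg _) ((norm_nonneg _).trans (hB u))

theorem re_indepStat (n : ℕ) (q : ObsSpace ι dy dz) (ω : Ω) :
    RCLike.re (indepStat V K h φ n q ω) = indepStat V K h (fun u w => RCLike.re (φ u w)) n q ω := by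
  simp only [indepStat, summand, RCLike.smul_re, map_sum, smul_eq_mul]

theorem im_indepStat (n : ℕ) (q : ObsSpace ι dy dz) (ω : Ω) :
    RCLike.im (indepStat V K h φ n q ω) = indepStat V K h (fun u w => RCLike.im (φ u w)) n q ω := by
  simp only [indepStat, summand, RCLike.smul_im, map_sum, smul_eq_mul]

/-- Reduces complex weights to real ones, for which pair averages have been treated. -/
theorem tendstoInMeasure_of_re_im {X : ℕ → Ω → 𝕜} {c : 𝕜}
    (hre : TendstoInMeasure μ (fun n ω => RCLike.re (X n ω)) atTop fun _ => RCLike.re c)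
    (him : TendstoInMeasure μ (fun n ω => RCLike.im (X n ω)) atTop fun _ => RCLike.im c) :
    TendstoInMeasure μ X atTop fun _ => c := by
  rw [tendstoInMeasure_iff_norm] at hre him ⊢
  intro ε hε
  refine tendsto_measure_zero_of_eventually_subset
    (tendsto_measure_union_zero (hre (ε / 2) (by positivity)) (him (ε / 2) (by positivity)))
    (.of_forall fun n ω hω => ?_)
  simp only [Set.mem_ofPred_eq, Set.mem_union, ← map_sub, Real.norm_eq_abs] at hω ⊢
  by_contra hlt
  push Not at hlt
  have h2 : ‖X n ω - c‖ ^ 2 < ε ^ 2 := by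
    rw [← RCLike.normSq_eq_def', RCLike.normSq_apply, ← abs_mul_abs_self, ← abs_mul_abs_self (RCLike.im _)]
    nlinarith [abs_nonneg (RCLike.re (X n ω - c)), abs_nonneg (RCLike.im (X n ω - c))]
  have h3 := lt_of_pow_lt_pow_left₀ 2 hε.le h2
  linarith

theorem condMean_ind_ind [IsMarkovKernel κ] (g : (ι → ℝ) → ℝ) (r : (Fin dy → ℝ) × (Fin dz → ℝ)) (u : ι → ℝ) :
    condMean κ (fun x => g x.1 * (ind x.2.1 r.1 * ind x.2.2 r.2)) u = g u * (κ u).real (Set.Iic r) := by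
  unfold condMean
  simp only
  rw [integral_const_mul]
  congr 1
  have : ∀ s : (Fin dy → ℝ) × (Fin dz → ℝ), ind s.1 r.1 * ind s.2 r.2 = (Set.Iic r).indicator (fun _ => (1 : ℝ)) s := by
    intro s
    by_cases h1 : s.1 ≤ r.1 <;> by_cases h2 : s.2 ≤ r.2 <;> simp [ind, h1, h2, Prod.le_def]
  simp_rw [this]
  rw [integral_indicator_const _ measurableSet_Iic, smul_eq_mul, mul_one]

theorem condMean_ind_left [IsMarkovKernel κ] (g : (ι → ℝ) → ℝ) (y : Fin dy → ℝ) (u : ι → ℝ) :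
    condMean κ (fun x => g x.1 * ind x.2.1 y) u = g u * (κ u).fst.real (Set.Iic y) := by
  unfold condMean
  simp only
  rw [integral_const_mul]
  congr 1
  have : ∀ s : (Fin dy → ℝ) × (Fin dz → ℝ), ind s.1 y = (Prod.fst ⁻¹' Set.Iic y).indicator (fun _ => (1 : ℝ)) s := by
    intro s
    by_cases h1 : s.1 ≤ y <;> simp [ind, h1]
  simp_rw [this]
  rw [integral_indicator_const _ (measurable_fst measurableSet_Iic), smul_eq_mul, mul_one, measureReal_def,
    measureReal_def, Measure.fst_apply measurableSet_Iic]

theorem condMean_ind_right [IsMarkovKernel κ] (z : Fin dz → ℝ) (u : ι → ℝ) :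
    condMean κ (fun x => ind x.2.2 z) u = (κ u).snd.real (Set.Iic z) := by
  unfold condMean
  have : ∀ s : (Fin dy → ℝ) × (Fin dz → ℝ), ind s.2 z = (Prod.snd ⁻¹' Set.Iic z).indicator (fun _ => (1 : ℝ)) s := by
    intro s
    by_cases h1 : s.2 ≤ z <;> simp [ind, h1]
  simp_rw [this]
  rw [integral_indicator_const _ (measurable_snd measurableSet_Iic), smul_eq_mul, mul_one, measureReal_def,
    measureReal_def, Measure.snd_apply measurableSet_Iic]

/-- Expanding `1(Z_t ≤ z) - 1(Z_s ≤ z)` gives two kernel pair averages of products. Their regression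
functions involve the joint conditional distribution function in one case and the two marginal ones
in the other. -/
theorem tendstoInMeasure_indepStat_real [IsProbabilityMeasure P] [IsMarkovKernel κ]
    (hD : KernelDesign μ V (P ⊗ₘ κ) a Prod.fst h)
    (hfW : Measurable fW) (hle : ∀ u, fW u ≤ M) (hP : P = volume.withDensity fW)
    (hK : Measurable K) (hKi : Integrable K) {BK : ℝ} (hBK : ∀ u, |K u| ≤ BK) (hK1 : ∫ u, K u = 1)
    (htail : TailCondition μ V Prod.fst K h) {φ : (ι → ℝ) → (ι → ℝ) → ℝ} (q : ObsSpace ι dy dz)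
    (hφm : Measurable fun u => φ u q.1) (hφB : ∀ u, |φ u q.1| ≤ B) :
    TendstoInMeasure μ (fun n => indepStat V K h φ n q) atTop fun _ => indepLimit P κ fW φ q := by
  have hB0 : 0 ≤ B := (abs_nonneg _).trans (hφB 0)
  have mY : Measurable fun x : ObsSpace ι dy dz => ind x.2.1 q.2.1 := (measurable_ind _).comp (by fun_prop)
  have mZ : Measurable fun x : ObsSpace ι dy dz => ind x.2.2 q.2.2 := (measurable_ind _).comp (by fun_prop)
  have mφ : Measurable fun x : ObsSpace ι dy dz => φ x.1 q.1 := hφm.comp measurable_fst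
  have t1 := hD.tendstoInMeasure hfW hle hP hK hKi hBK htail
    (f := fun x => φ x.1 q.1 * (ind x.2.1 q.2.1 * ind x.2.2 q.2.2)) (g := fun _ => 1)
    (mφ.mul (mY.mul mZ)) measurable_const (A := B) (A' := 1) (fun x => by
      rw [abs_mul, abs_mul]
      calc _ ≤ B * 1 := mul_le_mul (hφB _) (mul_le_one₀ (abs_ind_le _ _) (abs_nonneg _) (abs_ind_le _ _))
            (by positivity) hB0
        _ = B := mul_one B) (by simp)
  have t2 := hD.tendstoInMeasure hfW hle hP hK hKi hBK htail
    (f := fun x => -φ x.1 q.1 * ind x.2.1 q.2.1) (g := fun x => ind x.2.2 q.2.2)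
    (mφ.neg.mul mY) mZ (A := B) (A' := 1) (fun x => by
      rw [abs_mul, abs_neg]
      calc _ ≤ B * 1 := mul_le_mul (hφB _) (abs_ind_le _ _) (by positivity) hB0
        _ = B := mul_one B) (fun x => abs_ind_le _ _)
  have t3 := TendstoInMeasure.const_seq_smul tendsto_div_sub_one (TendstoInMeasure.add_const_limits t1 t2)
  have hlim : (∫ u, K u) * pairLimit P κ fW (fun x => φ x.1 q.1 * (ind x.2.1 q.2.1 * ind x.2.2 q.2.2)) (fun _ => 1) +
      (∫ u, K u) * pairLimit P κ fW (fun x => -φ x.1 q.1 * ind x.2.1 q.2.1) (fun x => ind x.2.2 q.2.2) =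
      indepLimit P κ fW φ q := by
    have e1 : ∀ u, condMean κ (fun x => φ x.1 q.1 * (ind x.2.1 q.2.1 * ind x.2.2 q.2.2)) u =
        φ u q.1 * (κ u).real (Set.Iic q.2) := condMean_ind_ind (fun u => φ u q.1) q.2
    have e2 : ∀ u, condMean κ (fun x => -φ x.1 q.1 * ind x.2.1 q.2.1) u =
        -φ u q.1 * (κ u).fst.real (Set.Iic q.2.1) := condMean_ind_left (fun u => -φ u q.1) q.2.1
    have e3 : ∀ u, condMean κ (fun _ => (1 : ℝ)) u = 1 := fun u => by simp [condMean]
    rw [hK1, one_mul, one_mul, pairLimit, pairLimit, indepLimit]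
    simp_rw [e1, e2, e3, condMean_ind_right]
    have h1 : Measurable fun u => (κ u).real (Set.Iic q.2) := (κ.measurable_coe measurableSet_Iic).ennreal_toReal
    have h2 : Measurable fun u => (κ u).fst.real (Set.Iic q.2.1) :=
      measurable_fst_real_Iic _
    have h3 : Measurable fun u => (κ u).snd.real (Set.Iic q.2.2) :=
      measurable_snd_real_Iic _
    have h4 := hfW.ennreal_toReal
    have b1 : ∀ u, |(κ u).real (Set.Iic q.2)| ≤ 1 := fun u => by
      rw [abs_of_nonneg measureReal_nonneg]; exact measureReal_le_one
    have b2 : ∀ u, |(κ u).fst.real (Set.Iic q.2.1)| ≤ 1 := fun u => by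
      rw [abs_of_nonneg measureReal_nonneg]; exact measureReal_le_one
    have b3 : ∀ u, |(κ u).snd.real (Set.Iic q.2.2)| ≤ 1 := fun u => by
      rw [abs_of_nonneg measureReal_nonneg]; exact measureReal_le_one
    have b4 := toReal_density_le (fW := fW) hle
    rw [← integral_add]
    · refine integral_congr_ae (.of_forall fun u => ?_)
      simp only [dependence, RCLike.ofReal_real_eq_id, id]
      ring
    · refine integrable_of_abs_le (B := B * 1 * 1 * M) (by fun_prop) fun u => ?_
      simp only [abs_mul, abs_one]
      have := hφB u; have := b1 u; have := b4 u
      gcongr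
    · refine integrable_of_abs_le (B := B * 1 * 1 * M) (by fun_prop) fun u => ?_
      simp only [abs_mul, abs_neg]
      have := hφB u; have := b2 u; have := b3 u; have := b4 u
      gcongr
  rw [hlim] at t3
  refine t3.congr_left fun n => .of_forall fun ω => ?_
  simp only [smul_eq_mul, indepStat, ← pairAvg_add]
  congr 1
  unfold pairAvg
  congr 1
  refine Finset.sum_congr rfl fun t _ => Finset.sum_congr rfl fun s _ => ?_
  simp only [summand, smul_eq_mul]
  ring

theorem tendstoInMeasure_indepStat [IsProbabilityMeasure P] [IsMarkovKernel κ]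
    (hD : KernelDesign μ V (P ⊗ₘ κ) a Prod.fst h)
    (hfW : Measurable fW) (hle : ∀ u, fW u ≤ M) (hP : P = volume.withDensity fW)
    (hK : Measurable K) (hKi : Integrable K) {BK : ℝ} (hBK : ∀ u, |K u| ≤ BK) (hK1 : ∫ u, K u = 1)
    (htail : TailCondition μ V Prod.fst K h) (q : ObsSpace ι dy dz)
    (hφm : Measurable fun u => φ u q.1) (hφB : ∀ u, ‖φ u q.1‖ ≤ B) :
    TendstoInMeasure μ (fun n => indepStat V K h φ n q) atTop fun _ => indepLimit P κ fW φ q := by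
  have hint := integrable_indepLimit (P := P) (κ := κ) hfW hle hφm hφB q.2
  refine tendstoInMeasure_of_re_im ?_ ?_
  · have h1 := tendstoInMeasure_indepStat_real hD hfW hle hP hK hKi hBK hK1 htail
      (φ := fun u w => RCLike.re (φ u w)) q (by fun_prop) (B := B) fun u => (RCLike.abs_re_le_norm _).trans (hφB u)
    have e : RCLike.re (indepLimit P κ fW φ q) = indepLimit P κ fW (fun u w => RCLike.re (φ u w)) q := by
      unfold indepLimit
      rw [← integral_re hint]
      simp
    simp only [re_indepStat, e]
    exact h1
  · have h1 := tendstoInMeasure_indepStat_real hD hfW hle hP hK hKi hBK hK1 htail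
      (φ := fun u w => RCLike.im (φ u w)) q (by fun_prop) (B := B) fun u => (RCLike.abs_im_le_norm _).trans (hφB u)
    have e : RCLike.im (indepLimit P κ fW φ q) = indepLimit P κ fW (fun u w => RCLike.im (φ u w)) q := by
      unfold indepLimit
      rw [← integral_im hint]
      simp
    simp only [im_indepStat, e]
    exact h1

end PointwiseLimit

/-! ### Stationarity and mixing of `(W_t, Y_t, Z_t)` -/

section Series

variable {Ω : Type*} {dx dy dz : ℕ} {X : ℤ → Ω → Fin dx → ℝ} {Y : ℤ → Ω → Fin dy → ℝ}
  {Z : ℤ → Ω → Fin dz → ℝ} {p : ℕ}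

/-- The observation `(W_t, Y_t, Z_t)`. -/
def obsVec (X : ℤ → Ω → Fin dx → ℝ) (Y : ℤ → Ω → Fin dy → ℝ) (Z : ℤ → Ω → Fin dz → ℝ) (p : ℕ) (t : ℤ) (ω : Ω) :
    ObsSpace (WIdx p dx dy dz) dy dz := (condVec X Y Z p t ω, (Y t ω, Z t ω))

theorem measurable_condVec_of [MeasurableSpace Ω] {t : ℤ} (hX : ∀ s ≤ t, t - p ≤ s → Measurable (X s))
    (hY : ∀ s ≤ t, t - p ≤ s → Measurable (Y s)) (hZ : ∀ s ≤ t, t - p ≤ s → Measurable (Z s)) :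
    Measurable (condVec X Y Z p t) := by
  refine measurable_pi_lambda _ fun i => ?_
  obtain ⟨j, c⟩ := i
  have hj : ((j : ℕ) : ℤ) < p := by exact_mod_cast j.2
  have hj0 : (0 : ℤ) ≤ ((j : ℕ) : ℤ) := by positivity
  rcases c with a | b | c
  · exact (measurable_pi_apply a).comp (hX (t - (j : ℕ)) (by linarith) (by linarith))
  · exact (measurable_pi_apply b).comp (hY (t - (j : ℕ) - 1) (by linarith) (by omega))
  · exact (measurable_pi_apply c).comp (hZ (t - (j : ℕ) - 1) (by linarith) (by omega))

theorem measurable_obsVec_of [MeasurableSpace Ω] {t : ℤ}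
    (h : ∀ s ≤ t, t - p ≤ s → Measurable (obs X Y Z s)) : Measurable (obsVec X Y Z p t) := by
  have hX : ∀ s ≤ t, t - p ≤ s → Measurable (X s) := fun s h1 h2 => measurable_fst.comp (h s h1 h2)
  have hY : ∀ s ≤ t, t - p ≤ s → Measurable (Y s) := fun s h1 h2 =>
    (measurable_fst.comp measurable_snd).comp (h s h1 h2)
  have hZ : ∀ s ≤ t, t - p ≤ s → Measurable (Z s) := fun s h1 h2 =>
    (measurable_snd.comp measurable_snd).comp (h s h1 h2)
  have ht : t - (p : ℤ) ≤ t := by linarith [Int.natCast_nonneg p]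
  exact (measurable_condVec_of hX hY hZ).prodMk ((hY t le_rfl ht).prodMk (hZ t le_rfl ht))

theorem measurable_sigmaPast {E : Type*} [MeasurableSpace E] (U : ℤ → Ω → E) {s t : ℤ} (hst : s ≤ t) :
    Measurable[sigmaPast U t] (U s) := by
  rw [measurable_iff_comap_le]
  exact le_iSup₂_of_le s hst le_rfl

theorem measurable_sigmaFuture {E : Type*} [MeasurableSpace E] (U : ℤ → Ω → E) {s t : ℤ} (hst : t ≤ s) :
    Measurable[sigmaFuture U t] (U s) := by
  rw [measurable_iff_comap_le]
  exact le_iSup₂_of_le s hst le_rfl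

theorem measurable_obsVec_sigmaPast (t : ℤ) :
    Measurable[sigmaPast (obs X Y Z) t] (obsVec X Y Z p t) :=
  @measurable_obsVec_of Ω dx dy dz X Y Z p (sigmaPast (obs X Y Z) t) t
    fun _ h1 _ => measurable_sigmaPast _ h1

/-- The oldest entries of `W_t` are `Y` and `Z` at time `t - p`, hence the shift by `p`. -/
theorem measurable_obsVec_sigmaFuture (t : ℤ) :
    Measurable[sigmaFuture (obs X Y Z) (t - p)] (obsVec X Y Z p t) :=
  @measurable_obsVec_of Ω dx dy dz X Y Z p (sigmaFuture (obs X Y Z) (t - p)) t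
    fun _ _ h2 => measurable_sigmaFuture _ h2

variable [MeasurableSpace Ω]

theorem measurable_obs (hX : ∀ t, Measurable (X t)) (hY : ∀ t, Measurable (Y t)) (hZ : ∀ t, Measurable (Z t))
    (t : ℤ) : Measurable (obs X Y Z t) := (hX t).prodMk ((hY t).prodMk (hZ t))

theorem measurable_obsVec (hX : ∀ t, Measurable (X t)) (hY : ∀ t, Measurable (Y t)) (hZ : ∀ t, Measurable (Z t))
    (t : ℤ) : Measurable (obsVec X Y Z p t) := measurable_obsVec_of fun s _ _ => measurable_obs hX hY hZ s

theorem measurable_condVec (hX : ∀ t, Measurable (X t)) (hY : ∀ t, Measurable (Y t)) (hZ : ∀ t, Measurable (Z t))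
    (t : ℤ) : Measurable (condVec X Y Z p t) := measurable_fst.comp (measurable_obsVec hX hY hZ t)

variable {μ : Measure Ω}

theorem StrictlyStationary.map_shift {E : Type*} [MeasurableSpace E] {U : ℤ → Ω → E}
    (hU : ∀ t, Measurable (U t)) (hs : StrictlyStationary μ U) (t : ℤ) :
    μ.map (fun ω (s : ℤ) => U (s + t) ω) = μ.map fun ω (s : ℤ) => U s ω := by
  have hstep : ∀ t : ℤ, μ.map (fun ω (s : ℤ) => U (s + (t + 1)) ω) = μ.map fun ω (s : ℤ) => U (s + t) ω := by
    intro t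
    have hm : Measurable fun (x : ℤ → E) (s : ℤ) => x (s + t) :=
      measurable_pi_lambda _ fun s => measurable_pi_apply _
    have h1 : Measurable fun ω (s : ℤ) => U (s + 1) ω := measurable_pi_lambda _ fun s => hU _
    have h2 : Measurable fun ω (s : ℤ) => U s ω := measurable_pi_lambda _ fun s => hU _
    have := congrArg (fun m => Measure.map (fun (x : ℤ → E) (s : ℤ) => x (s + t)) m) hs
    simp only [Measure.map_map hm h1, Measure.map_map hm h2] at this
    simpa only [Function.comp_def, add_assoc] using this
  induction t using Int.induction_on with
  | zero => simp
  | succ i ih => rw [hstep, ih]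
  | pred i ih =>
    rw [← ih, ← hstep]
    simp

/-- All these vectors are one and the same function of the shifted trajectory. -/
theorem map_obsVec_eq (hX : ∀ t, Measurable (X t)) (hY : ∀ t, Measurable (Y t)) (hZ : ∀ t, Measurable (Z t))
    (hs : StrictlyStationary μ (obs X Y Z)) (t : ℤ) : μ.map (obsVec X Y Z p t) = μ.map (obsVec X Y Z p 0) := by
  set coord : ℤ → (ℤ → (Fin dx → ℝ) × (Fin dy → ℝ) × (Fin dz → ℝ)) → (Fin dx → ℝ) × (Fin dy → ℝ) × (Fin dz → ℝ) :=
    fun s x => x s with hcoord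
  have hc : ∀ s, Measurable (coord s) := fun s => measurable_pi_apply s
  set G := obsVec (fun s x => (coord s x).1) (fun s x => (coord s x).2.1) (fun s x => (coord s x).2.2) p 0 with hG
  have hGm : Measurable G := measurable_obsVec (fun s => (hc s).fst) (fun s => (hc s).snd.fst) (fun s => (hc s).snd.snd) 0
  have hrep : ∀ t, obsVec X Y Z p t = G ∘ fun ω (s : ℤ) => obs X Y Z (s + t) ω := by
    intro t
    ext1 ω
    refine Prod.ext ?_ (by simp [obsVec, hG, hcoord, obs])
    ext i
    obtain ⟨j, c⟩ := i
    rcases c with a | b | c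
    · simp only [obsVec, hG, hcoord, obs, condVec, Function.comp_apply]
      congr 2; ring
    · simp only [obsVec, hG, hcoord, obs, condVec, Function.comp_apply]
      congr 2; ring
    · simp only [obsVec, hG, hcoord, obs, condVec, Function.comp_apply]
      congr 2; ring
  have hm : ∀ t : ℤ, Measurable fun ω (s : ℤ) => obs X Y Z (s + t) ω := fun t =>
    measurable_pi_lambda _ fun s => measurable_obs hX hY hZ _
  rw [hrep t, hrep 0, ← Measure.map_map hGm (hm t), ← Measure.map_map hGm (hm 0),
    hs.map_shift (measurable_obs hX hY hZ), hs.map_shift (measurable_obs hX hY hZ)]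

variable [IsProbabilityMeasure μ]

theorem abs_measureReal_inter_sub_le_one (A B : Set Ω) : |μ.real (A ∩ B) - μ.real A * μ.real B| ≤ 1 := by
  have h1 : μ.real (A ∩ B) ≤ 1 := measureReal_le_one
  have h2 : μ.real A ≤ 1 := measureReal_le_one
  have h3 : μ.real B ≤ 1 := measureReal_le_one
  have h1' : 0 ≤ μ.real (A ∩ B) := measureReal_nonneg
  have h2' : 0 ≤ μ.real A := measureReal_nonneg
  have h3' : 0 ≤ μ.real B := measureReal_nonneg
  rw [abs_le]
  constructor <;> nlinarith

theorem le_alphaMix {E : Type*} [MeasurableSpace E] (U : ℤ → Ω → E) (t : ℤ) (s : ℕ) {A B : Set Ω}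
    (hA : MeasurableSet[sigmaPast U t] A) (hB : MeasurableSet[sigmaFuture U (t + s)] B) :
    |μ.real (A ∩ B) - μ.real A * μ.real B| ≤ alphaMix μ U s :=
  le_csSup ⟨1, by rintro _ ⟨t, A, B, _, _, rfl⟩; exact abs_measureReal_inter_sub_le_one A B⟩
    ⟨t, A, B, hA, hB, rfl⟩

theorem alphaMix_nonneg {E : Type*} [MeasurableSpace E] (U : ℤ → Ω → E) (s : ℕ) : 0 ≤ alphaMix μ U s :=
  (abs_nonneg _).trans (le_alphaMix U 0 s (@MeasurableSet.empty _ (_)) (@MeasurableSet.empty _ (_)))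

theorem alphaMix_le_one {E : Type*} [MeasurableSpace E] (U : ℤ → Ω → E) (s : ℕ) : alphaMix μ U s ≤ 1 :=
  csSup_le ⟨_, 0, ∅, ∅, @MeasurableSet.empty _ (_), @MeasurableSet.empty _ (_), rfl⟩ (by
    rintro _ ⟨t, A, B, _, _, rfl⟩; exact abs_measureReal_inter_sub_le_one A B)

/-- Mixing coefficients of the observations `(W_t, Y_t, Z_t)`. -/
def obsMixing (μ : Measure Ω) (X : ℤ → Ω → Fin dx → ℝ) (Y : ℤ → Ω → Fin dy → ℝ) (Z : ℤ → Ω → Fin dz → ℝ) (p : ℕ)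
    (s : ℕ) : ℝ := if s ≤ p then 2 else 4 * alphaMix μ (obs X Y Z) (s - p)

/-- Mixing coefficients lie in `[0, 1]`, the exponent `η / (2m + η)` is at most `1` and the
polynomial weight is at least `1`, so each coefficient is at most the corresponding term of the
assumed series. The finitely many lags up to `p` do not matter. -/
theorem summable_obsMixing {m : ℕ} {η : ℝ} (hMix : MixingAssumption μ X Y Z p m η) :
    Summable (obsMixing μ X Y Z p) := by
  obtain ⟨-, hm, hη, hsum, -⟩ := hMix
  rw [← summable_nat_add_iff (p + 1)]
  refine Summable.of_nonneg_of_le (fun s => ?_) (fun s => ?_) (hsum.mul_left 4)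
  · unfold obsMixing
    split_ifs
    · norm_num
    · exact mul_nonneg (by norm_num) (alphaMix_nonneg _ _)
  · have h1 : ¬ (s + (p + 1) ≤ p) := by omega
    have h2 : s + (p + 1) - p = s + 1 := by omega
    simp only [obsMixing, h1, if_false, h2]
    have h0 := alphaMix_nonneg (μ := μ) (obs X Y Z) (s + 1)
    have h01 := alphaMix_le_one (μ := μ) (obs X Y Z) (s + 1)
    have he : η / (2 * m + η) ≤ 1 := by
      rw [div_le_one (by positivity)]
      have : (0 : ℝ) ≤ m := by positivity
      linarith
    have h3 := Real.rpow_le_rpow_of_exponent_ge' h0 h01 (by positivity) he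
    rw [Real.rpow_one] at h3
    have h4 : (1 : ℝ) ≤ ((s : ℝ) + 1) ^ (2 * m - 1) := one_le_pow₀ (by linarith [Nat.cast_nonneg (α := ℝ) s])
    have h5 := Real.rpow_nonneg h0 (η / (2 * m + η))
    nlinarith

theorem abs_cov_le_two {f g : Ω → ℝ} (hf1 : ∀ ω, |f ω| ≤ 1) (hg1 : ∀ ω, |g ω| ≤ 1) :
    |∫ ω, f ω * g ω ∂μ - (∫ ω, f ω ∂μ) * ∫ ω, g ω ∂μ| ≤ 2 := by
  have h1 : ∀ {u : Ω → ℝ}, (∀ ω, |u ω| ≤ 1) → |∫ ω, u ω ∂μ| ≤ 1 := fun {u} hu => by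
    have := norm_integral_le_of_norm_le_const (μ := μ) (f := u) (C := 1) (.of_forall hu)
    simpa using this
  have h2 := h1 (u := fun ω => f ω * g ω) fun ω => by
    rw [abs_mul]; exact mul_le_one₀ (hf1 ω) (abs_nonneg _) (hg1 ω)
  have h3 : |(∫ ω, f ω ∂μ) * ∫ ω, g ω ∂μ| ≤ 1 := by
    rw [abs_mul]; exact mul_le_one₀ (h1 hf1) (abs_nonneg _) (h1 hg1)
  exact (abs_sub _ _).trans (by linarith)

/-- The window at `s` reaches back to `s - p`, which leaves a gap `|t - s| - p` between past and
future. If there is no gap, the trivial bound `2` is used. -/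
theorem abs_cov_obsVec_le (hX : ∀ t, Measurable (X t)) (hY : ∀ t, Measurable (Y t)) (hZ : ∀ t, Measurable (Z t))
    {t s : ℤ} (hts : t ≤ s) {f g : ObsSpace (WIdx p dx dy dz) dy dz → ℝ} (hf : Measurable f) (hg : Measurable g)
    (hf1 : ∀ x, |f x| ≤ 1) (hg1 : ∀ x, |g x| ≤ 1) :
    |∫ ω, f (obsVec X Y Z p t ω) * g (obsVec X Y Z p s ω) ∂μ -
      (∫ ω, f (obsVec X Y Z p t ω) ∂μ) * ∫ ω, g (obsVec X Y Z p s ω) ∂μ| ≤ obsMixing μ X Y Z p (t - s).natAbs := by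
  unfold obsMixing
  split_ifs with hp
  · exact abs_cov_le_two (fun ω => hf1 _) (fun ω => hg1 _)
  · have hobs := measurable_obs hX hY hZ
    have hA : sigmaPast (obs X Y Z) t ≤ ‹MeasurableSpace Ω› :=
      iSup₂_le fun r _ => (hobs r).comap_le
    have hB : sigmaFuture (obs X Y Z) (s - p) ≤ ‹MeasurableSpace Ω› :=
      iSup₂_le fun r _ => (hobs r).comap_le
    refine abs_cov_le hA hB (fun A B hA' hB' => ?_) (hf.comp (measurable_obsVec_sigmaPast t))
      (hg.comp (measurable_obsVec_sigmaFuture s)) (fun ω => hf1 _) (fun ω => hg1 _)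
    refine le_alphaMix _ t _ hA' ?_
    have e : t + (((t - s).natAbs - p : ℕ) : ℤ) = s - p := by omega
    rw [e]
    exact hB'

theorem mixingSequence_obsVec (hX : ∀ t, Measurable (X t)) (hY : ∀ t, Measurable (Y t))
    (hZ : ∀ t, Measurable (Z t)) {m : ℕ} {η : ℝ} (hMix : MixingAssumption μ X Y Z p m η) :
    MixingSequence μ (obsVec X Y Z p) (μ.map (obsVec X Y Z p 0)) (obsMixing μ X Y Z p) where
  measurable := measurable_obsVec hX hY hZ
  map_eq := map_obsVec_eq hX hY hZ hMix.1
  nonneg s := by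
    unfold obsMixing
    split_ifs
    · norm_num
    · exact mul_nonneg (by norm_num) (alphaMix_nonneg _ _)
  summable := summable_obsMixing hMix
  cov_le t s f g hf hg hf1 hg1 := by
    have e : ∀ (t : ℤ) {f : ObsSpace (WIdx p dx dy dz) dy dz → ℝ}, Measurable f →
        ∫ x, f x ∂(μ.map (obsVec X Y Z p 0)) = ∫ ω, f (obsVec X Y Z p t ω) ∂μ := fun t f hf => by
      rw [← map_obsVec_eq hX hY hZ hMix.1 t, integral_map (measurable_obsVec hX hY hZ t).aemeasurable
        hf.aestronglyMeasurable]
    rw [e t hf, e s hg]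
    rcases le_total t s with h | h
    · exact abs_cov_obsVec_le hX hY hZ h hf hg hf1 hg1
    · have := abs_cov_obsVec_le (μ := μ) hX hY hZ h hg hf hg1 hf1
      rw [← Int.natAbs_neg, neg_sub]
      simpa only [mul_comm] using this

end Series

/-! ### Densities, bandwidths and the kernel design -/

section Densities

theorem HasDensityLE.map_measurePreserving {E E' : Type*} [MeasureSpace E] [MeasureSpace E'] {P : Measure E}
    {M : ℝ≥0} (hP : HasDensityLE P M) (e : E ≃ᵐ E') (he : MeasurePreserving e) : HasDensityLE (P.map e) M := by
  obtain ⟨f, hf, hle, rfl⟩ := hP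
  refine ⟨f ∘ e.symm, hf.comp e.symm.measurable, fun x => hle _, ?_⟩
  ext s hs
  rw [Measure.map_apply e.measurable hs, withDensity_apply _ (e.measurable hs), withDensity_apply _ hs,
    ← he.setLIntegral_comp_preimage_emb e.measurableEmbedding]
  simp

theorem HasDensityLE.le_smul {E : Type*} [MeasureSpace E] {P : Measure E} {M : ℝ≥0} (hP : HasDensityLE P M) :
    P ≤ (M : ℝ≥0∞) • volume := by
  obtain ⟨f, hf, hle, rfl⟩ := hP
  rw [← withDensity_const]
  exact withDensity_mono (.of_forall hle)

theorem HasDensityLE.absolutelyContinuous {E : Type*} [MeasureSpace E] {P : Measure E} {M : ℝ≥0}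
    (hP : HasDensityLE P M) : P ≪ volume := by
  obtain ⟨f, hf, hle, rfl⟩ := hP
  exact withDensity_absolutelyContinuous _ _

theorem nullSingletonClass_map_eval {E : Type*} [MeasurableSpace E] {Q : Measure E} {d : ℕ} {y : E → Fin d → ℝ}
    (hy : Measurable y) (hac : Q.map y ≪ volume) (i : Fin d) : NullSingletonClass (Q.map fun x => y x i) := by
  have h1 : (Q.map fun x => y x i) = (Q.map y).map fun v => v i := by
    rw [Measure.map_map (measurable_pi_apply i) hy]; rfl
  have h2 : (Q.map y).map (fun v => v i) ≪ (volume : Measure ℝ) :=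
    (hac.map (measurable_pi_apply i)).trans
      (Measure.quasiMeasurePreserving_eval (fun _ : Fin d => (volume : Measure ℝ)) i).absolutelyContinuous
  rw [h1]
  exact ⟨fun x => h2 (measure_singleton x)⟩

variable {Ω : Type*} {dx dy dz : ℕ} {X : ℤ → Ω → Fin dx → ℝ} {Y : ℤ → Ω → Fin dy → ℝ}
  {Z : ℤ → Ω → Fin dz → ℝ} {p : ℕ} [MeasurableSpace Ω] {μ : Measure Ω} [IsProbabilityMeasure μ]

/-- The density assumption concerns indices at least `1`; stationarity transports it to index `0`.
-/
theorem exists_hasDensityLE_condVec (hX : ∀ t, Measurable (X t)) (hY : ∀ t, Measurable (Y t))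
    (hZ : ∀ t, Measurable (Z t)) (hs : StrictlyStationary μ (obs X Y Z)) (hJ : JointDensityAssumption μ X Y Z p) :
    ∃ M, HasDensityLE (μ.map (condVec X Y Z p 0)) M := by
  obtain ⟨M, hM⟩ := hJ 1 one_pos
  refine ⟨M, ?_⟩
  have h1 := hM (fun _ => 1) (fun _ => le_rfl) (fun a b hab => (hab (Subsingleton.elim a b)).elim)
  have h2 := h1.map_measurePreserving (MeasurableEquiv.funUnique (Fin 1) (WSpace p dx dy dz))
    (volume_preserving_funUnique (Fin 1) (WSpace p dx dy dz))
  have hm := measurable_condVec (p := p) hX hY hZ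
  have e0 : ∀ t, μ.map (condVec X Y Z p t) = (μ.map (obsVec X Y Z p t)).map Prod.fst := fun t => by
    rw [Measure.map_map measurable_fst (measurable_obsVec hX hY hZ t)]; rfl
  rw [Measure.map_map (MeasurableEquiv.measurable _) (measurable_pi_lambda _ fun _ => hm 1)] at h2
  rw [e0 0, ← map_obsVec_eq hX hY hZ hs 1, ← e0 1]
  exact h2

theorem exists_joint_density_le (hX : ∀ t, Measurable (X t)) (hY : ∀ t, Measurable (Y t))
    (hZ : ∀ t, Measurable (Z t)) (hJ : JointDensityAssumption μ X Y Z p) :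
    ∃ M : ℝ≥0, ∀ t s : ℤ, 1 ≤ t → 1 ≤ s → t ≠ s → (p : ℤ) ≤ |t - s| →
      HasDensityLE (μ.map (fun ω => (condVec X Y Z p t ω, condVec X Y Z p s ω))) M := by
  obtain ⟨M, hM⟩ := hJ 2 two_pos
  refine ⟨M, fun t s ht hs hts hp => ?_⟩
  have hm := measurable_condVec (p := p) hX hY hZ
  have h1 := hM ![t, s] (fun a => by fin_cases a <;> simp [ht, hs]) (fun a b hab => by
    fin_cases a <;> fin_cases b
    · exact (hab rfl).elim
    · simpa using hp
    · simpa [abs_sub_comm] using hp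
    · exact (hab rfl).elim)
  have h2 := h1.map_measurePreserving (MeasurableEquiv.finTwoArrow (α := WSpace p dx dy dz))
    (volume_preserving_finTwoArrow (WSpace p dx dy dz))
  rw [Measure.map_map (MeasurableEquiv.measurable _) (measurable_pi_lambda _ fun _ => hm _)] at h2
  exact h2

theorem card_WIdx (p dx dy dz : ℕ) : Fintype.card (WIdx p dx dy dz) = dimW p dx dy dz := by
  simp [dimW, add_assoc]

/-- `√n h^d` is the square root of `n h^{2d}`, and dividing by a power of `log n` only makes this
smaller once `n ≥ 3`. -/
theorem BandwidthAssumption.rate {h : ℕ → ℝ} {dw l : ℕ} (hb : BandwidthAssumption h dw l) :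
    Tendsto (fun n : ℕ => √n * h n ^ dw) atTop atTop := by
  obtain ⟨hpos, -, ⟨ξ, hξ, hlim⟩, -⟩ := hb
  have h1 : Tendsto (fun n : ℕ => √(n * h n ^ (2 * dw) / Real.log n ^ ξ)) atTop atTop :=
    Real.tendsto_sqrt_atTop.comp hlim
  refine tendsto_atTop_mono' atTop ?_ h1
  filter_upwards [eventually_ge_atTop 3] with n hn
  have hn3 : (3 : ℝ) ≤ n := by exact_mod_cast hn
  have hlog : 1 ≤ Real.log n := by
    rw [Real.le_log_iff_exp_le (by linarith)]
    linarith [Real.exp_one_lt_d9]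
  have h2 : 1 ≤ Real.log n ^ ξ := Real.one_le_rpow hlog hξ.le
  have h3 := hpos n
  have e : √n * h n ^ dw = √(n * h n ^ (2 * dw)) := by
    rw [Real.sqrt_mul (by positivity), mul_comm 2 dw, pow_mul, Real.sqrt_sq (by positivity)]
  rw [e]
  exact Real.sqrt_le_sqrt (div_le_self (by positivity) h2)

/-- The conditional law of `(Y_t, Z_t)` given `W_t`. -/
abbrev condLaw (μ : Measure Ω) [IsFiniteMeasure μ] (X : ℤ → Ω → Fin dx → ℝ) (Y : ℤ → Ω → Fin dy → ℝ)
    (Z : ℤ → Ω → Fin dz → ℝ) (p : ℕ) : Kernel (WSpace p dx dy dz) ((Fin dy → ℝ) × (Fin dz → ℝ)) :=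
  condDistrib (fun ω => (Y 0 ω, Z 0 ω)) (condVec X Y Z p 0) μ

theorem map_obsVec_eq_compProd (hY : ∀ t, Measurable (Y t)) (hZ : ∀ t, Measurable (Z t)) :
    μ.map (obsVec X Y Z p 0) = μ.map (condVec X Y Z p 0) ⊗ₘ condLaw μ X Y Z p :=
  (compProd_map_condDistrib ((hY 0).prodMk (hZ 0)).aemeasurable).symm

theorem kernelDesign_obsVec (hX : ∀ t, Measurable (X t)) (hY : ∀ t, Measurable (Y t))
    (hZ : ∀ t, Measurable (Z t)) {m l : ℕ} {η : ℝ} {h : ℕ → ℝ} (hMix : MixingAssumption μ X Y Z p m η)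
    (hJ : JointDensityAssumption μ X Y Z p) (hb : BandwidthAssumption h (dimW p dx dy dz) l) :
    KernelDesign μ (obsVec X Y Z p) (μ.map (condVec X Y Z p 0) ⊗ₘ condLaw μ X Y Z p) (obsMixing μ X Y Z p)
      Prod.fst h where
  mixing := by
    rw [← map_obsVec_eq_compProd hY hZ]
    exact mixingSequence_obsVec hX hY hZ hMix
  measurable_proj := measurable_fst
  density := by
    obtain ⟨M, hM⟩ := exists_hasDensityLE_condVec hX hY hZ hMix.1 hJ
    have : IsProbabilityMeasure (μ.map (condVec X Y Z p 0)) :=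
      Measure.isProbabilityMeasure_map (measurable_condVec hX hY hZ 0).aemeasurable
    refine ⟨M, ?_⟩
    have e : (μ.map (condVec X Y Z p 0) ⊗ₘ condLaw μ X Y Z p).map Prod.fst = μ.map (condVec X Y Z p 0) :=
      Measure.fst_compProd _ _
    rw [e]
    exact hM.le_smul
  joint_density := by
    obtain ⟨M, hM⟩ := exists_joint_density_le hX hY hZ hJ
    exact ⟨p, M, fun t s ht hs hts hp => (hM t s ht hs hts hp).le_smul⟩
  bandwidth_pos := hb.1
  bandwidth_tendsto := hb.2.1
  rate := by
    rw [card_WIdx]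
    exact hb.rate

end Densities

/-! ### Product kernels -/

section Kernel

variable {ι : Type*} [Fintype ι] {k : ℝ → ℝ} {l : ℕ}

/-- The order `l` is positive, since for `l = 0` the condition `n h^{2l} → 0` would say `n → 0`.
Hence the moment condition of order `0` is available. -/
theorem KernelAssumption.integral_eq_one (hk : KernelAssumption k l) {h : ℕ → ℝ} {dw : ℕ}
    (hb : BandwidthAssumption h dw l) : Integrable k ∧ ∫ x, k x = 1 := by
  have hl : 0 < l := by
    rcases l.eq_zero_or_pos with rfl | hl
    · have := hb.2.2.2
      simp only [mul_zero, pow_zero, mul_one] at this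
      exact (not_tendsto_nhds_of_tendsto_atTop tendsto_natCast_atTop_atTop 0 this).elim
    · exact hl
  have := hk.2.2.2.1 0 hl
  simpa using this

theorem measurable_prodKernel (hk : Measurable k) : Measurable (prodKernel (ι := ι) k) := by
  unfold prodKernel
  exact Finset.measurable_fun_prod _ fun j _ => hk.comp (measurable_pi_apply j)

theorem integrable_prodKernel (hk : Integrable k) : Integrable (prodKernel (ι := ι) k) :=
  Integrable.fintype_prod fun _ => hk

theorem integral_prodKernel (hk : ∫ x, k x = 1) : ∫ u, prodKernel (ι := ι) k u = 1 := by
  unfold prodKernel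
  rw [integral_fintype_prod_volume_eq_pow k, hk, one_pow]

theorem abs_prodKernel_le {B : ℝ} (hB : ∀ x, |k x| ≤ B) (u : ι → ℝ) :
    |prodKernel k u| ≤ B ^ Fintype.card ι := by
  unfold prodKernel
  rw [Finset.abs_prod]
  exact (Finset.prod_le_prod (fun _ _ => abs_nonneg _) fun j _ => hB _).trans (by simp)

theorem KernelDesign.tailCondition_of_majorant {Ω E : Type*} [MeasurableSpace Ω] [MeasurableSpace E]
    {μ : Measure Ω} [IsProbabilityMeasure μ] {V : ℤ → Ω → E} {Q : Measure E} {a : ℕ → ℝ} {π : E → ι → ℝ} {h : ℕ → ℝ}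
    (hD : KernelDesign μ V Q a π h) (hk : HasMonotoneMajorant k) : TailCondition μ V π (prodKernel k) h := by
  obtain ⟨ν, ψ, hν, hψ, hψm, hψi, hle⟩ := hk.exists_charFun
  refine hD.tailCondition_of_charFun hψ hψm hψi (fun t => (abs_nonneg _).trans (hle t)) fun u => ?_
  unfold prodKernel
  rw [Finset.abs_prod]
  exact Finset.prod_le_prod (fun _ _ => abs_nonneg _) fun j _ => hle _

end Kernel

/-! ### What a vanishing limit says about the conditional law -/

section Detection

variable {ι 𝕜 : Type*} [Fintype ι] [RCLike 𝕜] {dy dz : ℕ}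
variable {P : Measure (ι → ℝ)} {κ : Kernel (ι → ℝ) ((Fin dy → ℝ) × (Fin dz → ℝ))}
  {φ : (ι → ℝ) → (ι → ℝ) → 𝕜} {𝒲 : Set (ι → ℝ)} {fW : (ι → ℝ) → ℝ≥0∞} {M : ℝ≥0}

theorem ae_density_ne_zero (hfW : Measurable fW) (hle : ∀ u, fW u ≤ M) (hP : P = volume.withDensity fW) :
    ∀ᵐ u ∂P, (fW u).toReal ≠ 0 := by
  rw [hP, ae_withDensity_iff hfW]
  exact .of_forall fun u hu => ENNReal.toReal_ne_zero.2 ⟨hu, ((hle u).trans_lt (by simp)).ne⟩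

/-- The density factor can be dropped, as `f_W` does not vanish at almost every value of `W`. -/
theorem dependence_ae_eq_zero_iff (hfW : Measurable fW) (hle : ∀ u, fW u ≤ M) (hP : P = volume.withDensity fW)
    (r : (Fin dy → ℝ) × (Fin dz → ℝ)) : dependence κ fW r =ᵐ[P] 0 ↔ ∀ᵐ u ∂P, (κ u).real (Set.Iic r) =
      (κ u).fst.real (Set.Iic r.1) * (κ u).snd.real (Set.Iic r.2) := by
  have hne := ae_density_ne_zero hfW hle hP
  constructor
  · intro h
    filter_upwards [h, hne] with u hu h0
    simp only [dependence, Pi.zero_apply, mul_eq_zero, h0, or_false] at hu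
    linarith
  · intro h
    filter_upwards [h] with u hu
    simp [dependence, hu]

theorem measurable_dependence_prod [IsMarkovKernel κ] (hfW : Measurable fW) :
    Measurable fun q : ((Fin dy → ℝ) × (Fin dz → ℝ)) × (ι → ℝ) => dependence κ fW q.1 q.2 := by
  have h1 : Measurable fun q : ((Fin dy → ℝ) × (Fin dz → ℝ)) × (ι → ℝ) => (κ q.2).real (Set.Iic q.1) :=
    (measurable_kernel_Iic κ).comp (measurable_snd.prodMk measurable_fst)
  have h2 : Measurable fun q : ((Fin dy → ℝ) × (Fin dz → ℝ)) × (ι → ℝ) => (κ q.2).fst.real (Set.Iic q.1.1) := by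
    have h := (measurable_kernel_Iic κ.fst).comp
      (f := fun q : ((Fin dy → ℝ) × (Fin dz → ℝ)) × (ι → ℝ) => (q.2, q.1.1)) (by fun_prop)
    simp only [Function.comp_def, Kernel.fst_apply] at h
    exact h
  have h3 : Measurable fun q : ((Fin dy → ℝ) × (Fin dz → ℝ)) × (ι → ℝ) => (κ q.2).snd.real (Set.Iic q.1.2) := by
    have h := (measurable_kernel_Iic κ.snd).comp
      (f := fun q : ((Fin dy → ℝ) × (Fin dz → ℝ)) × (ι → ℝ) => (q.2, q.1.2)) (by fun_prop)
    simp only [Function.comp_def, Kernel.snd_apply] at h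
    exact h
  exact (h1.sub (h2.mul h3)).mul (hfW.ennreal_toReal.comp measurable_snd)

theorem measurableSet_dependence_ae_eq_zero [IsMarkovKernel κ] [IsProbabilityMeasure P] (hfW : Measurable fW) :
    MeasurableSet {r | dependence κ fW r =ᵐ[P] 0} := by
  have hm := measurable_dependence_prod (κ := κ) hfW
  have h1 : Measurable fun r => ∫⁻ u, ‖dependence κ fW r u‖ₑ ∂P := hm.enorm.lintegral_prod_right'
  have h2 : {r | dependence κ fW r =ᵐ[P] 0} = (fun r => ∫⁻ u, ‖dependence κ fW r u‖ₑ ∂P) ⁻¹' {0} := by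
    ext r
    simp only [Set.mem_ofPred_eq, Set.mem_preimage, Set.mem_singleton_iff]
    rw [lintegral_eq_zero_iff (measurable_dependence hfW r).enorm]
    refine eventually_congr (.of_forall fun u => ?_)
    simp
  rw [h2]
  exact h1 (measurableSet_singleton 0)

/-- If a generically revealing weight detects no dependence at almost all observations, then `Y` and
`Z` are conditionally independent. -/
theorem ae_kernel_eq_prod_of_indepLimit [IsProbabilityMeasure P] [IsMarkovKernel κ] (hfW : Measurable fW)
    (hle : ∀ u, fW u ≤ M) (hP : P = volume.withDensity fW) (hφ : IsGCR P 𝒲 φ) (h𝒲 : ∀ᵐ u ∂P, u ∈ 𝒲)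
    (hosc : HasSmallOscillation (𝒲 ×ˢ Set.univ) (indepLimit P κ fW φ))
    (hac : P ⊗ₘ κ ≪ (volume : Measure (ι → ℝ)).prod volume)
    (hzero : ∀ᵐ v ∂(P ⊗ₘ κ), indepLimit P κ fW φ v = 0) :
    ∀ᵐ u ∂P, κ u = (κ u).fst.prod (κ u).snd := by
  have : SigmaFinite (volume : Measure ((Fin dy → ℝ) × (Fin dz → ℝ))) :=
    inferInstanceAs (SigmaFinite (volume.prod volume))
  refine ae_kernel_eq_prod P κ volume hac ?_
  simp_rw [← dependence_ae_eq_zero_iff (κ := κ) hfW hle hP]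
  set Λ := (P ⊗ₘ κ).snd with hΛ
  have hQ : P ⊗ₘ κ ≪ P.prod Λ := by
    have := absolutelyContinuous_fst_prod_snd hac
    rwa [Measure.fst_compProd] at this
  have hPv : P ≪ volume := by rw [hP]; exact withDensity_absolutelyContinuous _ _
  have hS : ∀ᵐ v ∂(P.prod Λ), v ∈ 𝒲 ×ˢ (Set.univ : Set ((Fin dy → ℝ) × (Fin dz → ℝ))) := by
    have h1 := (Measure.quasiMeasurePreserving_fst (μ := P) (ν := Λ)).ae h𝒲
    filter_upwards [h1] with v hv
    exact ⟨hv, trivial⟩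
  have hLm : AEMeasurable (indepLimit P κ fW φ) (P.prod Λ) := hosc.aemeasurable hS
  set L' := hLm.mk with hL'
  have hA := measurableSet_dependence_ae_eq_zero (κ := κ) (P := P) hfW
  set A := {r | dependence κ fW r =ᵐ[P] 0} with hAdef
  have hset : MeasurableSet {v : ObsSpace ι dy dz | v.2 ∉ A → L' v ≠ 0} := by
    have e : {v : ObsSpace ι dy dz | v.2 ∉ A → L' v ≠ 0} = (Prod.snd ⁻¹' A) ∪ (L' ⁻¹' {0})ᶜ := by
      ext v
      simp only [Set.mem_ofPred_eq, Set.mem_union, Set.mem_preimage, Set.mem_compl_iff, Set.mem_singleton_iff]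
      tauto
    rw [e]
    exact (measurable_snd hA).union (hLm.measurable_mk (measurableSet_singleton 0)).compl
  -- For each fixed `r` outside `A` the generic revealing property gives a nonzero limit for
  -- Lebesgue-almost every `w ∈ 𝒲`, hence for `P`-almost every `w`. Fubini, applied to the
  -- measurable version `L'`, makes this a statement about pairs.
  have hprod : ∀ᵐ v ∂(P.prod Λ), v.2 ∉ A → L' v ≠ 0 := by
    rw [Measure.ae_prod_iff_ae_ae hset, Measure.ae_ae_comm hset]
    have h2 : ∀ᵐ v ∂(Λ.prod P), indepLimit P κ fW φ v.swap = L' v.swap := by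
      have := (Measure.measurePreserving_swap (μ := Λ) (ν := P)).quasiMeasurePreserving.ae hLm.ae_eq_mk
      exact this
    have h3 := Measure.ae_ae_of_ae_prod h2
    filter_upwards [h3] with r hr
    by_cases hrA : r ∈ A
    · exact .of_forall fun w hw => (hw hrA).elim
    · have h4 := hPv.ae_le (hφ _ (measurable_dependence hfW r) ⟨M, abs_dependence_le hle r⟩ hrA)
      filter_upwards [hr, h4, h𝒲] with w hw h5 hw𝒲 _
      have hw' : indepLimit P κ fW φ (w, r) = L' (w, r) := hw
      rw [← hw']
      exact h5 hw𝒲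
  -- By absolute continuity the previous statement also holds for the joint law, under which the
  -- limit is assumed to vanish. So almost every value `r` lies in `A`.
  have hL : ∀ᵐ v ∂(P ⊗ₘ κ), v.2 ∈ A := by
    filter_upwards [hQ.ae_le hprod, hQ.ae_le hLm.ae_eq_mk, hzero] with v h1 h2 h3
    by_contra hv
    exact h1 hv (h2.symm.trans h3)
  rw [hΛ, Measure.snd]
  exact (ae_map_iff measurable_snd.aemeasurable hA).2 hL

end Detection

/-! ### Divergence and consistency -/

section Consistency

variable {Ω : Type*} [MeasurableSpace Ω] {μ : Measure Ω}

theorem consistentTests_of_tendstoInMeasure {T : ℕ → Ω → ℝ} {r : ℕ → ℝ} (hr : Tendsto r atTop atTop) {c : ℝ}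
    (hc : 0 < c) (hT : TendstoInMeasure μ (fun n ω => (r n)⁻¹ * T n ω) atTop fun _ => c) :
    DivergesInProbability μ T ∧ ConsistentTests μ T := by
  have hdiv : DivergesInProbability μ T := by
    intro M
    refine tendsto_measure_zero_of_eventually_subset (tendstoInMeasure_iff_norm.1 hT (c / 2) (by positivity)) ?_
    filter_upwards [hr.eventually_gt_atTop (2 * |M| / c), hr.eventually_gt_atTop 0] with n hn hn0 ω hω
    simp only [Set.mem_ofPred_eq] at hω ⊢
    rw [div_lt_iff₀ hc] at hn
    have h1 : (r n)⁻¹ * T n ω ≤ c / 2 := by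
      rw [inv_mul_le_iff₀ hn0]
      linarith [le_abs_self M]
    rw [Real.norm_eq_abs, abs_sub_comm]
    exact le_trans (by linarith) (le_abs_self _)
  refine ⟨hdiv, fun κ hκ => ?_⟩
  rw [ENNReal.tendsto_nhds_zero]
  intro ε hε
  have hε2 : 0 < ε / 2 := ENNReal.half_pos hε.ne'
  obtain ⟨M, hM⟩ := hκ (ε / 2) hε2
  filter_upwards [hM, ENNReal.tendsto_nhds_zero.1 (hdiv M) (ε / 2) hε2] with n h1 h2
  calc μ {ω | T n ω ≤ κ n ω} ≤ μ ({ω | M < |κ n ω|} ∪ {ω | T n ω ≤ M}) := by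
        refine measure_mono fun ω hω => ?_
        simp only [Set.mem_ofPred_eq, Set.mem_union] at hω ⊢
        by_cases h : M < |κ n ω|
        · exact Or.inl h
        · exact Or.inr (hω.trans ((le_abs_self _).trans (not_lt.1 h)))
    _ ≤ ε / 2 + ε / 2 := (measure_union_le _ _).trans (add_le_add h1 h2)
    _ = ε := ENNReal.add_halves ε

end Consistency

/-! ### Weights controlled only on the support -/

section Cutoff

variable {ι 𝕜 : Type*} [Fintype ι] [RCLike 𝕜]

/-- The weight `φ(u, w)`, set to zero for `u` outside the support of `P`. -/
def cutoff (P : Measure (ι → ℝ)) (φ : (ι → ℝ) → (ι → ℝ) → 𝕜) (u w : ι → ℝ) : 𝕜 :=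
  P.support.indicator (fun u => φ u w) u

theorem cutoff_of_mem {P : Measure (ι → ℝ)} {φ : (ι → ℝ) → (ι → ℝ) → 𝕜} {u : ι → ℝ} (hu : u ∈ P.support) (w : ι → ℝ) :
    cutoff P φ u w = φ u w := Set.indicator_of_mem hu _

theorem cutoff_of_notMem {P : Measure (ι → ℝ)} {φ : (ι → ℝ) → (ι → ℝ) → 𝕜} {u : ι → ℝ} (hu : u ∉ P.support) (w : ι → ℝ) :
    cutoff P φ u w = 0 := Set.indicator_of_notMem hu _

/-- The bounds on `φ` are assumed only for `u` in the support of the law of `W_t`. Cutting `φ` off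
outside makes them global, and changes neither the limit nor, almost surely, the statistics. -/
theorem WeightAssumption.exists_regularWeights {P : Measure (ι → ℝ)} [IsProbabilityMeasure P] {𝒲 : Set (ι → ℝ)}
    {φ : (ι → ℝ) → (ι → ℝ) → 𝕜} {ν : ℝ} (hφ : WeightAssumption P 𝒲 φ ν) :
    ∃ B C, RegularWeights P 𝒲 (cutoff P φ) B C ν := by
  obtain ⟨hm, ⟨B, hB⟩, -, hν, -, C, hCm, hC2, hC⟩ := hφ
  refine ⟨|B|, fun u => |C u|, ⟨fun w hw => ?_, abs_nonneg _, fun u w hw => ?_, hν, hCm.abs, fun u => abs_nonneg _,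
    (hC2.integrable one_le_two).abs, fun u w hw w' hw' => ?_⟩⟩
  · exact (hm w hw).indicator Measure.isClosed_support.measurableSet
  · by_cases hu : u ∈ P.support
    · rw [cutoff_of_mem hu]
      exact (hB u hu w hw).trans (le_abs_self _)
    · rw [cutoff_of_notMem hu, norm_zero]
      exact abs_nonneg _
  · by_cases hu : u ∈ P.support
    · rw [cutoff_of_mem hu, cutoff_of_mem hu]
      exact (hC u hu w hw w' hw').trans (mul_le_mul_of_nonneg_right (le_abs_self _) (by positivity))
    · rw [cutoff_of_notMem hu, cutoff_of_notMem hu, sub_zero, norm_zero]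
      positivity

theorem indepLimit_cutoff {dy dz : ℕ} {P : Measure (ι → ℝ)} {κ : Kernel (ι → ℝ) ((Fin dy → ℝ) × (Fin dz → ℝ))}
    {fW : (ι → ℝ) → ℝ≥0∞} {φ : (ι → ℝ) → (ι → ℝ) → 𝕜} :
    indepLimit P κ fW (cutoff P φ) = indepLimit P κ fW φ := by
  ext q
  refine integral_congr_ae ?_
  filter_upwards [Measure.support_mem_ae (μ := P)] with u hu
  rw [cutoff_of_mem hu]

theorem indepStat_cutoff {Ω : Type*} {dy dz : ℕ} {V : ℤ → Ω → ObsSpace ι dy dz} {K : (ι → ℝ) → ℝ} {h : ℕ → ℝ}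
    {P : Measure (ι → ℝ)} {φ : (ι → ℝ) → (ι → ℝ) → 𝕜} {ω : Ω} (hω : ∀ t, (V t ω).1 ∈ P.support) (n : ℕ)
    (q : ObsSpace ι dy dz) : indepStat V K h (cutoff P φ) n q ω = indepStat V K h φ n q ω := by
  simp only [indepStat, summand, cutoff_of_mem (hω _)]

end Cutoff

/-! ### Translation between the time series and the abstract setting -/

section Link

variable {Ω : Type*} [MeasurableSpace Ω] {μ : Measure Ω} [IsProbabilityMeasure μ] {𝕜 : Type*} [RCLike 𝕜]
  {dx dy dz p : ℕ} {X : ℤ → Ω → Fin dx → ℝ} {Y : ℤ → Ω → Fin dy → ℝ} {Z : ℤ → Ω → Fin dz → ℝ}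

theorem inv_sqrt_smul_empS (φ : WSpace p dx dy dz → WSpace p dx dy dz → 𝕜) (k : ℝ → ℝ) (h : ℕ → ℝ) (n : ℕ)
    (w : WSpace p dx dy dz) (y : Fin dy → ℝ) (z : Fin dz → ℝ) (ω : Ω) :
    (√(n : ℝ))⁻¹ • empS X Y Z p φ k h n w y z ω =
      indepStat (obsVec X Y Z p) (prodKernel k) h φ n (w, (y, z)) ω := by
  unfold empS indepStat
  rw [smul_smul, smul_smul]
  simp_rw [Finset.smul_sum]
  refine Finset.sum_congr rfl fun t _ => Finset.sum_congr rfl fun s _ => ?_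
  simp only [scaledKernel, summand, obsVec, card_WIdx, smul_smul]
  congr 1
  rcases n.eq_zero_or_pos with rfl | hn
  · simp
  have hn' : (0 : ℝ) < n := by exact_mod_cast hn
  have e : (√(n : ℝ))⁻¹ * (1 / (√(n : ℝ) * ((n : ℝ) - 1) * h n ^ dimW p dx dy dz)) =
      (n : ℝ) / ((n : ℝ) - 1) * ((n : ℝ) ^ 2)⁻¹ * (h n ^ dimW p dx dy dz)⁻¹ := by
    have h1 : (√(n : ℝ))⁻¹ * (√(n : ℝ))⁻¹ = (n : ℝ)⁻¹ := by
      rw [← mul_inv, Real.mul_self_sqrt hn'.le]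
    have h2 : (n : ℝ) * ((n : ℝ) ^ 2)⁻¹ = (n : ℝ)⁻¹ := by field_simp
    rw [one_div, mul_inv, mul_inv, div_eq_mul_inv]
    calc _ = ((√(n : ℝ))⁻¹ * (√(n : ℝ))⁻¹) * ((n : ℝ) - 1)⁻¹ * (h n ^ dimW p dx dy dz)⁻¹ := by ring
      _ = ((n : ℝ) * ((n : ℝ) ^ 2)⁻¹) * ((n : ℝ) - 1)⁻¹ * (h n ^ dimW p dx dy dz)⁻¹ := by rw [h1, h2]
      _ = _ := by ring
  rw [e]
  ring

/-- The conditional laws of `Y` and of `Z` are almost everywhere the marginals of the joint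
conditional law. As the laws themselves agree, one null set serves all `y` and `z`. -/
theorem ae_condCDF_eq (hY : ∀ t, Measurable (Y t)) (hZ : ∀ t, Measurable (Z t)) :
    ∀ᵐ u ∂(μ.map (condVec X Y Z p 0)), (∀ y, condCDF μ (Y 0) (condVec X Y Z p 0) y u =
      (condLaw μ X Y Z p u).fst.real (Set.Iic y)) ∧
      ∀ z, condCDF μ (Z 0) (condVec X Y Z p 0) z u = (condLaw μ X Y Z p u).snd.real (Set.Iic z) := by
  have hYZ : AEMeasurable (fun ω => (Y 0 ω, Z 0 ω)) μ := ((hY 0).prodMk (hZ 0)).aemeasurable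
  have h1 := condDistrib_comp (μ := μ) (mβ := inferInstance) (condVec X Y Z p 0) hYZ (f := Prod.fst) measurable_fst
  have h2 := condDistrib_comp (μ := μ) (mβ := inferInstance) (condVec X Y Z p 0) hYZ (f := Prod.snd) measurable_snd
  filter_upwards [h1, h2] with u hu1 hu2
  rw [Kernel.map_apply _ measurable_fst] at hu1
  rw [Kernel.map_apply _ measurable_snd] at hu2
  refine ⟨fun y => ?_, fun z => ?_⟩
  · unfold condCDF Measure.fst
    rw [← hu1]
    rfl
  · unfold condCDF Measure.snd
    rw [← hu2]
    rfl

theorem condCDF₂_eq (y : Fin dy → ℝ) (z : Fin dz → ℝ) (u : WSpace p dx dy dz) :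
    condCDF₂ μ (Y 0) (Z 0) (condVec X Y Z p 0) y z u = (condLaw μ X Y Z p u).real (Set.Iic (y, z)) := by
  unfold condCDF₂
  rw [Set.Iic_prod_Iic]

theorem measurable_condCDF {d : ℕ} {ι : Type*} [Fintype ι] (U : Ω → Fin d → ℝ) (W : Ω → ι → ℝ) (y : Fin d → ℝ) :
    Measurable (condCDF μ U W y) :=
  ((condDistrib U W μ).measurable_coe measurableSet_Iic).ennreal_toReal

theorem limitFun_eq_indepLimit (hX : ∀ t, Measurable (X t)) (hY : ∀ t, Measurable (Y t))
    (hZ : ∀ t, Measurable (Z t)) {fW : WSpace p dx dy dz → ℝ≥0∞} (hfW : Measurable fW)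
    (hP : μ.map (condVec X Y Z p 0) = volume.withDensity fW)
    {φ : WSpace p dx dy dz → WSpace p dx dy dz → 𝕜} {w : WSpace p dx dy dz} (hφ : Measurable fun u => φ u w)
    (y : Fin dy → ℝ) (z : Fin dz → ℝ) :
    limitFun μ X Y Z p φ w y z =
      indepLimit (μ.map (condVec X Y Z p 0)) (condLaw μ X Y Z p) fW φ (w, (y, z)) := by
  set W := condVec X Y Z p 0 with hW
  have hWm : Measurable W := measurable_condVec hX hY hZ 0
  set G : WSpace p dx dy dz → 𝕜 := fun u => φ u w * (((condCDF₂ μ (Y 0) (Z 0) W y z u -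
    condCDF μ (Y 0) W y u * condCDF μ (Z 0) W z u) * (pdf W μ volume u).toReal : ℝ) : 𝕜) with hG
  have hGm : Measurable G := by
    have h1 := measurable_condCDF (μ := μ) (Y 0) W y
    have h2 := measurable_condCDF (μ := μ) (Z 0) W z
    have h3 : Measurable (condCDF₂ μ (Y 0) (Z 0) W y z) :=
      ((condDistrib _ W μ).measurable_coe (measurableSet_Iic.prod measurableSet_Iic)).ennreal_toReal
    have h4 : Measurable (pdf W μ volume) := measurable_pdf W μ volume
    exact hφ.mul (RCLike.measurable_ofReal.comp ((h3.sub (h1.mul h2)).mul h4.ennreal_toReal))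
  have e1 : limitFun μ X Y Z p φ w y z = ∫ ω, G (W ω) ∂μ := rfl
  rw [e1, ← integral_map hWm.aemeasurable hGm.aestronglyMeasurable]
  refine integral_congr_ae ?_
  have hpdf : pdf W μ volume =ᵐ[μ.map W] fW := by
    have h1 : pdf W μ volume =ᵐ[volume] fW := by
      rw [pdf_def, hP]
      exact Measure.rnDeriv_withDensity volume hfW
    have h2 : μ.map W ≪ volume := by rw [hP]; exact withDensity_absolutelyContinuous _ _
    exact h2.ae_le h1
  filter_upwards [hpdf, ae_condCDF_eq (μ := μ) (X := X) (p := p) hY hZ] with u h1 h2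
  simp only [hG, h1]
  simp only [dependence, h2.1 y, h2.2 z, hW, condCDF₂_eq]

theorem nullHypothesis_of_dependence (hY : ∀ t, Measurable (Y t))
    (hZ : ∀ t, Measurable (Z t)) {fW : WSpace p dx dy dz → ℝ≥0∞} {M : ℝ≥0} (hfW : Measurable fW)
    (hle : ∀ u, fW u ≤ M) (hP : μ.map (condVec X Y Z p 0) = volume.withDensity fW)
    (h0 : ∀ r, dependence (condLaw μ X Y Z p) fW r =ᵐ[μ.map (condVec X Y Z p 0)] 0) :
    NullHypothesis μ X Y Z p := by
  intro y z
  filter_upwards [(dependence_ae_eq_zero_iff hfW hle hP (y, z)).1 (h0 (y, z)),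
    ae_condCDF_eq (μ := μ) (X := X) (p := p) hY hZ] with u h1 h2
  rw [h2.1 y, h2.2 z, condCDF₂_eq]
  exact h1

theorem nullHypothesis_of_eq_prod (hY : ∀ t, Measurable (Y t)) (hZ : ∀ t, Measurable (Z t))
    (h0 : ∀ᵐ u ∂(μ.map (condVec X Y Z p 0)), condLaw μ X Y Z p u =
      (condLaw μ X Y Z p u).fst.prod (condLaw μ X Y Z p u).snd) : NullHypothesis μ X Y Z p := by
  intro y z
  filter_upwards [h0, ae_condCDF_eq (μ := μ) (X := X) (p := p) hY hZ] with u h1 h2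
  rw [h2.1 y, h2.2 z, condCDF₂_eq]
  conv_lhs => rw [h1]
  rw [← Set.Iic_prod_Iic, measureReal_prod_prod]

/-- The coordinates of `W_{t+p}` that are `Y_t` and `Z_t`. -/
def lastLag (hp : 0 < p) : WSpace p dx dy dz →ₗ[ℝ] (Fin dy → ℝ) × (Fin dz → ℝ) where
  toFun x := (fun b => x (⟨p - 1, by omega⟩, Sum.inr (Sum.inl b)), fun c => x (⟨p - 1, by omega⟩, Sum.inr (Sum.inr c)))
  map_add' _ _ := rfl
  map_smul' _ _ := rfl

theorem lastLag_surjective (hp : 0 < p) : Function.Surjective (lastLag (dx := dx) (dy := dy) (dz := dz) hp) := by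
  rintro ⟨y, z⟩
  exact ⟨fun i => Sum.elim (fun _ => 0) (Sum.elim y z) i.2, rfl⟩

/-- The windows `W_1` and `W_{1+p}` do not overlap, so they have a joint density; and `Y_1`, `Z_1`
are the oldest entries of `W_{1+p}`. Thus `(W_1, Y_1, Z_1)` is a surjective linear image of an
absolutely continuous vector. Stationarity gives the claim at index `0`. -/
theorem absolutelyContinuous_obsVec (hp : 0 < p) (hX : ∀ t, Measurable (X t)) (hY : ∀ t, Measurable (Y t))
    (hZ : ∀ t, Measurable (Z t)) (hs : StrictlyStationary μ (obs X Y Z)) (hJ : JointDensityAssumption μ X Y Z p) :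
    μ.map (obsVec X Y Z p 0) ≪ (volume : Measure (WSpace p dx dy dz)).prod volume := by
  obtain ⟨M, hM⟩ := exists_joint_density_le hX hY hZ hJ
  have hm := measurable_condVec (p := p) hX hY hZ
  have h1 := (hM 1 (1 + p) le_rfl (by omega) (by omega) (by simp)).absolutelyContinuous
  set A : WSpace p dx dy dz × WSpace p dx dy dz →ₗ[ℝ] ObsSpace (WIdx p dx dy dz) dy dz :=
    LinearMap.prodMap LinearMap.id (lastLag hp) with hA
  have hAm : Measurable A := (LinearMap.continuous_of_finiteDimensional _).measurable
  have hAs : Function.Surjective A := Function.Surjective.prodMap Function.surjective_id (lastLag_surjective hp)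
  have hrep : obsVec X Y Z p 1 = A ∘ fun ω => (condVec X Y Z p 1 ω, condVec X Y Z p (1 + p) ω) := by
    ext1 ω
    have e : (1 : ℤ) + p - ((p - 1 : ℕ) : ℤ) - 1 = 1 := by omega
    simp only [obsVec, Function.comp_apply, hA, LinearMap.prodMap_apply, LinearMap.id_apply, lastLag,
      LinearMap.coe_mk, AddHom.coe_mk, condVec, e]
  have i1 : (volume : Measure ((Fin dy → ℝ) × (Fin dz → ℝ))).IsAddHaarMeasure :=
    Measure.prod.instIsAddHaarMeasure _ _
  have i2 : (volume : Measure (WSpace p dx dy dz × WSpace p dx dy dz)).IsAddHaarMeasure :=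
    Measure.prod.instIsAddHaarMeasure _ _
  have i4 : SigmaFinite (volume : Measure ((Fin dy → ℝ) × (Fin dz → ℝ))) :=
    inferInstanceAs (SigmaFinite (volume.prod volume))
  have i3 : ((volume : Measure (WSpace p dx dy dz)).prod
      (volume : Measure ((Fin dy → ℝ) × (Fin dz → ℝ)))).IsAddHaarMeasure :=
    Measure.prod.instIsAddHaarMeasure _ _
  obtain ⟨c, -, hc⟩ := A.exists_map_addHaar_eq_smul_addHaar volume
    ((volume : Measure (WSpace p dx dy dz)).prod volume) hAs
  rw [← map_obsVec_eq hX hY hZ hs 1, hrep, ← Measure.map_map hAm ((hm 1).prodMk (hm (1 + p)))]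
  refine (h1.map hAm).trans ?_
  rw [hc]
  exact Measure.smul_absolutelyContinuous

end Link

/-! ### The two statistics and the hypotheses of the limit theorems -/

section Statistics

variable {Ω : Type*} [MeasurableSpace Ω] {μ : Measure Ω} [IsProbabilityMeasure μ] {𝕜 : Type*} [RCLike 𝕜]
  {dx dy dz p : ℕ} {X : ℤ → Ω → Fin dx → ℝ} {Y : ℤ → Ω → Fin dy → ℝ} {Z : ℤ → Ω → Fin dz → ℝ}

theorem inv_sqrt_mul_ksStat (𝒲 : Set (WSpace p dx dy dz)) (φ : WSpace p dx dy dz → WSpace p dx dy dz → 𝕜)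
    (k : ℝ → ℝ) (h : ℕ → ℝ) (n : ℕ) (ω : Ω) :
    (√(n : ℝ))⁻¹ * ksStat X Y Z p 𝒲 φ k h n ω =
      ⨆ q : ↥(𝒲 ×ˢ (Set.univ : Set ((Fin dy → ℝ) × (Fin dz → ℝ)))),
        ‖indepStat (obsVec X Y Z p) (prodKernel k) h φ n q ω‖ := by
  unfold ksStat
  rw [Real.mul_iSup_of_nonneg (by positivity)]
  let e : ↥(𝒲 ×ˢ (Set.univ : Set ((Fin dy → ℝ) × (Fin dz → ℝ)))) ≃ 𝒲 × (Fin dy → ℝ) × (Fin dz → ℝ) :=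
    { toFun := fun q => (⟨q.1.1, q.2.1⟩, q.1.2)
      invFun := fun q => ⟨(q.1.1, q.2), q.1.2, trivial⟩
      left_inv := fun _ => rfl
      right_inv := fun _ => rfl }
  rw [← e.iSup_comp]
  refine iSup_congr fun q => ?_
  have h1 := inv_sqrt_smul_empS (X := X) (Y := Y) (Z := Z) φ k h n q.1.1 q.1.2.1 q.1.2.2 ω
  rw [show (q : WSpace p dx dy dz × ((Fin dy → ℝ) × (Fin dz → ℝ))) = (q.1.1, (q.1.2.1, q.1.2.2)) from rfl,
    ← h1, norm_smul, Real.norm_of_nonneg (by positivity)]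
  rfl

theorem inv_mul_cvmStat (φ : WSpace p dx dy dz → WSpace p dx dy dz → 𝕜)
    (k : ℝ → ℝ) (h : ℕ → ℝ) (n : ℕ) (ω : Ω) :
    (n : ℝ)⁻¹ * cvmStat X Y Z p φ k h n ω = (n : ℝ)⁻¹ * ∑ t ∈ Finset.Icc (1 : ℤ) n,
      ‖indepStat (obsVec X Y Z p) (prodKernel k) h φ n (obsVec X Y Z p t ω) ω‖ ^ 2 := by
  unfold cvmStat
  congr 1
  rw [Finset.mul_sum]
  refine Finset.sum_congr rfl fun t _ => ?_
  have h1 := inv_sqrt_smul_empS (X := X) (Y := Y) (Z := Z) φ k h n (condVec X Y Z p t ω) (Y t ω) (Z t ω) ω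
  rw [show obsVec X Y Z p t ω = (condVec X Y Z p t ω, (Y t ω, Z t ω)) from rfl, ← h1, norm_smul, mul_pow,
    norm_inv, inv_pow, Real.norm_of_nonneg (Real.sqrt_nonneg _), Real.sq_sqrt (by positivity)]

theorem ae_forall_condVec_mem_support (hX : ∀ t, Measurable (X t)) (hY : ∀ t, Measurable (Y t))
    (hZ : ∀ t, Measurable (Z t)) (hs : StrictlyStationary μ (obs X Y Z)) :
    ∀ᵐ ω ∂μ, ∀ t, (obsVec X Y Z p t ω).1 ∈ (μ.map (condVec X Y Z p 0)).support := by
  refine ae_all_iff.2 fun t => ?_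
  have hm := measurable_obsVec (p := p) hX hY hZ
  have h1 : μ.map (condVec X Y Z p 0) = (μ.map (obsVec X Y Z p t)).map Prod.fst := by
    rw [map_obsVec_eq hX hY hZ hs t, Measure.map_map measurable_fst (hm 0)]
    rfl
  have h2 : ∀ᵐ u ∂(μ.map (condVec X Y Z p 0)), u ∈ (μ.map (condVec X Y Z p 0)).support :=
    Measure.support_mem_ae
  conv at h2 => rw [h1]
  rw [Measure.map_map measurable_fst (hm t)] at h2
  have h3 := ae_of_ae_map (measurable_fst.comp (hm t)).aemeasurable h2
  rw [← Measure.map_map measurable_fst (hm t), ← h1] at h3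
  exact h3

theorem tailCondition_obsVec (hX : ∀ t, Measurable (X t)) (hY : ∀ t, Measurable (Y t))
    (hZ : ∀ t, Measurable (Z t)) {a : ℕ → ℝ} {h : ℕ → ℝ} {k : ℝ → ℝ}
    (hD : KernelDesign μ (obsVec X Y Z p) (μ.map (condVec X Y Z p 0) ⊗ₘ condLaw μ X Y Z p) a Prod.fst h)
    (hreg : (∃ B : ℝ, ∀ᵐ ω ∂μ, ‖condVec X Y Z p 0 ω‖ ≤ B) ∨ HasMonotoneMajorant k) :
    TailCondition μ (obsVec X Y Z p) Prod.fst (prodKernel k) h := by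
  rcases hreg with ⟨B, hB⟩ | hk
  · refine tailCondition_of_bounded hD.mixing (R := B) ?_
    rw [← map_obsVec_eq_compProd hY hZ, ae_map_iff (measurable_obsVec hX hY hZ 0).aemeasurable
      (measurableSet_le measurable_fst.norm measurable_const)]
    exact hB
  · exact hD.tailCondition_of_majorant hk

theorem nullSingletonClass_obsVec (hX : ∀ t, Measurable (X t)) (hY : ∀ t, Measurable (Y t))
    (hZ : ∀ t, Measurable (Z t)) (hMarg : MarginalDensityAssumption μ Y Z) :
    (∀ i, NullSingletonClass ((μ.map (condVec X Y Z p 0) ⊗ₘ condLaw μ X Y Z p).map fun x => x.2.1 i)) ∧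
      ∀ i, NullSingletonClass ((μ.map (condVec X Y Z p 0) ⊗ₘ condLaw μ X Y Z p).map fun x => x.2.2 i) := by
  obtain ⟨⟨MY, hMY⟩, MZ, hMZ⟩ := hMarg
  have hm := measurable_obsVec (p := p) hX hY hZ 0
  rw [← map_obsVec_eq_compProd hY hZ]
  constructor
  · refine fun i => nullSingletonClass_map_eval (y := fun x : ObsSpace (WIdx p dx dy dz) dy dz => x.2.1) (by fun_prop) ?_ i
    rw [Measure.map_map (by fun_prop) hm]
    exact hMY.absolutelyContinuous
  · refine fun i => nullSingletonClass_map_eval (y := fun x : ObsSpace (WIdx p dx dy dz) dy dz => x.2.2) (by fun_prop) ?_ i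
    rw [Measure.map_map (by fun_prop) hm]
    exact hMZ.absolutelyContinuous

/-- A revealing weight detects a violation of conditional independence at some point of `𝒲`. -/
theorem exists_indepLimit_ne_zero (hY : ∀ t, Measurable (Y t)) (hZ : ∀ t, Measurable (Z t))
    {fW : WSpace p dx dy dz → ℝ≥0∞} {M : ℝ≥0} (hfW : Measurable fW) (hle : ∀ u, fW u ≤ M)
    (hP : μ.map (condVec X Y Z p 0) = volume.withDensity fW) {𝒲 : Set (WSpace p dx dy dz)}
    {φ : WSpace p dx dy dz → WSpace p dx dy dz → 𝕜}
    (hφ : IsCR (μ.map (condVec X Y Z p 0)) 𝒲 φ ∨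
      (IsGCR (μ.map (condVec X Y Z p 0)) 𝒲 φ ∧ (interior 𝒲).Nonempty))
    (hH1 : ¬ NullHypothesis μ X Y Z p) :
    ∃ q ∈ 𝒲 ×ˢ Set.univ, indepLimit (μ.map (condVec X Y Z p 0)) (condLaw μ X Y Z p) fW φ q ≠ 0 := by
  have h1 : ∃ r, ¬ dependence (condLaw μ X Y Z p) fW r =ᵐ[μ.map (condVec X Y Z p 0)] 0 := by
    by_contra! h0
    exact hH1 (nullHypothesis_of_dependence hY hZ hfW hle hP h0)
  obtain ⟨r, hr⟩ := h1
  have hm : Measurable (dependence (condLaw μ X Y Z p) fW r) := measurable_dependence hfW r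
  have hb : ∃ B, ∀ u, |dependence (condLaw μ X Y Z p) fW r u| ≤ B := ⟨_, abs_dependence_le hle r⟩
  suffices ∃ w ∈ 𝒲, indepLimit (μ.map (condVec X Y Z p 0)) (condLaw μ X Y Z p) fW φ (w, r) ≠ 0 by
    obtain ⟨w, hw, h⟩ := this
    exact ⟨(w, r), ⟨hw, trivial⟩, h⟩
  rcases hφ with hφ | ⟨hφ, hne⟩
  · exact hφ _ hm hb hr
  · have h2 := hφ _ hm hb hr
    -- A nonempty open set is not Lebesgue null, so it meets the set of revealing points.
    have hpos : volume (interior 𝒲) ≠ 0 := (isOpen_interior.measure_pos _ hne).ne'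
    have h3 : ∃ᵐ w ∂(volume : Measure (WSpace p dx dy dz)), w ∈ interior 𝒲 := frequently_ae_mem_iff.2 hpos
    obtain ⟨w, hw, h4⟩ := (h3.and_eventually h2).exists
    exact ⟨w, interior_subset hw, h4 (interior_subset hw)⟩

end Statistics

end CondIndepTest

end

/-! ### Power of the two tests -/

open CondIndepTest

theorem theorem2 {Ω : Type*} [MeasurableSpace Ω] (μ : Measure Ω) [IsProbabilityMeasure μ]
    {𝕜 : Type*} [RCLike 𝕜] {dx dy dz : ℕ} (p : ℕ) (hp : 0 < p)
    (X : ℤ → Ω → Fin dx → ℝ) (Y : ℤ → Ω → Fin dy → ℝ) (Z : ℤ → Ω → Fin dz → ℝ)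
    (hX : ∀ t, Measurable (X t)) (hY : ∀ t, Measurable (Y t)) (hZ : ∀ t, Measurable (Z t))
    (𝒲 : Set (CondIndepTest.WSpace p dx dy dz)) (h𝒲 : Bornology.IsBounded 𝒲)
    (φ : CondIndepTest.WSpace p dx dy dz → CondIndepTest.WSpace p dx dy dz → 𝕜)
    (k : ℝ → ℝ) (h : ℕ → ℝ) (m l : ℕ) (η ν : ℝ)
    (hMarkov : CondIndepTest.MarkovProperty μ X Y Z p)
    (hMix : CondIndepTest.MixingAssumption μ X Y Z p m η)
    (hWeight : CondIndepTest.WeightAssumption (μ.map (CondIndepTest.condVec X Y Z p 0)) 𝒲 φ ν)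
    (hKernel : CondIndepTest.KernelAssumption k l)
    (hBand : CondIndepTest.BandwidthAssumption h (CondIndepTest.dimW p dx dy dz) l)
    (hJoint : CondIndepTest.JointDensityAssumption μ X Y Z p)
    (hMarg : CondIndepTest.MarginalDensityAssumption μ Y Z)
    (hHolder : CondIndepTest.HolderAssumption μ X Y Z p η)
    (hreg : (∃ B : ℝ, ∀ᵐ ω ∂μ, ‖CondIndepTest.condVec X Y Z p 0 ω‖ ≤ B) ∨
      CondIndepTest.HasMonotoneMajorant k)
    (hH1 : ¬ CondIndepTest.NullHypothesis μ X Y Z p) :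
    (∀ w ∈ 𝒲, ∀ (y : Fin dy → ℝ) (z : Fin dz → ℝ),
      TendstoInMeasure μ
        (fun (n : ℕ) ω => (√(n : ℝ))⁻¹ • CondIndepTest.empS X Y Z p φ k h n w y z ω)
        atTop (fun _ => CondIndepTest.limitFun μ X Y Z p φ w y z)) ∧
    ((CondIndepTest.IsCR (μ.map (CondIndepTest.condVec X Y Z p 0)) 𝒲 φ ∨
        (CondIndepTest.IsGCR (μ.map (CondIndepTest.condVec X Y Z p 0)) 𝒲 φ ∧
          (interior 𝒲).Nonempty)) →
      (∃ c : ℝ, 0 < c ∧ TendstoInMeasure μ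
        (fun (n : ℕ) ω => (√(n : ℝ))⁻¹ * CondIndepTest.ksStat X Y Z p 𝒲 φ k h n ω)
        atTop (fun _ => c)) ∧
      CondIndepTest.DivergesInProbability μ (CondIndepTest.ksStat X Y Z p 𝒲 φ k h) ∧
      CondIndepTest.ConsistentTests μ (CondIndepTest.ksStat X Y Z p 𝒲 φ k h)) ∧
    (CondIndepTest.IsGCR (μ.map (CondIndepTest.condVec X Y Z p 0)) 𝒲 φ →
      (∀ᵐ u ∂(μ.map (CondIndepTest.condVec X Y Z p 0)), u ∈ 𝒲) →
      (∃ c : ℝ, 0 < c ∧ TendstoInMeasure μ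
        (fun (n : ℕ) ω => (n : ℝ)⁻¹ * CondIndepTest.cvmStat X Y Z p φ k h n ω)
        atTop (fun _ => c)) ∧
      CondIndepTest.DivergesInProbability μ (CondIndepTest.cvmStat X Y Z p φ k h) ∧
      CondIndepTest.ConsistentTests μ (CondIndepTest.cvmStat X Y Z p φ k h)) := by
  have hs := hMix.1
  obtain ⟨M, fW, hfW, hle, hP⟩ := exists_hasDensityLE_condVec hX hY hZ hs hJoint
  have : IsProbabilityMeasure (μ.map (condVec X Y Z p 0)) :=
    Measure.isProbabilityMeasure_map (measurable_condVec hX hY hZ 0).aemeasurable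
  have hD := kernelDesign_obsVec hX hY hZ hMix hJoint hBand
  have htail := tailCondition_obsVec hX hY hZ hD hreg
  obtain ⟨hki, hk1⟩ := hKernel.integral_eq_one hBand
  obtain ⟨Bk, hBk⟩ := hKernel.2.1
  obtain ⟨B, C, hφ⟩ := hWeight.exists_regularWeights
  obtain ⟨hYn, hZn⟩ := nullSingletonClass_obsVec (p := p) hX hY hZ hMarg
  set P := μ.map (condVec X Y Z p 0) with hPdef
  set κ := condLaw μ X Y Z p with hκ
  set S : Set (ObsSpace (WIdx p dx dy dz) dy dz) := 𝒲 ×ˢ Set.univ with hS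
  set L := indepLimit P κ fW φ with hL
  have hpt : ∀ q ∈ S, TendstoInMeasure μ
      (fun n => indepStat (obsVec X Y Z p) (prodKernel k) h (cutoff P φ) n q) atTop fun _ => L q := by
    intro q hq
    rw [hL, ← indepLimit_cutoff]
    exact tendstoInMeasure_indepStat hD hfW hle hP (measurable_prodKernel hKernel.1) (integrable_prodKernel hki)
      (abs_prodKernel_le hBk) (integral_prodKernel hk1) htail q (hφ.measurable _ hq.1) fun u => hφ.bound u _ hq.1
  have hbr : HasBrackets μ S (indepStat (obsVec X Y Z p) (prodKernel k) h (cutoff P φ)) :=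
    hasBrackets_indepStat hD hfW hle hP (measurable_prodKernel hKernel.1) (integrable_prodKernel hki)
      (abs_prodKernel_le hBk) htail hφ h𝒲 hYn hZn
  have hunif := hbr.uniformInProbability hpt
  have hosc := hbr.hasSmallOscillation hpt
  obtain ⟨BL, hBL0, hBL⟩ := hosc.bounded
  -- The limit theorems are proved for the cut-off weight; almost surely all `W_t` lie in the
  -- support, and there the two processes coincide.
  have hsupp : ∀ᵐ ω ∂μ, ∀ n q, indepStat (obsVec X Y Z p) (prodKernel k) h (cutoff P φ) n q ω =
      indepStat (obsVec X Y Z p) (prodKernel k) h φ n q ω := by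
    filter_upwards [ae_forall_condVec_mem_support (p := p) hX hY hZ hs] with ω hω n q
    exact indepStat_cutoff hω n q
  refine ⟨fun w hw y z => ?_, fun hrev => ?_, fun hgcr hW => ?_⟩
  · rw [limitFun_eq_indepLimit hX hY hZ hfW hP (hWeight.1 w hw)]
    refine (hpt (w, (y, z)) ⟨hw, trivial⟩).congr_left fun n => ?_
    filter_upwards [hsupp] with ω hω
    rw [inv_sqrt_smul_empS, hω]
  · obtain ⟨q, hq, hq0⟩ := exists_indepLimit_ne_zero hY hZ hfW hle hP hrev hH1
    have hc : 0 < ⨆ q : S, ‖L q‖ :=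
      (norm_pos_iff.2 hq0).trans_le (le_ciSup (f := fun q : S => ‖L q‖)
        ⟨BL, by rintro _ ⟨q, rfl⟩; exact hBL q q.2⟩ ⟨q, hq⟩)
    have hlim : TendstoInMeasure μ (fun (n : ℕ) ω => (√(n : ℝ))⁻¹ * ksStat X Y Z p 𝒲 φ k h n ω) atTop
        fun _ => ⨆ q : S, ‖L q‖ := by
      refine (hunif.tendstoInMeasure_iSup ⟨q, hq⟩ hBL).congr_left fun n => ?_
      filter_upwards [hsupp] with ω hω
      rw [inv_sqrt_mul_ksStat]
      simp only [hω]
      rfl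
    exact ⟨⟨_, hc, hlim⟩, consistentTests_of_tendstoInMeasure
      (Real.tendsto_sqrt_atTop.comp tendsto_natCast_atTop_atTop) hc hlim⟩
  · have hQS : ∀ᵐ v ∂(P ⊗ₘ κ), v ∈ S := by
      rw [← Measure.fst_compProd P κ] at hW
      filter_upwards [ae_of_ae_map measurable_fst.aemeasurable hW] with v hv using ⟨hv, trivial⟩
    have hLm : AEMeasurable L (P ⊗ₘ κ) := hosc.aemeasurable hQS
    have hac : P ⊗ₘ κ ≪ (volume : Measure (WSpace p dx dy dz)).prod volume := by
      rw [← map_obsVec_eq_compProd hY hZ]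
      exact absolutelyContinuous_obsVec hp hX hY hZ hs hJoint
    have hlim : TendstoInMeasure μ (fun (n : ℕ) ω => (n : ℝ)⁻¹ * cvmStat X Y Z p φ k h n ω) atTop
        fun _ => ∫ v, ‖L v‖ ^ 2 ∂(P ⊗ₘ κ) := by
      refine (hunif.tendstoInMeasure_avg_norm_sq hD.mixing hQS hBL0 hBL hLm.norm).congr_left fun n => ?_
      filter_upwards [hsupp] with ω hω
      rw [inv_mul_cvmStat]
      simp only [hω]
    have hint : Integrable (fun v => ‖L v‖ ^ 2) (P ⊗ₘ κ) := by
      refine .of_bound (hLm.norm.pow_const 2).aestronglyMeasurable (BL ^ 2) ?_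
      filter_upwards [hQS] with v hv
      rw [Real.norm_of_nonneg (by positivity)]
      exact pow_le_pow_left₀ (norm_nonneg _) (hBL v hv) 2
    -- If the integral were zero, `L` would vanish at almost every observation, the conditional laws
    -- would be products, and the null hypothesis would hold.
    have hc : 0 < ∫ v, ‖L v‖ ^ 2 ∂(P ⊗ₘ κ) := by
      refine (integral_nonneg fun v => by positivity).lt_of_ne' fun h0 => hH1 ?_
      rw [integral_eq_zero_iff_of_nonneg (fun v => by positivity) hint] at h0
      refine nullHypothesis_of_eq_prod hY hZ
        (ae_kernel_eq_prod_of_indepLimit hfW hle hP hgcr hW hosc hac ?_)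
      filter_upwards [h0] with v hv
      simpa using hv
    exact ⟨⟨_, hc, hlim⟩, consistentTests_of_tendstoInMeasure tendsto_natCast_atTop_atTop hc hlim⟩
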